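/- Let $G=(A,\Phi)$ be a compact quantum group: $A\neq 0$ is a unital $C^*$-algebra and $\Phi:A\to A\otimes A$ (minimal $C^*$-tensor product) is a unital $*$-homomorphism with $(\Phi\otimes\mathrm{id})\Phi=(\mathrm{id}\otimes\Phi)\Phi$ such that the linear spans of $(A\otimes 1)\Phi(A)$ and of $(1\otimes A)\Phi(A)$ are dense in $A\otimes A$. Let $\widehat G$ be the set of equivalence classes of irreducible finite-dimensional unitary representations of $G$, and let $[1_G]$ be the class of the trivial representation. For $a=[u^a]$ and $b=[u^b]$ in $\widehat G$ let $\bar a$ be the class of the conjugate representation of $u^a$, and let $a\times b\subseteq\widehat G$ be the set of classes of the irreducible subrepresentations of $u^a\otimes u^b$. For $S,T\subseteq\widehat G$ put $S\times T=\bigcup_{a\in S,\,b\in T}a\times b$. A subobject of $\widehat G$ is a subset $\Sigma\subseteq\widehat G$ that contains $[1_G]$ and is closed under $\times$ and under conjugation. It defines the relation $a\sim_\Sigma b\iff(a\times\bar b)\cap\Sigma\neq\emptyset$, whose classes are called $\Sigma$-cosets. The subobject $\Sigma$ is called central if the set $\widehat G/\Sigma$ of $\Sigma$-cosets is a group under the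 set-wise product $\times$. The center subobject $\widetilde\Sigma$ is the intersection of all central subobjects of $\widehat G$; the group $H_{\widetilde\Sigma}=\widehat G/\widetilde\Sigma$ is (the discrete dual of) the center of $G$. For $X,Y\in\widehat G$ write $X\sim_1 Y$ if there are $n\in\mathbb N$ and $z_1,\dots,z_n\in\widehat G$ with $X\in z_1\times\cdots\times z_n$ and $Y\in z_1\times\cdots\times z_n$ (the empty product is $\{[1_G]\}$). Put $c(G)=\widehat G/{\sim_1}$ and $\mathcal E_z=\{z\in\widehat G: z\sim_1[1_G]\}$. Then: 1. $\sim_1$ is an equivalence relation, and $c(G)$ is a group under the set-wise product of classes; its identity element is the class of $[1_G]$, and the inverse of the class of $a$ is the class of $\bar a$. 2. $\mathcal E_z$ is a central subobject of $\widehat G$, the relations $\sim_{\mathcal E_z}$ and $\sim_1$ coincide, and the map sending the $\sim_1$-class of $a$ to the $\mathcal E_z$-coset of $a$ is a group isomorphism $c(G)\cong\widehat G/\mathcal E_z$. 3. $\widetilde\Sigma=\mathcal E_z$. 4. Hence the map sending the $\sim_1$-class of $a$ to the $\widetilde\Sigma$-coset of $a$ is a group isomorphism $c(G)\cong\widehat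 G/\widetilde\Sigma=H_{\widetilde\Sigma}$; that is, the chain group is isomorphic to the dual of the center of $G$. -/

import Mathlib

noncomputable section

open scoped TensorProduct ENNReal
open UniformSpace (Completion)

universe u v w x y z

/-- The Hilbert space tensor product `H ⊗ K` of two Hilbert spaces: the completion of the algebraic
tensor product in its inner product `⟪x ⊗ y, x' ⊗ y'⟫ = ⟪x, x'⟫ ⟪y, y'⟫`. -/
def HilbertTensor (H : Type v) (K : Type w) [NormedAddCommGroup H] [InnerProductSpace ℂ H]
    [NormedAddCommGroup K] [InnerProductSpace ℂ K] : Type (max v w) :=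
  Completion (H ⊗[ℂ] K)

namespace HilbertTensor

variable {H : Type v} {K : Type w} [NormedAddCommGroup H] [InnerProductSpace ℂ H]
  [NormedAddCommGroup K] [InnerProductSpace ℂ K]

instance : NormedAddCommGroup (HilbertTensor H K) :=
  inferInstanceAs (NormedAddCommGroup (Completion (H ⊗[ℂ] K)))

instance : InnerProductSpace ℂ (HilbertTensor H K) :=
  inferInstanceAs (InnerProductSpace ℂ (Completion (H ⊗[ℂ] K)))

instance : CompleteSpace (HilbertTensor H K) :=
  inferInstanceAs (CompleteSpace (Completion (H ⊗[ℂ] K)))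

variable (H K) in
/-- The inclusion of the algebraic tensor product. -/
def incl : H ⊗[ℂ] K →ₗᵢ[ℂ] HilbertTensor H K := Completion.toComplₗᵢ

theorem denseRange_incl : DenseRange (incl H K) := Completion.denseRange_coe

theorem ext_incl {E : Type x} [NormedAddCommGroup E] [NormedSpace ℂ E]
    {S T : HilbertTensor H K →L[ℂ] E}
    (h : ∀ x y, S (incl H K (x ⊗ₜ y)) = T (incl H K (x ⊗ₜ y))) : S = T := by
  have h' : ∀ z, S (incl H K z) = T (incl H K z) := fun z => by
    induction z using TensorProduct.induction_on with
    | zero => simp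
    | tmul x y => exact h x y
    | add a b ha hb => simp only [map_add, ha, hb]
  ext z
  exact congrFun (denseRange_incl.equalizer S.continuous T.continuous (funext h')) z

instance [Nontrivial H] [Nontrivial K] : Nontrivial (HilbertTensor H K) := by
  obtain ⟨a, ha⟩ := exists_ne (0 : H)
  obtain ⟨b, hb⟩ := exists_ne (0 : K)
  refine ⟨⟨incl H K (a ⊗ₜ b), 0, fun h => ?_⟩⟩
  have h1 := congrArg norm h
  rw [LinearIsometry.norm_map, TensorProduct.norm_tmul, norm_zero] at h1
  rcases mul_eq_zero.1 h1 with h2 | h2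
  · exact ha (norm_eq_zero.1 h2)
  · exact hb (norm_eq_zero.1 h2)

/-- The operator `S ⊗ T` on `H ⊗ K`. -/
def map (S : H →L[ℂ] H) (T : K →L[ℂ] K) : HilbertTensor H K →L[ℂ] HilbertTensor H K :=
  ContinuousLinearMap.completion (TensorProduct.mapL S T)

theorem map_incl (S : H →L[ℂ] H) (T : K →L[ℂ] K) (z : H ⊗[ℂ] K) :
    map S T (incl H K z) = incl H K (TensorProduct.mapL S T z) :=
  ContinuousLinearMap.completion_apply_coe _ _

@[simp] theorem map_tmul (S : H →L[ℂ] H) (T : K →L[ℂ] K) (x : H) (y : K) :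
    map S T (incl H K (x ⊗ₜ y)) = incl H K (S x ⊗ₜ T y) :=
  map_incl S T _

theorem norm_map_le (S : H →L[ℂ] H) (T : K →L[ℂ] K) : ‖map S T‖ ≤ ‖S‖ * ‖T‖ := by
  refine ContinuousLinearMap.opNorm_le_bound _ (by positivity) fun z => ?_
  refine denseRange_incl.induction_on z (isClosed_le (by fun_prop) (by fun_prop)) fun z => ?_
  rw [map_incl, LinearIsometry.norm_map, LinearIsometry.norm_map]
  exact (TensorProduct.mapL S T).le_of_opNorm_le (TensorProduct.norm_mapL_le S T) z

theorem map_one : map (1 : H →L[ℂ] H) (1 : K →L[ℂ] K) = 1 :=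
  ext_incl fun x y => by simp

theorem map_mul (S S' : H →L[ℂ] H) (T T' : K →L[ℂ] K) :
    map (S * S') (T * T') = map S T * map S' T' :=
  ext_incl fun x y => by simp

theorem map_star [CompleteSpace H] [CompleteSpace K] (S : H →L[ℂ] H) (T : K →L[ℂ] K) :
    map (star S) (star T) = star (map S T) := by
  rw [ContinuousLinearMap.star_eq_adjoint, ContinuousLinearMap.star_eq_adjoint,
    ContinuousLinearMap.star_eq_adjoint, ContinuousLinearMap.eq_adjoint_iff]
  intro a b
  refine denseRange_incl.induction_on a (isClosed_eq (by fun_prop) (by fun_prop)) fun a => ?_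
  refine denseRange_incl.induction_on b (isClosed_eq (by fun_prop) (by fun_prop)) fun b => ?_
  simp only [map_incl, LinearIsometry.inner_map_map]
  induction a using TensorProduct.induction_on with
  | zero => simp
  | add a a' ha ha' => simp only [map_add, inner_add_left, ha, ha']
  | tmul a a' =>
    induction b using TensorProduct.induction_on with
    | zero => simp
    | add a a' ha ha' => simp only [map_add, inner_add_right, ha, ha']
    | tmul b b' => simp [ContinuousLinearMap.adjoint_inner_left]

variable (H K) in
/-- The bilinear map `(S, T) ↦ S ⊗ T`. -/
def mapₗ : (H →L[ℂ] H) →ₗ[ℂ] (K →L[ℂ] K) →ₗ[ℂ] (HilbertTensor H K →L[ℂ] HilbertTensor H K) :=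
  LinearMap.mk₂ ℂ map
    (fun S S' T => ext_incl fun x y => by simp [TensorProduct.add_tmul])
    (fun c S T => ext_incl fun x y => by simp [← TensorProduct.smul_tmul'])
    (fun S T T' => ext_incl fun x y => by simp [TensorProduct.tmul_add])
    (fun c S T => ext_incl fun x y => by simp)

variable {L : Type x} [NormedAddCommGroup L] [InnerProductSpace ℂ L]

variable (H K L) in
/-- The inclusion of `(H ⊙ K) ⊙ L` into `(H ⊗ K) ⊗ L`. -/
def inclLeft : (H ⊗[ℂ] K) ⊗[ℂ] L →ₗᵢ[ℂ] HilbertTensor (HilbertTensor H K) L :=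
  (incl (HilbertTensor H K) L).comp ((incl H K).rTensor L)

variable (H K L) in
/-- The inclusion of `H ⊙ (K ⊙ L)` into `H ⊗ (K ⊗ L)`. -/
def inclRight : H ⊗[ℂ] (K ⊗[ℂ] L) →ₗᵢ[ℂ] HilbertTensor H (HilbertTensor K L) :=
  (incl H (HilbertTensor K L)).comp ((incl K L).lTensor H)

theorem continuous_incl_tmul : Continuous fun p : H × K => incl H K (p.1 ⊗ₜ p.2) :=
  (incl H K).continuous.comp TensorProduct.continuous_tmul

theorem denseRange_of_tmul {E : Type x} [AddCommGroup E] [Module ℂ E]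
    (f : E →ₗ[ℂ] HilbertTensor H K)
    (h : ∀ x y, incl H K (x ⊗ₜ y) ∈ closure (Set.range f)) : DenseRange f := by
  have hcl : ∀ z, incl H K z ∈ f.range.topologicalClosure := fun z => by
    induction z using TensorProduct.induction_on with
    | zero => rw [_root_.map_zero]; exact zero_mem _
    | add a b ha hb => rw [map_add]; exact add_mem ha hb
    | tmul x y => exact h x y
  intro z
  exact denseRange_incl.induction_on z isClosed_closure hcl

theorem denseRange_inclLeft : DenseRange (inclLeft H K L) := by
  refine denseRange_of_tmul (inclLeft H K L).toLinearMap fun x y => ?_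
  have hc : Continuous fun x => incl (HilbertTensor H K) L (x ⊗ₜ y) :=
    continuous_incl_tmul.comp (Continuous.prodMk_left y)
  have hx : x ∈ closure (Set.range (incl H K)) := denseRange_incl x
  refine closure_mono ?_ (image_closure_subset_closure_image hc ⟨x, hx, rfl⟩)
  rintro _ ⟨_, ⟨z, rfl⟩, rfl⟩
  exact ⟨z ⊗ₜ y, rfl⟩

theorem denseRange_inclRight : DenseRange (inclRight H K L) := by
  refine denseRange_of_tmul (inclRight H K L).toLinearMap fun x y => ?_
  have hc : Continuous fun y => incl H (HilbertTensor K L) (x ⊗ₜ y) :=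
    continuous_incl_tmul.comp (Continuous.prodMk_right x)
  have hy : y ∈ closure (Set.range (incl K L)) := denseRange_incl y
  refine closure_mono ?_ (image_closure_subset_closure_image hc ⟨y, hy, rfl⟩)
  rintro _ ⟨_, ⟨z, rfl⟩, rfl⟩
  exact ⟨x ⊗ₜ z, rfl⟩

variable (H K L) in
/-- The unitary `(H ⊗ K) ⊗ L ≃ H ⊗ (K ⊗ L)`. -/
def assoc : HilbertTensor (HilbertTensor H K) L ≃ₗᵢ[ℂ] HilbertTensor H (HilbertTensor K L) :=
  LinearEquiv.extendOfIsometry (TensorProduct.assoc ℂ H K L)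
    (inclLeft H K L).toLinearMap (inclRight H K L).toLinearMap
    denseRange_inclLeft denseRange_inclRight fun x =>
      ((inclRight H K L).norm_map _).trans
        ((TensorProduct.norm_assoc x).trans ((inclLeft H K L).norm_map x).symm)

@[simp] theorem assoc_tmul (x : H) (y : K) (z : L) :
    assoc H K L (incl _ _ (incl _ _ (x ⊗ₜ y) ⊗ₜ z)) = incl _ _ (x ⊗ₜ incl _ _ (y ⊗ₜ z)) :=
  LinearEquiv.extendOfIsometry_eq (TensorProduct.assoc ℂ H K L)
    (inclLeft H K L).toLinearMap (inclRight H K L).toLinearMap _ _ _ ((x ⊗ₜ y) ⊗ₜ z)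

end HilbertTensor

/-- A unital *-representation of a *-algebra `X` on a non-zero Hilbert space. -/
structure HilbertRep (X : Type v) [Ring X] [StarRing X] [Algebra ℂ X] : Type (max v (u + 1)) where
  H : Type u
  [normedH : NormedAddCommGroup H]
  [innerH : InnerProductSpace ℂ H]
  [completeH : CompleteSpace H]
  [nontrivialH : Nontrivial H]
  rep : X →⋆ₐ[ℂ] (H →L[ℂ] H)

namespace HilbertRep

attribute [instance] normedH innerH completeH nontrivialH

variable {X : Type v} [Ring X] [StarRing X] [Algebra ℂ X]
variable {Y : Type w} [Ring Y] [StarRing Y] [Algebra ℂ Y]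

/-- The homomorphism `a ⊗ b ↦ π(a) ⊗ ρ(b)`. -/
def tensorAlgHom (π : HilbertRep.{u} X) (ρ : HilbertRep.{u} Y) :
    X ⊗[ℂ] Y →ₐ[ℂ] (HilbertTensor π.H ρ.H →L[ℂ] HilbertTensor π.H ρ.H) :=
  Algebra.TensorProduct.algHomOfLinearMapTensorProduct
    (TensorProduct.lift ((HilbertTensor.mapₗ π.H ρ.H).compl₁₂
      π.rep.toAlgHom.toLinearMap ρ.rep.toAlgHom.toLinearMap))
    (fun a a' b b' => by simp [HilbertTensor.mapₗ, HilbertTensor.map_mul])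
    (by simp [HilbertTensor.mapₗ, HilbertTensor.map_one])

theorem tensorAlgHom_tmul (π : HilbertRep.{u} X) (ρ : HilbertRep.{u} Y) (a : X) (b : Y) :
    tensorAlgHom π ρ (a ⊗ₜ b) = HilbertTensor.map (π.rep a) (ρ.rep b) := rfl

variable [StarModule ℂ X] [StarModule ℂ Y]

theorem tensorAlgHom_star (π : HilbertRep.{u} X) (ρ : HilbertRep.{u} Y) (x : X ⊗[ℂ] Y) :
    tensorAlgHom π ρ (star x) = star (tensorAlgHom π ρ x) := by
  induction x using TensorProduct.induction_on with
  | zero => simp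
  | add a b ha hb => simp only [star_add, map_add, ha, hb]
  | tmul a b =>
    rw [TensorProduct.star_tmul, tensorAlgHom_tmul, tensorAlgHom_tmul, map_star, map_star,
      HilbertTensor.map_star]

/-- The representation `π ⊗ ρ` of the algebraic tensor product on the Hilbert space `H_π ⊗ H_ρ`. -/
abbrev tensor (π : HilbertRep.{u} X) (ρ : HilbertRep.{u} Y) : HilbertRep.{u} (X ⊗[ℂ] Y) where
  H := HilbertTensor π.H ρ.H
  rep := { tensorAlgHom π ρ with map_star' := tensorAlgHom_star π ρ }

theorem tensor_rep_tmul (π : HilbertRep.{u} X) (ρ : HilbertRep.{u} Y) (a : X) (b : Y) :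
    (π.tensor ρ).rep (a ⊗ₜ b) = HilbertTensor.map (π.rep a) (ρ.rep b) := rfl

theorem norm_rep_le {A : Type v} [CStarAlgebra A] (π : HilbertRep.{u} A) (a : A) :
    ‖π.rep a‖ ≤ ‖a‖ := NonUnitalStarAlgHom.norm_apply_le π.rep a

theorem exists_norm_tensor_le (x : X ⊗[ℂ] Y) (p : X → ℝ) (q : Y → ℝ) (hp : ∀ a, 0 ≤ p a) :
    ∃ M, ∀ (π : HilbertRep.{u} X) (ρ : HilbertRep.{u} Y), (∀ a, ‖π.rep a‖ ≤ p a) →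
      (∀ b, ‖ρ.rep b‖ ≤ q b) → ‖(π.tensor ρ).rep x‖ ≤ M := by
  induction x using TensorProduct.induction_on with
  | zero => exact ⟨0, fun π ρ _ _ => by simp⟩
  | add x y hx hy =>
    obtain ⟨M, hM⟩ := hx
    obtain ⟨N, hN⟩ := hy
    refine ⟨M + N, fun π ρ h1 h2 => ?_⟩
    rw [map_add]
    exact (norm_add_le _ _).trans (add_le_add (hM π ρ h1 h2) (hN π ρ h1 h2))
  | tmul a b =>
    refine ⟨p a * q b, fun π ρ h1 h2 => ?_⟩
    rw [tensor_rep_tmul]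
    exact (HilbertTensor.norm_map_le _ _).trans
      (mul_le_mul (h1 a) (h2 b) (norm_nonneg _) (hp a))

end HilbertRep

namespace HilbertRep

variable {X : Type v} [Ring X] [StarRing X] [Algebra ℂ X]
variable {Y : Type w} [Ring Y] [StarRing Y] [Algebra ℂ Y]
variable {I : Type y}

/-- The C*-algebra of all bounded families `(t_i)` with `t_i` a bounded operator on the Hilbert
space of `r i`, with the supremum norm. -/
def ProdAlg (r : I → HilbertRep.{u} X) : Type (max y u) := lp (fun i => (r i).H →L[ℂ] (r i).H) ∞

instance lp_cstarAlgebra (r : I → HilbertRep.{u} X) :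
    CStarAlgebra (lp (fun i => (r i).H →L[ℂ] (r i).H) ∞) where

instance (r : I → HilbertRep.{u} X) : CStarAlgebra (ProdAlg r) :=
  inferInstanceAs (CStarAlgebra (lp (fun i => (r i).H →L[ℂ] (r i).H) ∞))

namespace ProdAlg

variable (r : I → HilbertRep.{u} X)

/-- The `i`-th component. -/
def coord (i : I) : ProdAlg r →⋆ₐ[ℂ] ((r i).H →L[ℂ] (r i).H) where
  toFun t := (show lp (fun i => (r i).H →L[ℂ] (r i).H) ∞ from t) i
  map_one' := rfl
  map_mul' _ _ := rfl
  map_zero' := rfl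
  map_add' _ _ := rfl
  commutes' _ := rfl
  map_star' _ := rfl

variable {r}

theorem ext_coord {s t : ProdAlg r} (h : ∀ i, coord r i s = coord r i t) : s = t :=
  lp.ext (funext h)

theorem norm_eq (t : ProdAlg r) : ‖t‖ = ⨆ i, ‖coord r i t‖ := rfl

/-- The homomorphism into `ProdAlg r` with given components. -/
def lift (φ : ∀ i, Y →⋆ₐ[ℂ] ((r i).H →L[ℂ] (r i).H))
    (hφ : ∀ y, BddAbove (Set.range fun i => ‖φ i y‖)) : Y →⋆ₐ[ℂ] ProdAlg r where
  toFun y := (⟨fun i => φ i y, memℓp_infty (hφ y)⟩ : lp (fun i => (r i).H →L[ℂ] (r i).H) ∞)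
  map_one' := ext_coord fun i => map_one (φ i)
  map_mul' x y := ext_coord fun i => map_mul (φ i) x y
  map_zero' := ext_coord fun i => map_zero (φ i)
  map_add' x y := ext_coord fun i => map_add (φ i) x y
  commutes' c := ext_coord fun i => AlgHomClass.commutes (φ i) c
  map_star' x := ext_coord fun i => map_star (φ i) x

@[simp] theorem coord_lift (φ : ∀ i, Y →⋆ₐ[ℂ] ((r i).H →L[ℂ] (r i).H))
    (hφ : ∀ y, BddAbove (Set.range fun i => ‖φ i y‖)) (y : Y) (i : I) :
    coord r i (lift φ hφ y) = φ i y := rfl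

end ProdAlg

variable {r : I → HilbertRep.{u} X}

/-- The family of representations is pointwise bounded. -/
def Bounded (r : I → HilbertRep.{u} X) : Prop :=
  ∀ x, BddAbove (Set.range fun i => ‖(r i).rep x‖)

/-- The closure of the image of `X` under the direct sum of all `r i`. -/
def envelopeSubalgebra (hr : Bounded r) : StarSubalgebra ℂ (ProdAlg r) :=
  (ProdAlg.lift (fun i => (r i).rep) hr).range.topologicalClosure

theorem isClosed_envelopeSubalgebra (hr : Bounded r) :
    IsClosed (envelopeSubalgebra hr : Set (ProdAlg r)) :=
  StarSubalgebra.isClosed_topologicalClosure _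

/-- The C*-completion of (the quotient of) `X` in the seminorm `x ↦ sup_i ‖(r i)(x)‖`. -/
def Envelope (hr : Bounded r) : Type (max y u) := envelopeSubalgebra hr

instance (hr : Bounded r) : CStarAlgebra (Envelope hr) :=
  haveI := isClosed_envelopeSubalgebra hr
  inferInstanceAs (CStarAlgebra (envelopeSubalgebra hr))

namespace Envelope

/-- The inclusion into `ProdAlg r`. -/
def toProd (hr : Bounded r) : Envelope hr →⋆ₐ[ℂ] ProdAlg r := (envelopeSubalgebra hr).subtype

/-- The canonical map from `X` into its completion. -/
def of (hr : Bounded r) : X →⋆ₐ[ℂ] Envelope hr :=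
  (ProdAlg.lift (fun i => (r i).rep) hr).codRestrict (envelopeSubalgebra hr) fun x =>
    StarSubalgebra.le_topologicalClosure _ ⟨x, rfl⟩

/-- The extension of the representation `r i` to the completion. -/
def coord (hr : Bounded r) (i : I) : Envelope hr →⋆ₐ[ℂ] ((r i).H →L[ℂ] (r i).H) :=
  (ProdAlg.coord r i).comp (toProd hr)

@[simp] theorem coord_of (hr : Bounded r) (i : I) (x : X) :
    coord hr i (of hr x) = (r i).rep x := rfl

theorem ext_coord {hr : Bounded r} {s t : Envelope hr} (h : ∀ i, coord hr i s = coord hr i t) :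
    s = t :=
  Subtype.ext (ProdAlg.ext_coord h)

theorem norm_eq {hr : Bounded r} (t : Envelope hr) : ‖t‖ = ⨆ i, ‖coord hr i t‖ := rfl

theorem denseRange_of (hr : Bounded r) : DenseRange (of hr) := by
  intro t
  refine closure_subtype.2 ?_
  have ht : t.1 ∈ closure ((ProdAlg.lift (fun i => (r i).rep) hr).range : Set (ProdAlg r)) := t.2
  refine closure_mono ?_ ht
  rintro _ ⟨x, rfl⟩
  exact ⟨_, ⟨x, rfl⟩, rfl⟩

theorem map_mem {hr : Bounded r} {D : Type x} [CStarAlgebra D]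
    (F : Envelope hr →⋆ₐ[ℂ] D) (S : StarSubalgebra ℂ D) (hS : IsClosed (S : Set D))
    (h : ∀ x, F (of hr x) ∈ S) (t : Envelope hr) : F t ∈ S := by
  have hF : Continuous F := AddMonoidHomClass.continuous_of_bound F 1 fun t => by
    rw [one_mul]; exact NonUnitalStarAlgHom.norm_apply_le F t
  exact (denseRange_of hr).induction_on t (hS.preimage hF) h

/-- A family of representations of the envelope `Envelope hs`, one on each of the Hilbert spaces
underlying the envelope `Envelope hr`, defines a homomorphism `Envelope hs → Envelope hr` as soon
as it maps the canonical dense subalgebra of the former into the latter. -/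
def lift {J : Type z} {s : J → HilbertRep.{x} Y} {hs : Bounded s} {hr : Bounded r}
    (φ : ∀ i, Envelope hs →⋆ₐ[ℂ] ((r i).H →L[ℂ] (r i).H))
    (h : ∀ a, ∃ t : Envelope hr, ∀ i, φ i (of hs a) = coord hr i t) :
    Envelope hs →⋆ₐ[ℂ] Envelope hr :=
  (ProdAlg.lift φ fun y => ⟨‖y‖, by
    rintro _ ⟨i, rfl⟩; exact NonUnitalStarAlgHom.norm_apply_le (φ i) y⟩).codRestrict
    (envelopeSubalgebra hr) (map_mem _ _ (isClosed_envelopeSubalgebra hr) fun a => by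
      obtain ⟨t, ht⟩ := h a
      convert t.2 using 1
      exact ProdAlg.ext_coord ht)

@[simp] theorem coord_lift {J : Type z} {s : J → HilbertRep.{x} Y} {hs : Bounded s}
    {hr : Bounded r} (φ : ∀ i, Envelope hs →⋆ₐ[ℂ] ((r i).H →L[ℂ] (r i).H))
    (h : ∀ a, ∃ t : Envelope hr, ∀ i, φ i (of hs a) = coord hr i t) (y : Envelope hs) (i : I) :
    coord hr i (lift φ h y) = φ i y := rfl

end Envelope

section
variable {A B C D : Type u} [CStarAlgebra A] [CStarAlgebra B] [CStarAlgebra C] [CStarAlgebra D]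

variable (A B) in
theorem bounded_pair :
    Bounded fun i : HilbertRep.{u} A × HilbertRep.{u} B => i.1.tensor i.2 := fun x => by
  obtain ⟨M, hM⟩ := exists_norm_tensor_le.{u} x (fun a => ‖a‖) (fun b => ‖b‖) fun a => norm_nonneg a
  exact ⟨M, by rintro _ ⟨i, rfl⟩; exact hM _ _ (norm_rep_le _) (norm_rep_le _)⟩

variable (A B C) in
theorem bounded_triple :
    Bounded fun i : HilbertRep.{u} A × HilbertRep.{u} B × HilbertRep.{u} C =>
      (i.1.tensor i.2.1).tensor i.2.2 := fun x => by
  have h := bounded_pair A B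
  obtain ⟨M, hM⟩ := exists_norm_tensor_le.{u} x
    (fun y => ⨆ i : HilbertRep.{u} A × HilbertRep.{u} B, ‖(i.1.tensor i.2).rep y‖)
    (fun b => ‖b‖) fun y => Real.iSup_nonneg fun _ => norm_nonneg _
  exact ⟨M, by
    rintro _ ⟨i, rfl⟩
    exact hM _ _ (fun y => le_ciSup (h y) (i.1, i.2.1)) (norm_rep_le _)⟩

end

end HilbertRep

open HilbertRep

/-- The minimal (spatial) tensor product of two unital C*-algebras: the completion of the algebraic
tensor product in the norm `x ↦ sup ‖(π ⊗ ρ)(x)‖`, where `π` and `ρ` run over the representations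
of the two factors on Hilbert spaces. -/
abbrev MinTensor (A B : Type u) [CStarAlgebra A] [CStarAlgebra B] : Type (u + 1) :=
  Envelope (bounded_pair A B)

/-- The minimal tensor product of three unital C*-algebras. -/
abbrev MinTensor₃ (A B C : Type u) [CStarAlgebra A] [CStarAlgebra B] [CStarAlgebra C] :
    Type (u + 1) :=
  Envelope (bounded_triple A B C)

namespace MinTensor

variable {A B C D : Type u} [CStarAlgebra A] [CStarAlgebra B] [CStarAlgebra C] [CStarAlgebra D]

variable (A B) in
/-- The canonical map from the algebraic tensor product into the minimal one. -/
def of : A ⊗[ℂ] B →⋆ₐ[ℂ] MinTensor A B := Envelope.of (bounded_pair A B)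

variable (A B C) in
/-- The canonical map from the algebraic tensor product into the minimal one. -/
def of₃ : (A ⊗[ℂ] B) ⊗[ℂ] C →⋆ₐ[ℂ] MinTensor₃ A B C := Envelope.of (bounded_triple A B C)

/-- The extension of `π ⊗ ρ` to the minimal tensor product. -/
def coord (π : HilbertRep.{u} A) (ρ : HilbertRep.{u} B) :
    MinTensor A B →⋆ₐ[ℂ] (HilbertTensor π.H ρ.H →L[ℂ] HilbertTensor π.H ρ.H) :=
  Envelope.coord (bounded_pair A B) (π, ρ)

/-- The extension of `π ⊗ ρ ⊗ σ` to the minimal tensor product. -/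
def coord₃ (π : HilbertRep.{u} A) (ρ : HilbertRep.{u} B) (σ : HilbertRep.{u} C) :
    MinTensor₃ A B C →⋆ₐ[ℂ] (HilbertTensor (HilbertTensor π.H ρ.H) σ.H →L[ℂ]
      HilbertTensor (HilbertTensor π.H ρ.H) σ.H) :=
  Envelope.coord (bounded_triple A B C) (π, ρ, σ)

theorem coord_tmul (π : HilbertRep.{u} A) (ρ : HilbertRep.{u} B) (a : A) (b : B) :
    coord π ρ (of A B (a ⊗ₜ b)) = HilbertTensor.map (π.rep a) (ρ.rep b) := rfl

theorem coord₃_tmul (π : HilbertRep.{u} A) (ρ : HilbertRep.{u} B) (σ : HilbertRep.{u} C)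
    (a : A) (b : B) (c : C) :
    coord₃ π ρ σ (of₃ A B C ((a ⊗ₜ b) ⊗ₜ c)) =
      HilbertTensor.map (HilbertTensor.map (π.rep a) (ρ.rep b)) (σ.rep c) := rfl

/-- The representation `(π ⊗ ρ) ∘ f` of `A`, for `f : A → B ⊗ C` and representations `π` of `B`
and `ρ` of `C`. -/
abbrev pull (f : A →⋆ₐ[ℂ] MinTensor B C) (π : HilbertRep.{u} B) (ρ : HilbertRep.{u} C) :
    HilbertRep.{u} A where
  H := HilbertTensor π.H ρ.H
  rep := (coord π ρ).comp f

theorem norm_eq (t : MinTensor A B) :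
    ‖t‖ = ⨆ i : HilbertRep.{u} A × HilbertRep.{u} B, ‖coord i.1 i.2 t‖ := rfl

end MinTensor

namespace HilbertTensor

variable {H : Type v} {K : Type w} [NormedAddCommGroup H] [InnerProductSpace ℂ H]
  [CompleteSpace H] [NormedAddCommGroup K] [InnerProductSpace ℂ K] [CompleteSpace K]

variable (H K) in
/-- `S ↦ S ⊗ 1`. -/
def leftHom : (H →L[ℂ] H) →⋆ₐ[ℂ] (HilbertTensor H K →L[ℂ] HilbertTensor H K) where
  toFun S := map S 1
  map_one' := map_one
  map_mul' S S' := by rw [← map_mul, one_mul]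
  map_zero' := ext_incl fun x y => by simp
  map_add' S S' := ext_incl fun x y => by simp [TensorProduct.add_tmul]
  commutes' c := ext_incl fun x y => by simp [Algebra.algebraMap_eq_smul_one,
    ← TensorProduct.smul_tmul']
  map_star' S := by rw [← map_star, star_one]

variable (H K) in
/-- `T ↦ 1 ⊗ T`. -/
def rightHom : (K →L[ℂ] K) →⋆ₐ[ℂ] (HilbertTensor H K →L[ℂ] HilbertTensor H K) where
  toFun T := map 1 T
  map_one' := map_one
  map_mul' S S' := by rw [← map_mul, one_mul]
  map_zero' := ext_incl fun x y => by simp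
  map_add' S S' := ext_incl fun x y => by simp [TensorProduct.tmul_add]
  commutes' c := ext_incl fun x y => by simp [Algebra.algebraMap_eq_smul_one]
  map_star' S := by rw [← map_star, star_one]

theorem leftHom_apply (S : H →L[ℂ] H) : leftHom H K S = map S 1 := rfl

theorem rightHom_apply (T : K →L[ℂ] K) : rightHom H K T = map 1 T := rfl

theorem ext_incl₃ {L : Type x} [NormedAddCommGroup L] [InnerProductSpace ℂ L] {E : Type y}
    [NormedAddCommGroup E] [NormedSpace ℂ E]
    {S T : HilbertTensor (HilbertTensor H K) L →L[ℂ] E}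
    (h : ∀ a b c, S (incl _ _ (incl _ _ (a ⊗ₜ b) ⊗ₜ c)) = T (incl _ _ (incl _ _ (a ⊗ₜ b) ⊗ₜ c))) :
    S = T := by
  refine ext_incl fun p c => ?_
  have hc : Continuous fun q : HilbertTensor H K => incl (HilbertTensor H K) L (q ⊗ₜ c) :=
    continuous_incl_tmul.comp (Continuous.prodMk_left c)
  refine denseRange_incl.induction_on p (isClosed_eq (S.continuous.comp hc) (T.continuous.comp hc))
    fun z => ?_
  induction z using TensorProduct.induction_on with
  | zero => simp
  | tmul a b => exact h a b c
  | add a b ha hb => simp only [map_add, TensorProduct.add_tmul, ha, hb]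

end HilbertTensor

namespace MinTensor

variable {A B C D : Type u} [CStarAlgebra A] [CStarAlgebra B] [CStarAlgebra C] [CStarAlgebra D]

/-- The identification of operators on `H ⊗ (K ⊗ L)` with operators on `(H ⊗ K) ⊗ L`. -/
def conjAssoc (π : HilbertRep.{u} A) (ρ : HilbertRep.{u} B) (σ : HilbertRep.{u} C) :
    (HilbertTensor π.H (HilbertTensor ρ.H σ.H) →L[ℂ] HilbertTensor π.H (HilbertTensor ρ.H σ.H))
      →⋆ₐ[ℂ] (HilbertTensor (HilbertTensor π.H ρ.H) σ.H →L[ℂ]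
        HilbertTensor (HilbertTensor π.H ρ.H) σ.H) :=
  StarAlgHomClass.toStarAlgHom
    (LinearIsometryEquiv.conjStarAlgEquiv (HilbertTensor.assoc π.H ρ.H σ.H).symm)

theorem conjAssoc_map (π : HilbertRep.{u} A) (ρ : HilbertRep.{u} B) (σ : HilbertRep.{u} C)
    (R : π.H →L[ℂ] π.H) (S : ρ.H →L[ℂ] ρ.H) (T : σ.H →L[ℂ] σ.H) :
    conjAssoc π ρ σ (HilbertTensor.map R (HilbertTensor.map S T)) =
      HilbertTensor.map (HilbertTensor.map R S) T := by
  refine HilbertTensor.ext_incl₃ fun a b c => ?_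
  change (HilbertTensor.assoc π.H ρ.H σ.H).symm (HilbertTensor.map R (HilbertTensor.map S T)
    ((HilbertTensor.assoc π.H ρ.H σ.H).symm.symm _)) = _
  rw [LinearIsometryEquiv.symm_symm, HilbertTensor.assoc_tmul, LinearIsometryEquiv.symm_apply_eq]
  simp

theorem conjAssoc_map_eq_mul (π : HilbertRep.{u} A) (ρ : HilbertRep.{u} B) (σ : HilbertRep.{u} C)
    (R : π.H →L[ℂ] π.H) (S : HilbertTensor ρ.H σ.H →L[ℂ] HilbertTensor ρ.H σ.H) :
    conjAssoc π ρ σ (HilbertTensor.map R S) =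
      HilbertTensor.map (HilbertTensor.map R 1) 1 * conjAssoc π ρ σ (HilbertTensor.map 1 S) := by
  have h : HilbertTensor.map R S = HilbertTensor.map R 1 * HilbertTensor.map 1 S := by
    rw [← HilbertTensor.map_mul, one_mul, mul_one]
  rw [h, map_mul (conjAssoc π ρ σ), ← conjAssoc_map, HilbertTensor.map_one]

/-- `y ↦ y ⊗ 1`, from `A ⊗ B` to `A ⊗ B ⊗ C`. -/
def inclFirst : MinTensor A B →⋆ₐ[ℂ] MinTensor₃ A B C :=
  Envelope.lift (hs := bounded_pair A B) (hr := bounded_triple A B C)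
    (fun i => (HilbertTensor.leftHom (HilbertTensor i.1.H i.2.1.H) i.2.2.H).comp
      (coord i.1 i.2.1))
    (fun x => ⟨of₃ A B C (x ⊗ₜ 1), fun i => by
      change HilbertTensor.map ((i.1.tensor i.2.1).rep x) 1 =
        HilbertTensor.map ((i.1.tensor i.2.1).rep x) (i.2.2.rep 1)
      rw [map_one]⟩)

/-- `y ↦ 1 ⊗ y`, from `B ⊗ C` to `A ⊗ B ⊗ C`. -/
def inclLast : MinTensor B C →⋆ₐ[ℂ] MinTensor₃ A B C :=
  Envelope.lift (hs := bounded_pair B C) (hr := bounded_triple A B C)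
    (fun i => (conjAssoc i.1 i.2.1 i.2.2).comp
      ((HilbertTensor.rightHom i.1.H (HilbertTensor i.2.1.H i.2.2.H)).comp
        (coord i.2.1 i.2.2)))
    (fun x => ⟨of₃ A B C ((Algebra.TensorProduct.assoc ℂ ℂ ℂ A B C).symm (1 ⊗ₜ x)), fun i => by
      induction x using TensorProduct.induction_on with
      | zero => simp
      | add x y hx hy => simp only [map_add, TensorProduct.tmul_add, hx, hy]
      | tmul b c =>
        change conjAssoc i.1 i.2.1 i.2.2 (HilbertTensor.map 1
            (HilbertTensor.map (i.2.1.rep b) (i.2.2.rep c))) =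
          HilbertTensor.map (HilbertTensor.map (i.1.rep 1) (i.2.1.rep b)) (i.2.2.rep c)
        rw [conjAssoc_map, map_one]⟩)

/-- `f ⊗ id : A ⊗ D → B ⊗ C ⊗ D`, for `f : A → B ⊗ C`. -/
def ampLeft (f : A →⋆ₐ[ℂ] MinTensor B C) : MinTensor A D →⋆ₐ[ℂ] MinTensor₃ B C D :=
  Envelope.lift (hs := bounded_pair A D) (hr := bounded_triple B C D)
    (fun i => coord (pull f i.1 i.2.1) i.2.2)
    (fun x => by
      induction x using TensorProduct.induction_on with
      | zero => exact ⟨0, fun i => by simp⟩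
      | add x y hx hy =>
        obtain ⟨s, hs⟩ := hx
        obtain ⟨t, ht⟩ := hy
        exact ⟨s + t, fun i => by simp only [map_add, hs, ht]⟩
      | tmul a d =>
        refine ⟨inclFirst (f a) * of₃ B C D ((1 ⊗ₜ 1) ⊗ₜ d), fun i => ?_⟩
        rw [map_mul]
        change HilbertTensor.map (coord i.1 i.2.1 (f a)) (i.2.2.rep d) =
          HilbertTensor.map (coord i.1 i.2.1 (f a)) 1 *
            HilbertTensor.map (HilbertTensor.map (i.1.rep 1) (i.2.1.rep 1)) (i.2.2.rep d)
        rw [map_one, map_one, HilbertTensor.map_one, ← HilbertTensor.map_mul, one_mul, mul_one])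

/-- `id ⊗ f : D ⊗ A → D ⊗ B ⊗ C`, for `f : A → B ⊗ C`. -/
def ampRight (f : A →⋆ₐ[ℂ] MinTensor B C) : MinTensor D A →⋆ₐ[ℂ] MinTensor₃ D B C :=
  Envelope.lift (hs := bounded_pair D A) (hr := bounded_triple D B C)
    (fun i => (conjAssoc i.1 i.2.1 i.2.2).comp (coord i.1 (pull f i.2.1 i.2.2)))
    (fun x => by
      induction x using TensorProduct.induction_on with
      | zero => exact ⟨0, fun i => by simp⟩
      | add x y hx hy =>
        obtain ⟨s, hs⟩ := hx
        obtain ⟨t, ht⟩ := hy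
        exact ⟨s + t, fun i => by simp only [map_add, hs, ht]⟩
      | tmul d a =>
        refine ⟨of₃ D B C ((d ⊗ₜ 1) ⊗ₜ 1) * inclLast (f a), fun i => ?_⟩
        rw [map_mul]
        change conjAssoc i.1 i.2.1 i.2.2
            (HilbertTensor.map (i.1.rep d) (coord i.2.1 i.2.2 (f a))) =
          HilbertTensor.map (HilbertTensor.map (i.1.rep d) (i.2.1.rep 1)) (i.2.2.rep 1) *
            conjAssoc i.1 i.2.1 i.2.2 (HilbertTensor.map 1 (coord i.2.1 i.2.2 (f a)))
        rw [map_one, map_one, conjAssoc_map_eq_mul])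

theorem ampLeft_tmul (f : A →⋆ₐ[ℂ] MinTensor B C) (a : A) (d : D) :
    ampLeft f (of A D (a ⊗ₜ d)) = inclFirst (f a) * of₃ B C D ((1 ⊗ₜ 1) ⊗ₜ d) := by
  refine Envelope.ext_coord fun i => ?_
  rw [map_mul]
  change HilbertTensor.map (coord i.1 i.2.1 (f a)) (i.2.2.rep d) =
    HilbertTensor.map (coord i.1 i.2.1 (f a)) 1 *
      HilbertTensor.map (HilbertTensor.map (i.1.rep 1) (i.2.1.rep 1)) (i.2.2.rep d)
  rw [map_one, map_one, HilbertTensor.map_one, ← HilbertTensor.map_mul, one_mul, mul_one]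

theorem ampRight_tmul (f : A →⋆ₐ[ℂ] MinTensor B C) (d : D) (a : A) :
    ampRight f (of D A (d ⊗ₜ a)) = of₃ D B C ((d ⊗ₜ 1) ⊗ₜ 1) * inclLast (f a) := by
  refine Envelope.ext_coord fun i => ?_
  rw [map_mul]
  change conjAssoc i.1 i.2.1 i.2.2 (HilbertTensor.map (i.1.rep d) (coord i.2.1 i.2.2 (f a))) =
    HilbertTensor.map (HilbertTensor.map (i.1.rep d) (i.2.1.rep 1)) (i.2.2.rep 1) *
      conjAssoc i.1 i.2.1 i.2.2 (HilbertTensor.map 1 (coord i.2.1 i.2.2 (f a)))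
  rw [map_one, map_one, conjAssoc_map_eq_mul]

end MinTensor

/-- A compact quantum group: a unital C*-algebra `A` together with a coassociative unital
*-homomorphism `comul : A → A ⊗ A` (minimal tensor product) such that the linear spans of
`(A ⊗ 1) comul(A)` and `(1 ⊗ A) comul(A)` are dense in `A ⊗ A`. -/
structure CompactQuantumGroup (A : Type u) [CStarAlgebra A] where
  comul : A →⋆ₐ[ℂ] MinTensor A A
  coassoc : ∀ a, MinTensor.ampLeft comul (comul a) = MinTensor.ampRight comul (comul a)
  dense_left : Dense (Submodule.span ℂ
    {t : MinTensor A A | ∃ a b, t = MinTensor.of A A (a ⊗ₜ 1) * comul b} : Set (MinTensor A A))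
  dense_right : Dense (Submodule.span ℂ
    {t : MinTensor A A | ∃ a b, t = MinTensor.of A A (1 ⊗ₜ a) * comul b} : Set (MinTensor A A))

namespace CompactQuantumGroup

variable {A : Type u} [CStarAlgebra A]

variable (A) in
/-- The scalar matrix `T`, regarded as the matrix `T ⊗ 1` over `A`. -/
def scalar {ι κ : Type} (T : Matrix ι κ ℂ) : Matrix ι κ A := T.map (algebraMap ℂ A)

theorem scalar_mul {ι κ l : Type} [Fintype κ] (S : Matrix ι κ ℂ) (T : Matrix κ l ℂ) :
    scalar A (S * T) = scalar A S * scalar A T :=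
  Matrix.map_mul

theorem scalar_one {ι : Type} [DecidableEq ι] : scalar A (1 : Matrix ι ι ℂ) = 1 :=
  Matrix.map_one _ (map_zero _) (map_one _)

/-- `T` intertwines the matrices `u` and `v`, that is `(T ⊗ 1) u = v (T ⊗ 1)`. -/
def Intertwines {ι κ : Type} [Fintype ι] [Fintype κ] (u : Matrix ι ι A) (v : Matrix κ κ A)
    (T : Matrix κ ι ℂ) : Prop :=
  scalar A T * u = v * scalar A T

/-- Equivalence of finite-dimensional representations: there is an invertible intertwiner. -/
def Equivalent {ι κ : Type} [Fintype ι] [Fintype κ] [DecidableEq ι] [DecidableEq κ]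
    (u : Matrix ι ι A) (v : Matrix κ κ A) : Prop :=
  ∃ (T : Matrix κ ι ℂ) (S : Matrix ι κ ℂ), S * T = 1 ∧ T * S = 1 ∧ Intertwines u v T

/-- `u` is (equivalent to) a subrepresentation of `v`: there is an injective intertwiner from
`u` to `v`. -/
def IsSubrep {ι κ : Type} [Fintype ι] [Fintype κ] (u : Matrix ι ι A) (v : Matrix κ κ A) : Prop :=
  ∃ T : Matrix κ ι ℂ, Function.Injective T.mulVec ∧ Intertwines u v T

/-- The tensor product of two representations, with matrix coefficients
`(u ⊗ v)_{(i,k),(j,l)} = u_{ij} v_{kl}`. -/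
def tensorRep {ι κ : Type} (u : Matrix ι ι A) (v : Matrix κ κ A) : Matrix (ι × κ) (ι × κ) A :=
  Matrix.kroneckerMap (fun a b => a * b) u v

/-- The conjugate of a representation, with matrix coefficients `(u_{ij})^*`. -/
def conjRep {ι : Type} (u : Matrix ι ι A) : Matrix ι ι A := u.map star

/-- No subspace of `ℂ^ι` other than `0` and `ℂ^ι` is invariant under `u`, and `ℂ^ι ≠ 0`. The
subspaces are given by their orthogonal projections `P`; the range of `P` is invariant if and only
if `(P ⊗ 1) u (P ⊗ 1) = u (P ⊗ 1)`. -/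
def IsIrreducible {ι : Type} [Fintype ι] [DecidableEq ι] (u : Matrix ι ι A) : Prop :=
  Nonempty ι ∧ ∀ P : Matrix ι ι ℂ, P * P = P → P.conjTranspose = P →
    scalar A P * u * scalar A P = u * scalar A P → P = 0 ∨ P = 1

variable (G : CompactQuantumGroup A)

/-- The matrix `u` is a finite-dimensional (unitary) representation of `G`. -/
def IsRep {ι : Type} [Fintype ι] [DecidableEq ι] (u : Matrix ι ι A) : Prop :=
  u ∈ unitary (Matrix ι ι A) ∧
    ∀ i j, G.comul (u i j) = ∑ k, MinTensor.of A A (u i k ⊗ₜ u k j)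

/-- An irreducible finite-dimensional representation of `G` on some `ℂ^n`. -/
structure Irrep where
  dim : ℕ
  mat : Matrix (Fin dim) (Fin dim) A
  isRep : G.IsRep mat
  irreducible : IsIrreducible mat

instance irrepSetoid : Setoid G.Irrep where
  r u v := Equivalent u.mat v.mat
  iseqv :=
    { refl := fun u => ⟨1, 1, by simp, by simp, by
        change scalar A 1 * u.mat = u.mat * scalar A 1
        rw [scalar_one, Matrix.one_mul, Matrix.mul_one]⟩
      symm := by
        rintro u v ⟨T, S, h1, h2, h⟩
        refine ⟨S, T, h2, h1, ?_⟩
        have h' : scalar A T * u.mat = v.mat * scalar A T := h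
        have h1' : scalar A S * scalar A T = 1 := by
          rw [← scalar_mul, h1, scalar_one]
        have h2' : scalar A T * scalar A S = 1 := by
          rw [← scalar_mul, h2, scalar_one]
        change scalar A S * v.mat = u.mat * scalar A S
        calc scalar A S * v.mat = scalar A S * (v.mat * scalar A T) * scalar A S := by
              rw [Matrix.mul_assoc, Matrix.mul_assoc, h2', Matrix.mul_one]
          _ = u.mat * scalar A S := by
              rw [← h', ← Matrix.mul_assoc, h1', Matrix.one_mul]
      trans := by
        rintro u v w ⟨T, S, h1, h2, h⟩ ⟨T', S', h1', h2', h'⟩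
        have h3 : scalar A T * u.mat = v.mat * scalar A T := h
        have h4 : scalar A T' * v.mat = w.mat * scalar A T' := h'
        refine ⟨T' * T, S * S', ?_, ?_, ?_⟩
        · rw [Matrix.mul_assoc, ← Matrix.mul_assoc S', h1', Matrix.one_mul, h1]
        · rw [Matrix.mul_assoc, ← Matrix.mul_assoc T, h2, Matrix.one_mul, h2']
        · change scalar A (T' * T) * u.mat = w.mat * scalar A (T' * T)
          rw [scalar_mul, Matrix.mul_assoc, h3, ← Matrix.mul_assoc, h4, Matrix.mul_assoc] }

/-- The set of equivalence classes of irreducible representations of `G`. -/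
def Dual : Type u := Quotient G.irrepSetoid

/-- The equivalence class of an irreducible representation. -/
def toDual (u : G.Irrep) : G.Dual := Quotient.mk G.irrepSetoid u

/-- The trivial representation `1 ∈ M_1(A)`. -/
def trivialIrrep : G.Irrep where
  dim := 1
  mat := 1
  isRep := ⟨one_mem _, fun i j => by
    rw [Subsingleton.elim i 0, Subsingleton.elim j 0]
    simp only [Fin.sum_univ_one, Matrix.one_apply_eq, map_one, ← Algebra.TensorProduct.one_def]⟩
  irreducible := ⟨⟨0⟩, fun P hP _ _ => by
    have h : P 0 0 * P 0 0 = P 0 0 := by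
      have := congrFun (congrFun hP 0) 0
      simpa [Matrix.mul_apply] using this
    have h' : P 0 0 * (P 0 0 - 1) = 0 := by rw [mul_sub, h, mul_one, sub_self]
    rcases mul_eq_zero.1 h' with h0 | h0
    · left
      ext i j
      rw [Subsingleton.elim i 0, Subsingleton.elim j 0, h0, Matrix.zero_apply]
    · right
      ext i j
      rw [Subsingleton.elim i 0, Subsingleton.elim j 0, sub_eq_zero.1 h0, Matrix.one_apply_eq]⟩

/-- The class `[1_G]` of the trivial representation. -/
def triv : G.Dual := G.toDual G.trivialIrrep

variable {G}

/-- The set `a × b` of the classes of the irreducible subrepresentations of `u^a ⊗ u^b`. -/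
def fusion (a b : G.Dual) : Set G.Dual :=
  {c | ∃ u v w : G.Irrep, G.toDual u = a ∧ G.toDual v = b ∧ G.toDual w = c ∧
    IsSubrep w.mat (tensorRep u.mat v.mat)}

/-- `b` is the conjugate of `a`. -/
def IsConjugate (a b : G.Dual) : Prop :=
  ∃ u v : G.Irrep, G.toDual u = a ∧ G.toDual v = b ∧ Equivalent v.mat (conjRep u.mat)

/-- The set-wise product of two subsets of the dual. -/
def setMul (S T : Set G.Dual) : Set G.Dual := {c | ∃ a ∈ S, ∃ b ∈ T, c ∈ fusion a b}

/-- The product `z_1 × ⋯ × z_n` of a finite sequence of elements of the dual; the empty product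
is `{[1_G]}`. -/
def listProd : List G.Dual → Set G.Dual
  | [] => {G.triv}
  | z :: l => setMul {z} (listProd l)

/-- The set of classes `{b | R b a}`, `a ∈ Ĝ`, of a relation `R`. -/
def Classes (R : G.Dual → G.Dual → Prop) : Type u := {C : Set G.Dual // ∃ a, C = {b | R b a}}

/-- The class of `a`. -/
def classOf (R : G.Dual → G.Dual → Prop) (a : G.Dual) : Classes R := ⟨{b | R b a}, a, rfl⟩

/-- The multiplication of a group structure on the set of classes is the set-wise product. -/
def IsSetwise {R : G.Dual → G.Dual → Prop} (g : Group (Classes R)) : Prop :=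
  ∀ C D : Classes R, (g.mul C D).1 = setMul C.1 D.1

/-- A subobject of the dual: it contains the trivial class and is closed under products and
conjugates. -/
structure IsSubobject (S : Set G.Dual) : Prop where
  triv_mem : G.triv ∈ S
  fusion_subset : ∀ a ∈ S, ∀ b ∈ S, fusion a b ⊆ S
  conj_mem : ∀ a ∈ S, ∀ b, IsConjugate a b → b ∈ S

/-- The relation `a ∼ b` defined by a subobject `S`: the set `(a × b̄) ∩ S` is not empty. -/
def CosetRel (S : Set G.Dual) (a b : G.Dual) : Prop :=
  ∃ b', IsConjugate b b' ∧ (fusion a b' ∩ S).Nonempty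

/-- A subobject is central if its cosets form a group under the set-wise product. -/
def IsCentral (S : Set G.Dual) : Prop :=
  IsSubobject S ∧ ∃ g : Group (Classes (CosetRel S)), IsSetwise g

variable (G)

/-- The center subobject: the intersection of all central subobjects. -/
def centerSubobject : Set G.Dual := ⋂₀ {S | IsCentral S}

/-- The relation `∼₁`: both classes are contained in one product `z_1 × ⋯ × z_n`. -/
def ChainRel (a b : G.Dual) : Prop := ∃ l : List G.Dual, a ∈ listProd l ∧ b ∈ listProd l

/-- The underlying set `Ĝ/∼₁` of the chain group. -/
abbrev ChainGroup : Type u := Classes G.ChainRel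

/-- The set of classes `z` with `z ∼₁ [1_G]`. -/
def chainSubobject : Set G.Dual := {z | G.ChainRel z G.triv}

end CompactQuantumGroup

end

/-!
The chain relation `∼₁` and the central subobjects only see the fusion rules of `G`, so the theorem
has an analytic half, which establishes these rules, and a combinatorial half.

The rules needed are: conjugates exist (`exists_isConjugate`), products are non-empty
(`fusion_nonempty`), Frobenius reciprocity `c ∈ a × b → a ∈ c × b̄`
(`mem_fusion_of_isConjugate_right`), reversal `c ∈ a × b → c̄ ∈ b̄ × ā` (`mem_fusion_conj`), and
associativity (`exists_mem_fusion_assoc`). Reversal and Frobenius reciprocity are computations with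
intertwiners. The other rules rest on two facts: the conjugate of an irreducible unitary
representation is equivalent to a unitary one (`exists_unitary_equivalent_conjRep`), and tensor
products of irreducible representations are completely reducible (`exists_irrep_of_mul_ne_zero`).
Both are obtained by averaging.

No Haar state on the whole of `A` is constructed. On a finite-dimensional subspace which contains
`1` and is stable under convolutions, a limit of Cesàro means of convolution powers of a state `ω`
that is faithful on the subspace is invariant, by an argument of Van Daele
(`exists_invariant_state`). Applied to the span of `1` and the coefficients of `y ⊗ ȳ`, this gives a
state `h` for which the averages of `y P y^*` and of `y^T ȳ` are invariant
(`IsCorep.exists_average`).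

For an irreducible unitary `u`, the second average is an invertible positive matrix `E = B^* B` with
`u^T E ū = E`; then `B ū B^{-1}` is isometric, and the first average, formed for `ū`, yields a right
inverse of `ū`, so that `B ū B^{-1}` is unitary. The existence of such an `E` (`IsBalanced`) passes
to tensor products and subrepresentations, and it implies that invariant subspaces are reducing
(`IsRep.commute_of_invariant`). The difficulty is that `h` may fail to be faithful: if `P` is the
projection onto an invariant subspace, the average of `v P v^*` gives a reducing projection `S ≤ P`
such that the average of `v K v^*` vanishes for `K = P - S`. Hence `h` annihilates the right ideals
generated by the entries of `v K`, in particular the entries of `K^T v^T E v̄ K̄`, which are the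
scalars `K^T E K̄`; so `K = 0`.

For the combinatorial half, `∼₁` is transitive because `b̄ × b` contains `1`, and it is compatible
with products because concatenation of sequences multiplies their products. The set-wise product of
the classes of `a` and `b` is the class of any `c ∈ a × b`: an element `e` with `e ∼₁ c` lies in
`x × b` for any `x ∈ e × b̄`, and `x ∼₁ a` since `a ∈ c × b̄`. So the classes form a group, the
relation defined by the subobject of all `z ∼₁ 1` is `∼₁` itself, and this subobject is central.
Conversely, if `Σ` is central then every product `z₁ × ⋯ × zₙ` lies in one coset
(`IsCentral.exists_listProd_subset`); thus `z ∼₁ 1` implies `z ∈ Σ`.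
-/

noncomputable section

open scoped TensorProduct ENNReal ComplexOrder InnerProductSpace ComplexConjugate ComplexStarModule
open Filter Topology

universe u v w

set_option linter.unusedSectionVars false

/-! ### Positive functionals and states -/

namespace PositiveFunctional

variable {M : Type v} [Ring M] [StarRing M] [Algebra ℂ M] [StarModule ℂ M]
  {τ : M →ₗ[ℂ] ℂ}

theorem apply_star_mul_conj (hτ : ∀ x, 0 ≤ τ (star x * x)) (x y : M) :
    conj (τ (star y * x)) = τ (star x * y) := by
  have h1 := hτ (x + y)
  have h2 := hτ (x + Complex.I • y)
  have hx := hτ x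
  have hy := hτ y
  simp only [star_add, star_smul, mul_add, add_mul, map_add, smul_mul_assoc, mul_smul_comm,
    map_smul, smul_eq_mul, Complex.star_def, Complex.conj_I] at h1 h2
  rw [Complex.nonneg_iff] at h1 h2 hx hy
  have e1 := h1.2
  have e2 := h2.2
  simp at e1 e2
  apply Complex.ext
  · simp; linarith [hx.2, hy.2]
  · simp; linarith [hx.2, hy.2]

/-- The Cauchy-Schwarz inequality in its degenerate case. -/
theorem apply_star_mul_eq_zero (hτ : ∀ x, 0 ≤ τ (star x * x)) {x : M}
    (hx : τ (star x * x) = 0) (y : M) : τ (star y * x) = 0 := by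
  let c : PreInnerProductSpace.Core ℂ M :=
    { inner := fun a b => τ (star a * b)
      conj_inner_symm := fun a b => apply_star_mul_conj hτ a b
      re_inner_nonneg := fun a => (Complex.nonneg_iff.1 (hτ a)).1
      add_left := fun a b d => by simp [add_mul]
      smul_left := fun a b r => by simp }
  have h := InnerProductSpace.Core.norm_inner_symm (c := c) x y
  have h2 := InnerProductSpace.Core.inner_mul_inner_self_le (c := c) y x
  have h3 : ‖τ (star y * x)‖ * ‖τ (star x * y)‖ ≤
      (τ (star y * y)).re * (τ (star x * x)).re := h2
  have h4 : ‖τ (star x * y)‖ = ‖τ (star y * x)‖ := h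
  rw [h4, hx, Complex.zero_re, mul_zero] at h3
  have h5 : ‖τ (star y * x)‖ = 0 := by nlinarith [norm_nonneg (τ (star y * x))]
  exact norm_eq_zero.1 h5

theorem apply_mul_eq_zero (hτ : ∀ x, 0 ≤ τ (star x * x)) {x : M}
    (hx : τ (star x * x) = 0) (y : M) : τ (y * x) = 0 := by
  simpa using apply_star_mul_eq_zero hτ hx (star y)

theorem apply_star (hτ : ∀ x, 0 ≤ τ (star x * x)) (x : M) : τ (star x) = conj (τ x) := by
  simpa using (apply_star_mul_conj hτ x 1).symm

/-- If `τ (x x^*) = 0` then `τ` vanishes on the right ideal generated by `x`. -/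
theorem apply_mul_eq_zero_of_mul_star (hτ : ∀ x, 0 ≤ τ (star x * x)) {x : M}
    (hx : τ (x * star x) = 0) (y : M) : τ (x * y) = 0 := by
  have h := apply_mul_eq_zero hτ (x := star x) (by simpa using hx) (star y)
  rw [← star_mul, apply_star hτ] at h
  simpa using h

end PositiveFunctional

section

variable {A : Type u} [CStarAlgebra A]

/-- A state of a unital C*-algebra: a positive bounded functional with value `1` at `1`. -/
structure IsState (φ : A →L[ℂ] ℂ) : Prop where
  map_one : φ 1 = 1
  nonneg : ∀ a, 0 ≤ φ (star a * a)

/-- A positive linear functional on a C*-algebra which does not vanish on `q = x^* x`, obtained by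
separating `-q` from the closed cone of positive elements. -/
theorem exists_positive_functional_ne_zero {x : A} (hx : x ≠ 0) :
    ∃ φ : A →L[ℂ] ℂ, (∀ a, 0 ≤ φ (star a * a)) ∧ φ (star x * x) ≠ 0 := by
  let _ := CStarAlgebra.spectralOrder A
  have _ := CStarAlgebra.spectralOrderedRing A
  set q := star x * x with hq
  have hq0 : 0 ≤ q := star_mul_self_nonneg x
  have hqne : q ≠ 0 := fun h => hx ((CStarRing.star_mul_self_eq_zero_iff x).1 h)
  have hconv : Convex ℝ {a : A | 0 ≤ a} := by
    intro a ha b hb s t hs ht _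
    exact add_nonneg (smul_nonneg hs (show (0 : A) ≤ a from ha))
      (smul_nonneg ht (show (0 : A) ≤ b from hb))
  have hnot : -q ∉ {a : A | 0 ≤ a} := fun h =>
    hqne (le_antisymm (neg_nonneg.1 h) hq0)
  obtain ⟨g, s, hgs, hs⟩ := geometric_hahn_banach_point_closed (E := A) hconv
    (CStarAlgebra.isClosed_nonneg (A := A)) hnot
  have hs0 : s < 0 := by simpa using hs 0 (le_refl (0 : A))
  have hpos : ∀ a : A, 0 ≤ a → 0 ≤ g a := by
    intro a ha
    by_contra! hneg
    obtain ⟨n, hn⟩ := exists_nat_gt (s / g a)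
    have h1 := hs ((n : ℝ) • a) (smul_nonneg (Nat.cast_nonneg n) ha)
    rw [map_smul, smul_eq_mul] at h1
    rw [div_lt_iff_of_neg hneg] at hn
    linarith
  have hgq : 0 < g q := by
    have : g (-q) < 0 := hgs.trans hs0
    rw [map_neg] at this
    linarith
  -- The complex-linear extension of the restriction of `g` to the self-adjoint part.
  let f : A →ₗ[ℂ] ℂ :=
    { toFun := fun a => (g (ℜ a : A) : ℂ) + Complex.I * (g (ℑ a : A) : ℂ)
      map_add' := fun a b => by simp; ring
      map_smul' := fun c a => by
        rw [realPart_smul, imaginaryPart_smul]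
        simp only [AddSubgroupClass.coe_sub, AddMemClass.coe_add, selfAdjoint.val_smul, map_sub,
          map_add, map_smul, smul_eq_mul, RingHom.id_apply]
        apply Complex.ext <;> simp }
  have hfpos : ∀ a : A, 0 ≤ a → f a = (g a : ℂ) := by
    intro a ha
    have hsa : IsSelfAdjoint a := IsSelfAdjoint.of_nonneg ha
    change (g (ℜ a : A) : ℂ) + Complex.I * (g (ℑ a : A) : ℂ) = _
    rw [hsa.coe_realPart, hsa.imaginaryPart]
    simp
  have hbd : ∃ C, ∀ a, ‖f a‖ ≤ C * ‖a‖ := by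
    refine ⟨‖g‖ + ‖g‖, fun a => ?_⟩
    have h1 : ‖(g (ℜ a : A) : ℂ)‖ ≤ ‖g‖ * ‖a‖ := by
      rw [Complex.norm_real]
      exact (g.le_opNorm _).trans
        (mul_le_mul_of_nonneg_left (realPart.norm_le a) (norm_nonneg _))
    have h2 : ‖Complex.I * (g (ℑ a : A) : ℂ)‖ ≤ ‖g‖ * ‖a‖ := by
      rw [norm_mul, Complex.norm_I, one_mul, Complex.norm_real]
      exact (g.le_opNorm _).trans
        (mul_le_mul_of_nonneg_left (imaginaryPart.norm_le a) (norm_nonneg _))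
    rw [add_mul]
    exact (norm_add_le _ _).trans (add_le_add h1 h2)
  refine ⟨f.mkContinuousOfExistsBound hbd, fun a => ?_, ?_⟩
  · change 0 ≤ f _
    rw [hfpos _ (star_mul_self_nonneg a)]
    exact_mod_cast hpos _ (star_mul_self_nonneg a)
  · change f _ ≠ 0
    rw [hfpos _ hq0]
    exact_mod_cast hgq.ne'

theorem exists_isState_ne_zero {x : A} (hx : x ≠ 0) :
    ∃ φ : A →L[ℂ] ℂ, IsState φ ∧ φ (star x * x) ≠ 0 := by
  obtain ⟨φ, hφ, hne⟩ := exists_positive_functional_ne_zero hx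
  have h1 : φ 1 ≠ 0 := fun h0 => hne <| by
    have := PositiveFunctional.apply_mul_eq_zero (τ := φ.toLinearMap) hφ (x := 1)
      (by simpa using h0) (star x * x)
    simpa using this
  have h1' : 0 ≤ φ 1 := by simpa using hφ 1
  refine ⟨(φ 1)⁻¹ • φ, ⟨by simp [h1], fun a => ?_⟩, ?_⟩
  · simpa using mul_nonneg (inv_nonneg.2 h1') (hφ a)
  · simp [h1, hne]

/-- Every state is a vector state: the representation is the one of Gelfand, Naimark and Segal. -/
theorem IsState.exists_vector {φ : A →L[ℂ] ℂ} (hφ : IsState φ) :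
    ∃ (π : HilbertRep.{u} A) (ξ : π.H), ∀ a, φ a = ⟪ξ, π.rep a ξ⟫_ℂ := by
  let _ := CStarAlgebra.spectralOrder A
  have _ := CStarAlgebra.spectralOrderedRing A
  let f : A →ₚ[ℂ] ℂ := PositiveLinearMap.mk₀ φ.toLinearMap fun a ha => by
    obtain ⟨b, rfl⟩ := CStarAlgebra.nonneg_iff_eq_star_mul_self.1 ha
    exact hφ.nonneg b
  have hf : ∀ a, f a = φ a := fun a => rfl
  let ξ : f.GNS := ((f.toPreGNS 1 : f.PreGNS) : f.GNS)
  have hξ : ∀ a, φ a = ⟪ξ, f.gnsStarAlgHom a ξ⟫_ℂ := by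
    intro a
    change φ a = ⟪ξ, f.gnsNonUnitalStarAlgHom a ξ⟫_ℂ
    simp only [ξ]
    rw [PositiveLinearMap.gnsNonUnitalStarAlgHom_apply_coe, UniformSpace.Completion.inner_coe,
      PositiveLinearMap.preGNS_inner_def]
    simp [hf]
  have hnt : Nontrivial f.GNS := ⟨⟨ξ, 0, fun h => by
    have := hξ 1
    rw [h] at this
    simp [hφ.map_one] at this⟩⟩
  exact ⟨{ H := f.GNS, rep := f.gnsStarAlgHom }, ξ, hξ⟩

theorem HilbertRep.bounded_id (A : Type u) [CStarAlgebra A] :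
    HilbertRep.Bounded (fun π : HilbertRep.{u} A => π) := fun a => ⟨‖a‖, by
  rintro _ ⟨π, rfl⟩
  exact HilbertRep.norm_rep_le π a⟩

/-- The representations on Hilbert spaces determine the norm of a C*-algebra. -/
theorem norm_le_of_forall_rep {a : A} {C : ℝ} (hC : 0 ≤ C)
    (h : ∀ π : HilbertRep.{u} A, ‖π.rep a‖ ≤ C) : ‖a‖ ≤ C := by
  let F : A →⋆ₐ[ℂ] HilbertRep.ProdAlg (fun π : HilbertRep.{u} A => π) :=
    HilbertRep.ProdAlg.lift (fun π => π.rep) (HilbertRep.bounded_id A)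
  have hinj : Function.Injective F := by
    refine (injective_iff_map_eq_zero F).2 fun x hx => ?_
    by_contra hne
    obtain ⟨φ, hφ, hφx⟩ := exists_isState_ne_zero hne
    obtain ⟨π, ξ, hπ⟩ := hφ.exists_vector
    have h0 : π.rep x = 0 :=
      congrArg (HilbertRep.ProdAlg.coord (fun π : HilbertRep.{u} A => π) π) hx
    rw [hπ, map_mul, h0, mul_zero] at hφx
    simp at hφx
  have h1 : ‖F a‖ = ‖a‖ := NonUnitalStarAlgHom.norm_map F hinj a
  rw [← h1, HilbertRep.ProdAlg.norm_eq]
  exact Real.iSup_le h hC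

/-- On a finite-dimensional subspace some state is faithful. -/
theorem exists_isState_faithful [Nontrivial A] (V : Submodule ℂ A) [FiniteDimensional ℂ V] :
    ∃ φ : A →L[ℂ] ℂ, IsState φ ∧ ∀ x ∈ V, φ (star x * x) = 0 → x = 0 := by
  let N : (φ : A →L[ℂ] ℂ) → IsState φ → Submodule ℂ A := fun φ hφ =>
    { carrier := {x | x ∈ V ∧ φ (star x * x) = 0}
      zero_mem' := ⟨V.zero_mem, by simp⟩
      add_mem' := by
        rintro x y ⟨hx, hx'⟩ ⟨hy, hy'⟩
        have e := PositiveFunctional.apply_mul_eq_zero (τ := φ.toLinearMap) hφ.nonneg hx'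
        have e' := PositiveFunctional.apply_mul_eq_zero (τ := φ.toLinearMap) hφ.nonneg hy'
        have h := e (star (x + y))
        have h' := e' (star (x + y))
        refine ⟨V.add_mem hx hy, ?_⟩
        rw [mul_add, map_add]
        exact (congrArg₂ (· + ·) h h').trans (add_zero 0)
      smul_mem' := by
        rintro c x ⟨hx, hx'⟩
        refine ⟨V.smul_mem c hx, ?_⟩
        simp [hx'] }
  have hNV : ∀ φ hφ, N φ hφ ≤ V := fun φ hφ x hx => hx.1
  obtain ⟨φ₀, hφ₀, -⟩ := exists_isState_ne_zero (one_ne_zero (α := A))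
  let P : ℕ → Prop := fun n => ∃ φ, ∃ hφ : IsState φ, Module.finrank ℂ (N φ hφ) = n
  have hP : ∃ n, P n := ⟨_, φ₀, hφ₀, rfl⟩
  classical
  obtain ⟨φ, hφ, hn⟩ := Nat.find_spec hP
  refine ⟨φ, hφ, fun x hxV hx => ?_⟩
  by_contra hne
  obtain ⟨ψ, hψ, hψx⟩ := exists_isState_ne_zero hne
  -- Averaging with a state that sees `x` makes the null space strictly smaller.
  let χ : A →L[ℂ] ℂ := (1 / 2 : ℂ) • (φ + ψ)
  have hχ : IsState χ := by
    refine ⟨?_, fun a => ?_⟩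
    · simp only [χ, _root_.smul_apply, _root_.add_apply, hφ.map_one,
        hψ.map_one, smul_eq_mul]
      norm_num
    · simp only [χ, _root_.smul_apply, _root_.add_apply, smul_eq_mul]
      refine mul_nonneg ?_ (add_nonneg (hφ.nonneg a) (hψ.nonneg a))
      rw [Complex.nonneg_iff]; norm_num
  have hsplit : ∀ a, χ (star a * a) = 0 → φ (star a * a) = 0 ∧ ψ (star a * a) = 0 := by
    intro a ha
    simp only [χ, _root_.smul_apply, _root_.add_apply, smul_eq_mul] at ha
    have ha' : φ (star a * a) + ψ (star a * a) = 0 :=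
      (mul_eq_zero.1 ha).resolve_left (by norm_num)
    exact (add_eq_zero_iff_of_nonneg (hφ.nonneg a) (hψ.nonneg a)).1 ha'
  have hlt : N χ hχ < N φ hφ := by
    refine lt_of_le_of_ne (fun y hy => ⟨hy.1, (hsplit y hy.2).1⟩) fun heq => ?_
    have hxN : x ∈ N χ hχ := heq ▸ (⟨hxV, hx⟩ : x ∈ N φ hφ)
    exact hψx (hsplit x hxN.2).2
  have : FiniteDimensional ℂ (N φ hφ) := Submodule.finiteDimensional_of_le (hNV φ hφ)
  have := Submodule.finrank_lt_finrank_of_lt hlt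
  exact Nat.find_min hP (hn ▸ this) ⟨χ, hχ, rfl⟩

end

/-! ### Slice maps on the minimal tensor product -/

namespace MinTensor

variable {A B C D : Type u} [CStarAlgebra A] [CStarAlgebra B] [CStarAlgebra C] [CStarAlgebra D]

theorem continuous_starAlgHom {X : Type v} {Y : Type w} [CStarAlgebra X] [CStarAlgebra Y]
    (F : X →⋆ₐ[ℂ] Y) : Continuous F :=
  AddMonoidHomClass.continuous_of_bound F 1 fun t => by
    rw [one_mul]; exact NonUnitalStarAlgHom.norm_apply_le F t

theorem denseRange_of : DenseRange (of A B) := HilbertRep.Envelope.denseRange_of _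

/-- Continuous additive maps on the minimal tensor product are determined by elementary tensors. -/
theorem eq_of_tmul {E : Type v} [TopologicalSpace E] [T2Space E] [AddGroup E]
    {f g : MinTensor A B → E} (hf : Continuous f) (hg : Continuous g)
    (hf' : ∀ s t, f (s + t) = f s + f t) (hg' : ∀ s t, g (s + t) = g s + g t)
    (h : ∀ a b, f (of A B (a ⊗ₜ b)) = g (of A B (a ⊗ₜ b))) (t : MinTensor A B) : f t = g t := by
  refine congrFun (denseRange_of.equalizer hf hg (funext fun x => ?_)) t
  change f (of A B x) = g (of A B x)
  induction x using TensorProduct.induction_on with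
  | zero => simpa using h 0 0
  | tmul a b => exact h a b
  | add x y hx hy => rw [map_add, hf', hg', hx, hy]

theorem of_tmul_mul (a a' : A) (b b' : B) :
    of A B (a ⊗ₜ b) * of A B (a' ⊗ₜ b') = of A B ((a * a') ⊗ₜ (b * b')) := by
  rw [← map_mul, Algebra.TensorProduct.tmul_mul_tmul]

theorem star_of_tmul (a : A) (b : B) : star (of A B (a ⊗ₜ b)) = of A B (star a ⊗ₜ star b) := by
  rw [← map_star, TensorProduct.star_tmul]

theorem of₃_tmul_mul (a a' : A) (b b' : B) (c c' : C) :
    of₃ A B C ((a ⊗ₜ b) ⊗ₜ c) * of₃ A B C ((a' ⊗ₜ b') ⊗ₜ c') =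
      of₃ A B C (((a * a') ⊗ₜ (b * b')) ⊗ₜ (c * c')) := by
  rw [← map_mul, Algebra.TensorProduct.tmul_mul_tmul, Algebra.TensorProduct.tmul_mul_tmul]

theorem inclFirst_of (a : A) (b : B) :
    (inclFirst (of A B (a ⊗ₜ b)) : MinTensor₃ A B C) = of₃ A B C ((a ⊗ₜ b) ⊗ₜ 1) := by
  refine HilbertRep.Envelope.ext_coord fun i => ?_
  change HilbertTensor.map (HilbertTensor.map (i.1.rep a) (i.2.1.rep b)) 1 =
    HilbertTensor.map (HilbertTensor.map (i.1.rep a) (i.2.1.rep b)) (i.2.2.rep 1)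
  rw [map_one]

theorem inclLast_of (b : B) (c : C) :
    (inclLast (of B C (b ⊗ₜ c)) : MinTensor₃ A B C) = of₃ A B C ((1 ⊗ₜ b) ⊗ₜ c) := by
  refine HilbertRep.Envelope.ext_coord fun i => ?_
  change conjAssoc i.1 i.2.1 i.2.2 (HilbertTensor.map 1
      (HilbertTensor.map (i.2.1.rep b) (i.2.2.rep c))) =
    HilbertTensor.map (HilbertTensor.map (i.1.rep 1) (i.2.1.rep b)) (i.2.2.rep c)
  rw [conjAssoc_map, map_one]

theorem inner_tmul (π : HilbertRep.{u} A) (ρ : HilbertRep.{u} B) (a : A) (b : B)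
    (x x' : π.H) (y y' : ρ.H) :
    ⟪HilbertTensor.incl _ _ (x' ⊗ₜ y'), coord π ρ (of A B (a ⊗ₜ b))
      (HilbertTensor.incl _ _ (x ⊗ₜ y))⟫_ℂ = ⟪x', π.rep a x⟫_ℂ * ⟪y', ρ.rep b y⟫_ℂ := by
  rw [coord_tmul, HilbertTensor.map_tmul, LinearIsometry.inner_map_map, TensorProduct.inner_tmul]

theorem norm_coord_le (π : HilbertRep.{u} A) (ρ : HilbertRep.{u} B) (t : MinTensor A B) :
    ‖coord π ρ t‖ ≤ ‖t‖ := NonUnitalStarAlgHom.norm_apply_le (coord π ρ) t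

/-- The algebraic slice map `a ⊗ b ↦ ψ(b) a`. -/
def algRightSlice (ψ : B →L[ℂ] ℂ) : A ⊗[ℂ] B →ₗ[ℂ] A :=
  (TensorProduct.rid ℂ A).toLinearMap ∘ₗ (ψ.toLinearMap.lTensor A)

/-- The algebraic slice map `a ⊗ b ↦ φ(a) b`. -/
def algLeftSlice (φ : A →L[ℂ] ℂ) : A ⊗[ℂ] B →ₗ[ℂ] B :=
  (TensorProduct.lid ℂ B).toLinearMap ∘ₗ (φ.toLinearMap.rTensor B)

theorem norm_vector_of_isState {φ : A →L[ℂ] ℂ} (hφ : IsState φ) {π : HilbertRep.{u} A} {ξ : π.H}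
    (h : ∀ a, φ a = ⟪ξ, π.rep a ξ⟫_ℂ) : ‖ξ‖ = 1 := by
  have h1 := h 1
  rw [hφ.map_one, map_one, one_apply_eq_self, inner_self_eq_norm_sq_to_K] at h1
  have h2 : ‖ξ‖ ^ 2 = 1 := by
    have h3 := congrArg Complex.re h1
    rw [← RCLike.ofReal_pow] at h3
    exact h3.symm
  nlinarith [norm_nonneg ξ]

theorem opNorm_le_of_inner {H : Type v} [NormedAddCommGroup H] [InnerProductSpace ℂ H]
    (T : H →L[ℂ] H) {C : ℝ} (hC : 0 ≤ C) (h : ∀ x y, ‖⟪y, T x⟫_ℂ‖ ≤ C * ‖x‖ * ‖y‖) :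
    ‖T‖ ≤ C := by
  refine T.opNorm_le_bound hC fun x => ?_
  have h1 := h x (T x)
  rw [inner_self_eq_norm_sq_to_K, norm_pow, RCLike.norm_ofReal, abs_norm] at h1
  rcases (norm_nonneg (T x)).eq_or_lt with h0 | h0
  · rw [← h0]; positivity
  · nlinarith

theorem norm_algRightSlice_le {ψ : B →L[ℂ] ℂ} (hψ : IsState ψ) (x : A ⊗[ℂ] B) :
    ‖algRightSlice ψ x‖ ≤ ‖of A B x‖ := by
  obtain ⟨ρ, ξ, hρ⟩ := hψ.exists_vector
  have hξ := norm_vector_of_isState hψ hρ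
  refine norm_le_of_forall_rep (norm_nonneg _) fun π => ?_
  refine opNorm_le_of_inner _ (norm_nonneg _) fun y y' => ?_
  have key : ⟪y', π.rep (algRightSlice ψ x) y⟫_ℂ =
      ⟪HilbertTensor.incl _ _ (y' ⊗ₜ ξ), coord π ρ (of A B x)
        (HilbertTensor.incl _ _ (y ⊗ₜ ξ))⟫_ℂ := by
    induction x using TensorProduct.induction_on with
    | zero => simp
    | add x x' hx hx' =>
      simp only [map_add, _root_.add_apply, inner_add_right, hx, hx']
    | tmul a b =>
      rw [inner_tmul, ← hρ]
      simp [algRightSlice, mul_comm]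
  rw [key]
  refine (norm_inner_le_norm _ _).trans ?_
  have h1 := ((coord π ρ) (of A B x)).le_of_opNorm_le (norm_coord_le π ρ (of A B x))
    (HilbertTensor.incl _ _ (y ⊗ₜ ξ))
  rw [LinearIsometry.norm_map, TensorProduct.norm_tmul, hξ, mul_one] at h1 ⊢
  rw [mul_comm]
  exact mul_le_mul_of_nonneg_right h1 (norm_nonneg _)

theorem norm_algLeftSlice_le {φ : A →L[ℂ] ℂ} (hφ : IsState φ) (x : A ⊗[ℂ] B) :
    ‖algLeftSlice φ x‖ ≤ ‖of A B x‖ := by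
  obtain ⟨π, ξ, hπ⟩ := hφ.exists_vector
  have hξ := norm_vector_of_isState hφ hπ
  refine norm_le_of_forall_rep (norm_nonneg _) fun ρ => ?_
  refine opNorm_le_of_inner _ (norm_nonneg _) fun y y' => ?_
  have key : ⟪y', ρ.rep (algLeftSlice φ x) y⟫_ℂ =
      ⟪HilbertTensor.incl _ _ (ξ ⊗ₜ y'), coord π ρ (of A B x)
        (HilbertTensor.incl _ _ (ξ ⊗ₜ y))⟫_ℂ := by
    induction x using TensorProduct.induction_on with
    | zero => simp
    | add x x' hx hx' =>
      simp only [map_add, _root_.add_apply, inner_add_right, hx, hx']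
    | tmul a b =>
      rw [inner_tmul, ← hπ]
      simp [algLeftSlice]
  rw [key]
  refine (norm_inner_le_norm _ _).trans ?_
  have h1 := ((coord π ρ) (of A B x)).le_of_opNorm_le (norm_coord_le π ρ (of A B x))
    (HilbertTensor.incl _ _ (ξ ⊗ₜ y))
  rw [LinearIsometry.norm_map, TensorProduct.norm_tmul, hξ, one_mul] at h1 ⊢
  rw [mul_comm]
  exact mul_le_mul_of_nonneg_right h1 (norm_nonneg _)

/-- The slice map `id ⊗ ψ : A ⊗ B → A`, for a state `ψ` of `B`. -/
def rightSlice (ψ : B →L[ℂ] ℂ) : MinTensor A B →L[ℂ] A :=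
  (algRightSlice ψ).extendOfNorm (of A B).toAlgHom.toLinearMap

/-- The slice map `φ ⊗ id : A ⊗ B → B`, for a state `φ` of `A`. -/
def leftSlice (φ : A →L[ℂ] ℂ) : MinTensor A B →L[ℂ] B :=
  (algLeftSlice φ).extendOfNorm (of A B).toAlgHom.toLinearMap

theorem rightSlice_of {ψ : B →L[ℂ] ℂ} (hψ : IsState ψ) (a : A) (b : B) :
    rightSlice ψ (of A B (a ⊗ₜ b)) = ψ b • a := by
  have := (algRightSlice (A := A) ψ).extendOfNorm_eq (e := (of A B).toAlgHom.toLinearMap)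
    denseRange_of ⟨1, fun x => by rw [one_mul]; exact norm_algRightSlice_le hψ x⟩ (a ⊗ₜ b)
  exact this.trans (by simp [algRightSlice])

theorem leftSlice_of {φ : A →L[ℂ] ℂ} (hφ : IsState φ) (a : A) (b : B) :
    leftSlice φ (of A B (a ⊗ₜ b)) = φ a • b := by
  have := (algLeftSlice (B := B) φ).extendOfNorm_eq (e := (of A B).toAlgHom.toLinearMap)
    denseRange_of ⟨1, fun x => by rw [one_mul]; exact norm_algLeftSlice_le hφ x⟩ (a ⊗ₜ b)
  exact this.trans (by simp [algLeftSlice])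

/-- The functional `φ ⊗ ψ`. -/
def tensorFunctional (φ : A →L[ℂ] ℂ) (ψ : B →L[ℂ] ℂ) : MinTensor A B →L[ℂ] ℂ :=
  φ.comp (rightSlice ψ)

section
variable {φ : A →L[ℂ] ℂ} {ψ : B →L[ℂ] ℂ}

theorem tensorFunctional_of (hψ : IsState ψ) (a : A) (b : B) :
    tensorFunctional φ ψ (of A B (a ⊗ₜ b)) = φ a * ψ b := by
  rw [tensorFunctional, ContinuousLinearMap.comp_apply, rightSlice_of hψ, map_smul, smul_eq_mul,
    mul_comm]

theorem apply_rightSlice (t : MinTensor A B) :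
    φ (rightSlice ψ t) = tensorFunctional φ ψ t := rfl

theorem apply_leftSlice (hφ : IsState φ) (hψ : IsState ψ) (t : MinTensor A B) :
    ψ (leftSlice φ t) = tensorFunctional φ ψ t := by
  refine eq_of_tmul (f := fun t => ψ (leftSlice φ t)) (g := fun t => tensorFunctional φ ψ t)
    (by fun_prop) (by fun_prop) (fun s t => by simp only [map_add])
    (fun s t => by simp only [map_add]) (fun a b => ?_) t
  simp only [tensorFunctional_of hψ, leftSlice_of hφ, map_smul, smul_eq_mul]

theorem tensorFunctional_nonneg (hφ : IsState φ) (hψ : IsState ψ) (t : MinTensor A B) :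
    0 ≤ tensorFunctional φ ψ (star t * t) := by
  obtain ⟨π, ξ, hπ⟩ := hφ.exists_vector
  obtain ⟨ρ, η, hρ⟩ := hψ.exists_vector
  set ζ := HilbertTensor.incl π.H ρ.H (ξ ⊗ₜ η)
  have hcoord := continuous_starAlgHom (coord π ρ)
  have key : ∀ s, tensorFunctional φ ψ s = ⟪ζ, coord π ρ s ζ⟫_ℂ := by
    refine eq_of_tmul (f := fun t => tensorFunctional φ ψ t) (by fun_prop) (by fun_prop)
      (fun s t => by simp only [map_add])
      (fun s t => by simp only [map_add, _root_.add_apply, inner_add_right])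
      (fun a b => ?_)
    rw [tensorFunctional_of hψ, inner_tmul, hπ, hρ]
  rw [key, map_mul, map_star, mul_apply_eq_comp,
    ContinuousLinearMap.star_eq_adjoint, ContinuousLinearMap.adjoint_inner_right]
  rw [inner_self_eq_norm_sq_to_K]
  positivity

end

/-- The functional `φ ⊗ ψ ⊗ χ` on a triple tensor product. -/
theorem exists_tripleFunctional {φ : A →L[ℂ] ℂ} {ψ : B →L[ℂ] ℂ} {χ : C →L[ℂ] ℂ}
    (hφ : IsState φ) (hψ : IsState ψ) (hχ : IsState χ) :
    ∃ T : MinTensor₃ A B C →L[ℂ] ℂ, ∀ a b c,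
      T (of₃ A B C ((a ⊗ₜ b) ⊗ₜ c)) = φ a * ψ b * χ c := by
  obtain ⟨π, ξ, hπ⟩ := hφ.exists_vector
  obtain ⟨ρ, η, hρ⟩ := hψ.exists_vector
  obtain ⟨σ, θ, hσ⟩ := hχ.exists_vector
  set ζ := HilbertTensor.incl _ σ.H (HilbertTensor.incl π.H ρ.H (ξ ⊗ₜ η) ⊗ₜ θ)
  have hcoord := continuous_starAlgHom (coord₃ π ρ σ)
  let T : MinTensor₃ A B C →ₗ[ℂ] ℂ :=
    { toFun := fun t => ⟪ζ, coord₃ π ρ σ t ζ⟫_ℂ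
      map_add' := fun s t => by simp only [map_add, _root_.add_apply, inner_add_right]
      map_smul' := fun c t => by simp }
  refine ⟨⟨T, by change Continuous fun t => ⟪ζ, coord₃ π ρ σ t ζ⟫_ℂ; fun_prop⟩, fun a b c => ?_⟩
  change ⟪ζ, coord₃ π ρ σ (of₃ A B C ((a ⊗ₜ b) ⊗ₜ c)) ζ⟫_ℂ = _
  rw [coord₃_tmul, HilbertTensor.map_tmul, HilbertTensor.map_tmul, LinearIsometry.inner_map_map,
    TensorProduct.inner_tmul, LinearIsometry.inner_map_map, TensorProduct.inner_tmul,
    hπ, hρ, hσ]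

end MinTensor

namespace CompactQuantumGroup

open MinTensor

variable {A : Type u} [CStarAlgebra A] (G : CompactQuantumGroup A)

/-- The convolution operator `(id ⊗ ψ)Φ`. -/
def convRight (ψ : A →L[ℂ] ℂ) : A →L[ℂ] A :=
  (rightSlice ψ).comp ⟨G.comul.toAlgHom.toLinearMap, continuous_starAlgHom G.comul⟩

/-- The convolution operator `(φ ⊗ id)Φ`. -/
def convLeft (φ : A →L[ℂ] ℂ) : A →L[ℂ] A :=
  (leftSlice φ).comp ⟨G.comul.toAlgHom.toLinearMap, continuous_starAlgHom G.comul⟩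

theorem convRight_apply (ψ : A →L[ℂ] ℂ) (a : A) :
    G.convRight ψ a = rightSlice ψ (G.comul a) := rfl

theorem convLeft_apply (φ : A →L[ℂ] ℂ) (a : A) :
    G.convLeft φ a = leftSlice φ (G.comul a) := rfl

variable {G}
variable {φ ψ χ : A →L[ℂ] ℂ}

/-- Coassociativity, tested on `φ ⊗ ψ ⊗ χ` after multiplication by `c ⊗ d ⊗ 1`. -/
theorem tensorFunctional_mul_comul_convRight (hφ : IsState φ) (hψ : IsState ψ) (hχ : IsState χ)
    (c d a : A) :
    tensorFunctional φ ψ (of A A (c ⊗ₜ d) * G.comul (G.convRight χ a)) =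
      ψ (d * G.convRight χ (leftSlice φ (of A A (c ⊗ₜ 1) * G.comul a))) := by
  obtain ⟨T, hT⟩ := exists_tripleFunctional hφ hψ hχ
  have hΔ := continuous_starAlgHom G.comul
  have hfirst := continuous_starAlgHom (inclFirst : MinTensor A A →⋆ₐ[ℂ] MinTensor₃ A A A)
  have hlast := continuous_starAlgHom (inclLast : MinTensor A A →⋆ₐ[ℂ] MinTensor₃ A A A)
  have hL := continuous_starAlgHom (ampLeft G.comul : MinTensor A A →⋆ₐ[ℂ] MinTensor₃ A A A)
  have hR := continuous_starAlgHom (ampRight G.comul : MinTensor A A →⋆ₐ[ℂ] MinTensor₃ A A A)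
  have h1 : ∀ t, tensorFunctional φ ψ (of A A (c ⊗ₜ d) * G.comul (rightSlice χ t)) =
      T (of₃ A A A ((c ⊗ₜ d) ⊗ₜ 1) * ampLeft G.comul t) := by
    refine eq_of_tmul
      (f := fun t => tensorFunctional φ ψ (of A A (c ⊗ₜ d) * G.comul (rightSlice χ t)))
      (by fun_prop) (by fun_prop) (fun s t => by simp only [map_add, mul_add])
      (fun s t => by simp only [map_add, mul_add]) (fun x y => ?_)
    rw [rightSlice_of hχ, ampLeft_tmul, map_smul, mul_smul_comm, map_smul, smul_eq_mul]
    refine eq_of_tmul (f := fun s => χ y * tensorFunctional φ ψ (of A A (c ⊗ₜ d) * s))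
      (g := fun s => T (of₃ A A A ((c ⊗ₜ d) ⊗ₜ 1) * (inclFirst s * of₃ A A A ((1 ⊗ₜ 1) ⊗ₜ y))))
      (by fun_prop) (by fun_prop) (fun s t => by simp only [map_add, mul_add])
      (fun s t => by simp only [map_add, mul_add, add_mul]) (fun p q => ?_) (G.comul x)
    simp only [inclFirst_of, of₃_tmul_mul, of_tmul_mul, tensorFunctional_of hψ, hT, mul_one,
      one_mul]
    ring
  have h2 : ∀ t, T (of₃ A A A ((c ⊗ₜ d) ⊗ₜ 1) * ampRight G.comul t) =
      ψ (d * rightSlice χ (G.comul (leftSlice φ (of A A (c ⊗ₜ 1) * t)))) := by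
    refine eq_of_tmul (g := fun t => ψ (d * rightSlice χ (G.comul (leftSlice φ
        (of A A (c ⊗ₜ 1) * t)))))
      (by fun_prop) (by fun_prop) (fun s t => by simp only [map_add, mul_add])
      (fun s t => by simp only [map_add, mul_add]) (fun x y => ?_)
    rw [of_tmul_mul, leftSlice_of hφ, ampRight_tmul, one_mul, map_smul, map_smul, mul_smul_comm,
      map_smul, smul_eq_mul]
    refine eq_of_tmul
      (f := fun s => T (of₃ A A A ((c ⊗ₜ d) ⊗ₜ 1) * (of₃ A A A ((x ⊗ₜ 1) ⊗ₜ 1) * inclLast s)))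
      (g := fun s => φ (c * x) * ψ (d * rightSlice χ s))
      (by fun_prop) (by fun_prop) (fun s t => by simp only [map_add, mul_add])
      (fun s t => by simp only [map_add, mul_add]) (fun p q => ?_) (G.comul y)
    simp only [inclLast_of, of₃_tmul_mul, rightSlice_of hχ, hT, mul_one, one_mul, mul_smul_comm,
      map_smul, smul_eq_mul]
    ring
  rw [convRight_apply, h1, G.coassoc, h2, convRight_apply]

/-- Coassociativity, tested on `χ ⊗ ψ ⊗ φ` after multiplication by `1 ⊗ d ⊗ c`. -/
theorem tensorFunctional_mul_comul_convLeft (hφ : IsState φ) (hψ : IsState ψ) (hχ : IsState χ)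
    (c d a : A) :
    tensorFunctional ψ φ (of A A (d ⊗ₜ c) * G.comul (G.convLeft χ a)) =
      ψ (d * G.convLeft χ (rightSlice φ (of A A (1 ⊗ₜ c) * G.comul a))) := by
  obtain ⟨T, hT⟩ := exists_tripleFunctional hχ hψ hφ
  have hΔ := continuous_starAlgHom G.comul
  have hfirst := continuous_starAlgHom (inclFirst : MinTensor A A →⋆ₐ[ℂ] MinTensor₃ A A A)
  have hlast := continuous_starAlgHom (inclLast : MinTensor A A →⋆ₐ[ℂ] MinTensor₃ A A A)
  have hL := continuous_starAlgHom (ampLeft G.comul : MinTensor A A →⋆ₐ[ℂ] MinTensor₃ A A A)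
  have hR := continuous_starAlgHom (ampRight G.comul : MinTensor A A →⋆ₐ[ℂ] MinTensor₃ A A A)
  have h1 : ∀ t, tensorFunctional ψ φ (of A A (d ⊗ₜ c) * G.comul (leftSlice χ t)) =
      T (of₃ A A A ((1 ⊗ₜ d) ⊗ₜ c) * ampRight G.comul t) := by
    refine eq_of_tmul
      (f := fun t => tensorFunctional ψ φ (of A A (d ⊗ₜ c) * G.comul (leftSlice χ t)))
      (by fun_prop) (by fun_prop) (fun s t => by simp only [map_add, mul_add])
      (fun s t => by simp only [map_add, mul_add]) (fun x y => ?_)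
    rw [leftSlice_of hχ, ampRight_tmul, map_smul, mul_smul_comm, map_smul, smul_eq_mul]
    refine eq_of_tmul (f := fun s => χ x * tensorFunctional ψ φ (of A A (d ⊗ₜ c) * s))
      (g := fun s => T (of₃ A A A ((1 ⊗ₜ d) ⊗ₜ c) * (of₃ A A A ((x ⊗ₜ 1) ⊗ₜ 1) * inclLast s)))
      (by fun_prop) (by fun_prop) (fun s t => by simp only [map_add, mul_add])
      (fun s t => by simp only [map_add, mul_add]) (fun p q => ?_) (G.comul y)
    simp only [inclLast_of, of₃_tmul_mul, of_tmul_mul, tensorFunctional_of hφ, hT, mul_one,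
      one_mul]
    ring
  have h2 : ∀ t, T (of₃ A A A ((1 ⊗ₜ d) ⊗ₜ c) * ampLeft G.comul t) =
      ψ (d * leftSlice χ (G.comul (rightSlice φ (of A A (1 ⊗ₜ c) * t)))) := by
    refine eq_of_tmul (g := fun t => ψ (d * leftSlice χ (G.comul (rightSlice φ
        (of A A (1 ⊗ₜ c) * t)))))
      (by fun_prop) (by fun_prop) (fun s t => by simp only [map_add, mul_add])
      (fun s t => by simp only [map_add, mul_add]) (fun x y => ?_)
    rw [of_tmul_mul, rightSlice_of hφ, ampLeft_tmul, one_mul, map_smul, map_smul, mul_smul_comm,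
      map_smul, smul_eq_mul]
    refine eq_of_tmul
      (f := fun s => T (of₃ A A A ((1 ⊗ₜ d) ⊗ₜ c) * (inclFirst s * of₃ A A A ((1 ⊗ₜ 1) ⊗ₜ y))))
      (g := fun s => φ (c * y) * ψ (d * leftSlice χ s))
      (by fun_prop) (by fun_prop) (fun s t => by simp only [map_add, mul_add, add_mul])
      (fun s t => by simp only [map_add, mul_add]) (fun p q => ?_) (G.comul x)
    simp only [inclFirst_of, of₃_tmul_mul, leftSlice_of hχ, hT, mul_one, one_mul, mul_smul_comm,
      map_smul, smul_eq_mul]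
    ring
  rw [convLeft_apply, h1, ← G.coassoc, h2, convLeft_apply]

end CompactQuantumGroup

/-! ### Haar states on finite-dimensional subspaces -/

section
variable {A : Type u} [CStarAlgebra A]

theorem IsState.norm_apply_le {φ : A →L[ℂ] ℂ} (hφ : IsState φ) (a : A) : ‖φ a‖ ≤ ‖a‖ := by
  obtain ⟨π, ξ, hπ⟩ := hφ.exists_vector
  have hξ := MinTensor.norm_vector_of_isState hφ hπ
  rw [hπ]
  refine (norm_inner_le_norm _ _).trans ?_
  have := (π.rep a).le_of_opNorm_le (HilbertRep.norm_rep_le π a) ξ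
  rw [hξ, mul_one] at this
  rw [hξ, one_mul]
  exact this

/-- Weak-* compactness of the set of states, in the form of limits along an ultrafilter. -/
theorem exists_isState_tendsto (s : ℕ → A →L[ℂ] ℂ) (hs : ∀ n, IsState (s n)) :
    ∃ h : A →L[ℂ] ℂ, IsState h ∧
      ∀ a, Tendsto (fun n => s n a) (hyperfilter ℕ : Filter ℕ) (𝓝 (h a)) := by
  have hlim : ∀ a, ∃ z, Tendsto (fun n => s n a) (hyperfilter ℕ : Filter ℕ) (𝓝 z) := by
    intro a
    have hmem : Metric.closedBall (0 : ℂ) ‖a‖ ∈ (hyperfilter ℕ).map fun n => s n a :=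
      Filter.mem_map.2 (Filter.univ_mem' fun n => by
        simpa using (hs n).norm_apply_le a)
    obtain ⟨z, -, hz⟩ := (isCompact_closedBall (0 : ℂ) ‖a‖).ultrafilter_le_nhds'
      ((hyperfilter ℕ).map fun n => s n a) hmem
    exact ⟨z, hz⟩
  choose f hf using hlim
  let F : A →ₗ[ℂ] ℂ :=
    { toFun := f
      map_add' := fun a b => tendsto_nhds_unique (hf (a + b))
        (by simpa only [map_add] using (hf a).add (hf b))
      map_smul' := fun c a => tendsto_nhds_unique (hf (c • a))
        (by simpa only [map_smul, RingHom.id_apply] using (hf a).const_smul c) }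
  refine ⟨F.mkContinuous 1 fun a => ?_, ⟨?_, fun a => ?_⟩, hf⟩
  · rw [one_mul]
    exact le_of_tendsto (hf a).norm (Eventually.of_forall fun n => (hs n).norm_apply_le a)
  · refine tendsto_nhds_unique (hf 1) ?_
    simp only [(hs _).map_one]
    exact tendsto_const_nhds
  · exact ge_of_tendsto (hf (star a * a)) (Eventually.of_forall fun n => (hs n).nonneg a)

end

namespace CompactQuantumGroup

open MinTensor

variable {A : Type u} [CStarAlgebra A]

/-- The lemma of Van Daele behind the existence of the Haar state. Here `τ` is the tensor product
of a state `ω` and of a state `h` invariant under convolution with `ω`, and `N` is the convolution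
with `h`. For `X = Δ(N a) - N a ⊗ 1` one has `τ (X^* X) = 0`, so that `τ` vanishes on the left ideal
generated by `X`; the density of the span of `(A ⊗ 1) Δ(A)` then yields `ω (d N q) = ω (d) h (q)`
for all `d` and `q`. The two embeddings of `A` are variables, because the lemma is applied on both
sides. -/
theorem apply_star_sub_mul_sub_eq_zero
    (Δ ι₁ ι₂ : A →⋆ₐ[ℂ] MinTensor A A) (hcomm : ∀ c d, ι₁ c * ι₂ d = ι₂ d * ι₁ c)
    (τ : MinTensor A A →L[ℂ] ℂ) (hτ : ∀ t, 0 ≤ τ (star t * t))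
    {h ω : A →L[ℂ] ℂ} (hh : IsState h) (hω : IsState ω)
    (N : A →L[ℂ] A) (L : MinTensor A A →L[ℂ] A)
    (h1 : ∀ x, τ (Δ x) = h x) (h2 : ∀ c d, τ (ι₁ c * ι₂ d) = h c * ω d)
    (h3 : ∀ c d a, τ (ι₁ c * ι₂ d * Δ (N a)) = ω (d * N (L (ι₁ c * Δ a))))
    (h4 : ∀ x, ω (N x) = h x) (h5 : ∀ c a, h (L (ι₁ c * Δ a)) = h (c * N a))
    (h6 : ∀ q, L (ι₂ q) = q)
    (hdense : Dense (Submodule.span ℂ {t | ∃ a b, t = ι₁ a * Δ b} : Set (MinTensor A A)))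
    (q : A) : ω (star (N q - h q • 1) * (N q - h q • 1)) = 0 := by
  have k1 : ∀ c a, τ (ι₁ c * Δ (N a)) = h (c * N a) := by
    intro c a
    have := h3 c 1 a
    rwa [map_one, mul_one, one_mul, h4, h5] at this
  have k2 : ∀ c d a, τ (ι₁ c * ι₂ d * Δ (N a)) = ω d * h (L (ι₁ c * Δ a)) := by
    intro c d a
    set b := N a with hb
    have hX : τ (star (Δ b - ι₁ b) * (Δ b - ι₁ b)) = 0 := by
      have e1 : τ (star (Δ b) * Δ b) = h (star b * b) := by rw [← map_star, ← map_mul, h1]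
      have e2 : τ (star (ι₁ b) * Δ b) = h (star b * b) := by rw [← map_star, hb, k1]
      have e3 : τ (star (Δ b) * ι₁ b) = h (star b * b) := by
        have := PositiveFunctional.apply_star_mul_conj (τ := τ.toLinearMap) hτ (Δ b) (ι₁ b)
        change conj (τ (star (ι₁ b) * Δ b)) = τ (star (Δ b) * ι₁ b) at this
        rw [← this, e2]
        exact Complex.conj_eq_iff_im.2 (Complex.nonneg_iff.1 (hh.nonneg b)).2.symm
      have e4 : τ (star (ι₁ b) * ι₁ b) = h (star b * b) := by
        have := h2 (star b * b) 1
        rwa [map_one, mul_one, hω.map_one, mul_one, map_mul, map_star] at this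
      rw [star_sub, sub_mul, mul_sub, mul_sub, map_sub, map_sub, map_sub, e1, e2, e3, e4]
      ring
    have h0 := PositiveFunctional.apply_mul_eq_zero (τ := τ.toLinearMap) hτ hX (ι₁ c * ι₂ d)
    change τ (ι₁ c * ι₂ d * (Δ b - ι₁ b)) = 0 at h0
    rw [mul_sub, map_sub, sub_eq_zero] at h0
    rw [h0, mul_assoc, ← hcomm, ← mul_assoc, ← map_mul, h2, hb, h5, mul_comm]
  have k3 : ∀ d t, ω (d * N (L t)) = ω d * h (L t) := by
    intro d t
    have hc1 : Continuous fun t => ω (d * N (L t)) := by fun_prop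
    have hc2 : Continuous fun t => ω d * h (L t) := by fun_prop
    refine congrFun (Continuous.ext_on hdense hc1 hc2 fun t ht => ?_) t
    induction ht using Submodule.span_induction with
    | mem t ht =>
      obtain ⟨c, a, rfl⟩ := ht
      rw [← h3, k2]
    | zero => simp
    | add s t _ _ hs ht => simp only [map_add, mul_add] at hs ht ⊢; rw [hs, ht]
    | smul r t _ ht => simp only [map_smul, mul_smul_comm, smul_eq_mul] at ht ⊢; rw [ht]; ring
  have k4 : ∀ d, ω (d * (N q - h q • 1)) = 0 := by
    intro d
    have := k3 d (ι₂ q)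
    rw [h6] at this
    rw [mul_sub, map_sub, this, mul_smul_comm, mul_one, map_smul, smul_eq_mul]
    ring
  exact k4 _

variable {G : CompactQuantumGroup A} {φ ψ h ω : A →L[ℂ] ℂ}

theorem convRight_one (hψ : IsState ψ) : G.convRight ψ 1 = 1 := by
  rw [convRight_apply, map_one, ← map_one (of A A), Algebra.TensorProduct.one_def,
    rightSlice_of hψ, hψ.map_one, one_smul]

theorem IsState.comp_convRight (hφ : IsState φ) (hψ : IsState ψ) :
    IsState (φ.comp (G.convRight ψ)) where
  map_one := by
    rw [ContinuousLinearMap.comp_apply, convRight_one hψ, hφ.map_one]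
  nonneg a := by
    rw [ContinuousLinearMap.comp_apply, convRight_apply, apply_rightSlice, map_mul, map_star]
    exact tensorFunctional_nonneg hφ hψ _

theorem convLeft_convRight (hφ : IsState φ) (hψ : IsState ψ) (hω : IsState ω) (a : A) :
    ψ (G.convLeft φ (G.convRight ω a)) = ψ (G.convRight ω (G.convLeft φ a)) := by
  have := tensorFunctional_mul_comul_convRight (G := G) hφ hψ hω 1 1 a
  rw [← Algebra.TensorProduct.one_def, map_one, one_mul, one_mul, one_mul,
    ← apply_leftSlice hφ hψ] at this
  exact this

/-- The convolution powers of a state. -/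
def convPow (G : CompactQuantumGroup A) (ω : A →L[ℂ] ℂ) : ℕ → A →L[ℂ] ℂ
  | 0 => ω
  | n + 1 => (convPow G ω n).comp (G.convRight ω)

theorem isState_convPow (hω : IsState ω) : ∀ n, IsState (G.convPow ω n)
  | 0 => hω
  | n + 1 => IsState.comp_convRight (isState_convPow hω n) hω

theorem convPow_convRight (n : ℕ) (a : A) :
    G.convPow ω n (G.convRight ω a) = G.convPow ω (n + 1) a := rfl

theorem convPow_convLeft (hω : IsState ω) (n : ℕ) (a : A) :
    G.convPow ω n (G.convLeft ω a) = G.convPow ω (n + 1) a := by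
  induction n generalizing a with
  | zero =>
    change ω (leftSlice ω (G.comul a)) = ω (rightSlice ω (G.comul a))
    rw [apply_leftSlice hω hω, apply_rightSlice]
  | succ n ih =>
    rw [← convPow_convRight, ← convLeft_convRight hω (isState_convPow hω n) hω, ih,
      convPow_convRight]

/-- The averages of the convolution powers of a state. -/
def convAverage (G : CompactQuantumGroup A) (ω : A →L[ℂ] ℂ) (n : ℕ) : A →L[ℂ] ℂ :=
  ((n : ℂ) + 1)⁻¹ • ∑ k ∈ Finset.range (n + 1), G.convPow ω k

theorem convAverage_apply (n : ℕ) (a : A) :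
    G.convAverage ω n a = ((n : ℂ) + 1)⁻¹ * ∑ k ∈ Finset.range (n + 1), G.convPow ω k a := by
  simp [convAverage, _root_.sum_apply]

theorem isState_convAverage (hω : IsState ω) (n : ℕ) : IsState (G.convAverage ω n) where
  map_one := by
    rw [convAverage_apply]
    simp only [(isState_convPow hω _).map_one]
    have : (n : ℂ) + 1 ≠ 0 := by exact_mod_cast n.succ_ne_zero
    simp [this]
  nonneg a := by
    rw [convAverage_apply]
    refine mul_nonneg (inv_nonneg.2 (by positivity)) (Finset.sum_nonneg fun k _ => ?_)
    exact (isState_convPow hω k).nonneg a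

/-- For every state `ω` there is a state `h` with `h * ω = ω * h = h`. -/
theorem exists_isState_conv_invariant (G : CompactQuantumGroup A) (hω : IsState ω) :
    ∃ h : A →L[ℂ] ℂ, IsState h ∧ (∀ a, h (G.convRight ω a) = h a) ∧
      ∀ a, h (G.convLeft ω a) = h a := by
  obtain ⟨h, hh, hlim⟩ := exists_isState_tendsto (G.convAverage ω) (isState_convAverage hω)
  have key : ∀ a b, (∀ k, G.convPow ω k b = G.convPow ω (k + 1) a) → h b = h a := by
    intro a b hab
    have h0 : Tendsto (fun n => G.convAverage ω n b - G.convAverage ω n a)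
        (hyperfilter ℕ : Filter ℕ) (𝓝 0) := by
      refine Tendsto.mono_left ?_ (Nat.hyperfilter_le_atTop)
      refine squeeze_zero_norm (a := fun n : ℕ => 2 * ‖a‖ * (1 / ((n : ℝ) + 1))) (fun n => ?_) ?_
      · have e : G.convAverage ω n b - G.convAverage ω n a =
            ((n : ℂ) + 1)⁻¹ * (G.convPow ω (n + 1) a - G.convPow ω 0 a) := by
          rw [convAverage_apply, convAverage_apply, ← mul_sub, ← Finset.sum_sub_distrib]
          simp only [hab]
          rw [Finset.sum_range_sub fun k => G.convPow ω k a]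
        rw [e, norm_mul, mul_comm, norm_inv]
        have e2 : ‖(n : ℂ) + 1‖ = (n : ℝ) + 1 := by
          exact_mod_cast Complex.norm_natCast (n + 1)
        rw [e2, one_div]
        refine mul_le_mul_of_nonneg_right ?_ (by positivity)
        refine (norm_sub_le _ _).trans ?_
        have := (isState_convPow (G := G) hω (n + 1)).norm_apply_le a
        have := (isState_convPow (G := G) hω 0).norm_apply_le a
        linarith
      · have := (tendsto_one_div_add_atTop_nhds_zero_nat (𝕜 := ℝ)).const_mul (2 * ‖a‖)
        simpa using this
    exact sub_eq_zero.1 (tendsto_nhds_unique ((hlim b).sub (hlim a)) h0)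
  exact ⟨h, hh, fun a => key a _ fun k => convPow_convRight k a,
    fun a => key a _ fun k => convPow_convLeft hω k a⟩

/-- The embedding `a ↦ a ⊗ 1`. -/
def inl (A : Type u) [CStarAlgebra A] : A →⋆ₐ[ℂ] MinTensor A A :=
  { (of A A).toAlgHom.comp Algebra.TensorProduct.includeLeft with
    map_star' := fun a => by
      change of A A (star a ⊗ₜ 1) = star (of A A (a ⊗ₜ 1))
      rw [star_of_tmul, star_one] }

/-- The embedding `a ↦ 1 ⊗ a`. -/
def inr (A : Type u) [CStarAlgebra A] : A →⋆ₐ[ℂ] MinTensor A A :=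
  { (of A A).toAlgHom.comp Algebra.TensorProduct.includeRight with
    map_star' := fun a => by
      change of A A (1 ⊗ₜ star a) = star (of A A (1 ⊗ₜ a))
      rw [star_of_tmul, star_one] }

theorem inl_apply (a : A) : inl A a = of A A (a ⊗ₜ 1) := rfl

theorem inr_apply (a : A) : inr A a = of A A (1 ⊗ₜ a) := rfl

theorem inl_mul_inr (a b : A) : inl A a * inr A b = of A A (a ⊗ₜ b) := by
  rw [inl_apply, inr_apply, of_tmul_mul, mul_one, one_mul]

theorem inr_mul_inl (a b : A) : inr A b * inl A a = of A A (a ⊗ₜ b) := by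
  rw [inl_apply, inr_apply, of_tmul_mul, mul_one, one_mul]

theorem apply_convRight_sub (hh : IsState h) (hω : IsState ω)
    (hr : ∀ a, h (G.convRight ω a) = h a) (hl : ∀ a, h (G.convLeft ω a) = h a) (q : A) :
    ω (star (G.convRight h q - h q • 1) * (G.convRight h q - h q • 1)) = 0 := by
  refine apply_star_sub_mul_sub_eq_zero G.comul (inl A) (inr A)
    (fun c d => by rw [inl_mul_inr, inr_mul_inl]) (tensorFunctional h ω)
    (tensorFunctional_nonneg hh hω) hh hω (G.convRight h) (leftSlice h) hr (fun c d => ?_)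
    (fun c d a => ?_) (fun x => ?_) (fun c a => ?_) (fun q => ?_) G.dense_left q
  · rw [inl_mul_inr, tensorFunctional_of hω]
  · rw [inl_mul_inr, inl_apply, tensorFunctional_mul_comul_convRight hh hω hh]
  · rw [convRight_apply, apply_rightSlice, ← apply_leftSlice hω hh]
    exact hl x
  · rw [apply_leftSlice hh hh, ← apply_rightSlice, inl_apply, convRight_apply]
    refine congrArg h (eq_of_tmul (f := fun t => rightSlice h (of A A (c ⊗ₜ 1) * t))
      (g := fun t => c * rightSlice h t) (by fun_prop) (by fun_prop)
      (fun s t => by simp only [map_add, mul_add]) (fun s t => by simp only [map_add, mul_add])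
      (fun x y => ?_) _)
    rw [of_tmul_mul, one_mul, rightSlice_of hh, rightSlice_of hh, mul_smul_comm]
  · rw [inr_apply, leftSlice_of hh, hh.map_one, one_smul]

theorem apply_convLeft_sub (hh : IsState h) (hω : IsState ω)
    (hr : ∀ a, h (G.convRight ω a) = h a) (hl : ∀ a, h (G.convLeft ω a) = h a) (q : A) :
    ω (star (G.convLeft h q - h q • 1) * (G.convLeft h q - h q • 1)) = 0 := by
  refine apply_star_sub_mul_sub_eq_zero G.comul (inr A) (inl A)
    (fun c d => by rw [inl_mul_inr, inr_mul_inl]) (tensorFunctional ω h)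
    (tensorFunctional_nonneg hω hh) hh hω (G.convLeft h) (rightSlice h) (fun x => ?_)
    (fun c d => ?_)
    (fun c d a => ?_) (fun x => ?_) (fun c a => ?_) (fun q => ?_) G.dense_right q
  · rw [← apply_leftSlice hω hh]
    exact hl x
  · rw [inr_mul_inl, tensorFunctional_of hh, mul_comm]
  · rw [inr_mul_inl, inr_apply, tensorFunctional_mul_comul_convLeft hh hω hh]
  · rw [convLeft_apply, apply_leftSlice hh hω, ← apply_rightSlice]
    exact hr x
  · rw [apply_rightSlice, ← apply_leftSlice hh hh, inr_apply, convLeft_apply]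
    refine congrArg h (eq_of_tmul (f := fun t => leftSlice h (of A A (1 ⊗ₜ c) * t))
      (g := fun t => c * leftSlice h t) (by fun_prop) (by fun_prop)
      (fun s t => by simp only [map_add, mul_add]) (fun s t => by simp only [map_add, mul_add])
      (fun x y => ?_) _)
    rw [of_tmul_mul, one_mul, leftSlice_of hh, leftSlice_of hh, mul_smul_comm]
  · rw [inl_apply, rightSlice_of hh, hh.map_one, one_smul]

/-- On a finite-dimensional subspace which contains `1` and is stable under convolutions, some state
is invariant on both sides: it is obtained from a state `ω` that is faithful on the subspace. -/
theorem exists_invariant_state [Nontrivial A] (G : CompactQuantumGroup A) (V : Submodule ℂ A)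
    [FiniteDimensional ℂ V] (hV1 : (1 : A) ∈ V)
    (hVr : ∀ ψ, IsState ψ → ∀ q ∈ V, G.convRight ψ q ∈ V)
    (hVl : ∀ ψ, IsState ψ → ∀ q ∈ V, G.convLeft ψ q ∈ V) :
    ∃ h : A →L[ℂ] ℂ, IsState h ∧
      (∀ q ∈ V, G.convRight h q = h q • 1) ∧ ∀ q ∈ V, G.convLeft h q = h q • 1 := by
  obtain ⟨ω, hω, hfaith⟩ := exists_isState_faithful V
  obtain ⟨h, hh, hr, hl⟩ := exists_isState_conv_invariant G hω
  refine ⟨h, hh, fun q hq => ?_, fun q hq => ?_⟩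
  · exact sub_eq_zero.1 (hfaith _ (V.sub_mem (hVr h hh q hq) (V.smul_mem _ hV1))
      (apply_convRight_sub hh hω hr hl q))
  · exact sub_eq_zero.1 (hfaith _ (V.sub_mem (hVl h hh q hq) (V.smul_mem _ hV1))
      (apply_convLeft_sub hh hω hr hl q))

end CompactQuantumGroup

/-! ### Complex matrices -/

namespace Matrix

variable {ι κ : Type} [Fintype ι] [Fintype κ] [DecidableEq ι]

/-- Diagonalization of a Hermitian matrix. -/
theorem IsHermitian.exists_diagonalization {S : Matrix ι ι ℂ} (hS : S.IsHermitian) :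
    ∃ U : Matrix ι ι ℂ, Uᴴ * U = 1 ∧ U * Uᴴ = 1 ∧
      S = U * diagonal (fun i => (hS.eigenvalues i : ℂ)) * Uᴴ :=
  ⟨hS.eigenvectorUnitary, Unitary.coe_star_mul_self hS.eigenvectorUnitary,
    Unitary.coe_mul_star_self hS.eigenvectorUnitary, hS.spectral_theorem⟩

theorem PosSemidef.exists_eq_conjTranspose_mul_self {S : Matrix ι ι ℂ} (hS : S.PosSemidef) :
    ∃ B : Matrix ι ι ℂ, S = Bᴴ * B := by
  obtain ⟨U, -, -, hU⟩ := hS.isHermitian.exists_diagonalization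
  refine ⟨diagonal (fun i => ((√(hS.isHermitian.eigenvalues i) : ℝ) : ℂ)) * Uᴴ, ?_⟩
  rw [conjTranspose_mul, conjTranspose_conjTranspose, diagonal_conjTranspose, Matrix.mul_assoc,
    ← Matrix.mul_assoc (diagonal _), diagonal_mul_diagonal, ← Matrix.mul_assoc]
  refine hU.trans ?_
  congr 3
  funext i
  simp only [Pi.star_apply, Complex.star_def, Complex.conj_ofReal]
  rw [← Complex.ofReal_mul, Real.mul_self_sqrt (hS.eigenvalues_nonneg i)]

/-- The orthogonal projection `P` onto the kernel of `T`; the projection `1 - P` factors through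
`T`. -/
theorem exists_kernel_projection (T : Matrix κ ι ℂ) :
    ∃ (P : Matrix ι ι ℂ) (C : Matrix ι κ ℂ), P * P = P ∧ Pᴴ = P ∧ T * P = 0 ∧ 1 - P = C * T := by
  have hS : (Tᴴ * T).IsHermitian := isHermitian_conjTranspose_mul_self T
  obtain ⟨U, hU1, hU2, hU⟩ := hS.exists_diagonalization
  set d := hS.eigenvalues
  set p : ι → ℂ := fun i => if d i = 0 then 1 else 0 with hp
  set c : ι → ℂ := fun i => ((d i : ℂ))⁻¹ with hc
  have hmul : ∀ x y : ι → ℂ, (U * diagonal x * Uᴴ) * (U * diagonal y * Uᴴ) =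
      U * diagonal (fun i => x i * y i) * Uᴴ := by
    intro x y
    rw [← diagonal_mul_diagonal]
    calc _ = U * diagonal x * (Uᴴ * U) * diagonal y * Uᴴ := by simp only [Matrix.mul_assoc]
      _ = _ := by rw [hU1, Matrix.mul_one]; simp only [Matrix.mul_assoc]
  have hone : (1 : Matrix ι ι ℂ) = U * diagonal (fun _ => 1) * Uᴴ := by
    rw [diagonal_one, Matrix.mul_one, hU2]
  have hSP : Tᴴ * T * (U * diagonal p * Uᴴ) = 0 := by
    rw [hU, hmul]
    have : (fun i => (d i : ℂ) * p i) = 0 := by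
      funext i
      by_cases h : d i = 0 <;> simp [hp, h]
    rw [this]
    simp
  have hPh : (U * diagonal p * Uᴴ)ᴴ = U * diagonal p * Uᴴ := by
    rw [conjTranspose_mul, conjTranspose_mul, conjTranspose_conjTranspose, diagonal_conjTranspose,
      ← Matrix.mul_assoc]
    congr 3
    funext i
    by_cases h : d i = 0 <;> simp [hp, h]
  refine ⟨U * diagonal p * Uᴴ, U * diagonal c * Uᴴ * Tᴴ, ?_, hPh, ?_, ?_⟩
  · rw [hmul]
    congr 3
    funext i
    by_cases h : d i = 0 <;> simp [hp, h]
  · refine conjTranspose_mul_self_eq_zero.1 ?_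
    rw [conjTranspose_mul, Matrix.mul_assoc, ← Matrix.mul_assoc Tᴴ, hSP, Matrix.mul_zero]
  · rw [Matrix.mul_assoc _ Tᴴ T, hU, hmul, hone, ← Matrix.sub_mul, ← Matrix.mul_sub, diagonal_sub]
    congr 3
    funext i
    by_cases h : d i = 0 <;> simp [hp, hc, h]

/-- An orthogonal projection is of the form `V V^*` with an isometry `V`. -/
theorem exists_isometry_of_projection {P : Matrix ι ι ℂ} (hP : P * P = P) (hPh : Pᴴ = P) :
    ∃ (r : ℕ) (V : Matrix ι (Fin r) ℂ), Vᴴ * V = 1 ∧ V * Vᴴ = P := by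
  let W : Submodule ℂ (EuclideanSpace ℂ ι) := LinearMap.range (toEuclideanLin P)
  let b := stdOrthonormalBasis ℂ W
  let V : Matrix ι (Fin (Module.finrank ℂ W)) ℂ := of fun i k => (b k : EuclideanSpace ℂ ι) i
  have hV : Vᴴ * V = 1 := by
    ext k l
    have := orthonormal_iff_ite.1 b.orthonormal k l
    rw [Submodule.coe_inner, EuclideanSpace.inner_eq_star_dotProduct] at this
    rw [Matrix.one_apply, ← this]
    simp only [mul_apply, dotProduct, conjTranspose_apply, V, of_apply, Pi.star_apply]
    exact Finset.sum_congr rfl fun i _ => mul_comm _ _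
  have hPV : P * V = V := by
    ext i k
    obtain ⟨x, hx⟩ := LinearMap.mem_range.1 (b k).2
    have h2 : toEuclideanLin P (b k : EuclideanSpace ℂ ι) = b k := by
      rw [← hx]
      ext j
      simp only [toLpLin_apply, mulVec_mulVec, hP]
    have h3 := congrFun (congrArg WithLp.ofLp h2) i
    simpa [toLpLin_apply, mulVec, dotProduct, mul_apply, V] using h3
  have hVP : V * Vᴴ * P = P := by
    ext i j
    let x : W := ⟨toEuclideanLin P (EuclideanSpace.single j 1), LinearMap.mem_range_self _ _⟩
    have hx : ∀ i, (x : EuclideanSpace ℂ ι) i = P i j := fun i => by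
      simp [x, toLpLin_apply]
    have h4 := congrFun (congrArg WithLp.ofLp (congrArg Subtype.val (b.sum_repr x))) i
    rw [hx] at h4
    rw [← h4, Matrix.mul_assoc, mul_apply]
    simp only [Submodule.coe_sum, Submodule.coe_smul, WithLp.ofLp_sum, WithLp.ofLp_smul,
      Finset.sum_apply, Pi.smul_apply, smul_eq_mul]
    refine Finset.sum_congr rfl fun k _ => ?_
    rw [b.repr_apply_apply, Submodule.coe_inner, EuclideanSpace.inner_eq_star_dotProduct, mul_comm]
    simp only [mul_apply, dotProduct, conjTranspose_apply, V, of_apply, Pi.star_apply]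
    congr 1
    exact Finset.sum_congr rfl fun i _ => by rw [hx, mul_comm]
  refine ⟨_, V, hV, ?_⟩
  have h5 := congrArg conjTranspose hVP
  rw [conjTranspose_mul, conjTranspose_mul, conjTranspose_conjTranspose, hPh, ← Matrix.mul_assoc,
    hPV] at h5
  exact h5

end Matrix

/-! ### Matrices over a C*-algebra -/

namespace CompactQuantumGroup

open MinTensor Matrix

variable {A : Type u} [CStarAlgebra A]
variable {ι κ μ ν : Type} [Fintype ι] [Fintype κ] [Fintype μ] [Fintype ν]

theorem scalar_sub (S T : Matrix ι κ ℂ) : scalar A (S - T) = scalar A S - scalar A T :=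
  Matrix.map_sub _ (fun a b => map_sub _ a b) _ _

theorem scalar_zero : scalar A (0 : Matrix ι κ ℂ) = 0 := Matrix.map_zero _ (map_zero _)

theorem conjTranspose_scalar (T : Matrix ι κ ℂ) : (scalar A T)ᴴ = scalar A Tᴴ := by
  ext i j
  exact (algebraMap_star_comm (T j i)).symm

theorem scalar_mul_apply (S : Matrix μ ι ℂ) (Y : Matrix ι κ A) (i : μ) (j : κ) :
    (scalar A S * Y) i j = ∑ k, S i k • Y k j := by
  simp [Matrix.mul_apply, scalar, Algebra.smul_def]

theorem mul_scalar_apply (Y : Matrix ι κ A) (T : Matrix κ μ ℂ) (i : ι) (j : μ) :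
    (Y * scalar A T) i j = ∑ k, T k j • Y i k := by
  simp [Matrix.mul_apply, scalar, Algebra.smul_def, Algebra.commutes]

theorem map_star_scalar_mul (S : Matrix μ ι ℂ) (Y : Matrix ι κ A) :
    (scalar A S * Y).map star = scalar A (S.map star) * Y.map star := by
  ext i j
  simp [scalar_mul_apply]

theorem map_star_mul_scalar (Y : Matrix ι κ A) (T : Matrix κ μ ℂ) :
    (Y * scalar A T).map star = Y.map star * scalar A (T.map star) := by
  ext i j
  simp [mul_scalar_apply]

theorem transpose_mul_scalar (Y : Matrix ι κ A) (T : Matrix κ μ ℂ) :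
    (Y * scalar A T)ᵀ = scalar A Tᵀ * Yᵀ := by
  ext i j
  simp [scalar_mul_apply, mul_scalar_apply]

theorem conjTranspose_scalar_mul (S : Matrix μ ι ℂ) (Y : Matrix ι κ A) :
    (scalar A S * Y)ᴴ = Yᴴ * scalar A Sᴴ := by
  rw [conjTranspose_mul, conjTranspose_scalar]

theorem conjTranspose_mul_scalar (Y : Matrix ι κ A) (T : Matrix κ μ ℂ) :
    (Y * scalar A T)ᴴ = scalar A Tᴴ * Yᴴ := by
  rw [conjTranspose_mul, conjTranspose_scalar]

theorem map_mul_scalar (h : A →L[ℂ] ℂ) (Y : Matrix ι κ A) (T : Matrix κ μ ℂ) :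
    (Y * scalar A T).map h = Y.map h * T := by
  ext i j
  rw [map_apply, mul_scalar_apply, Matrix.mul_apply]
  simp [mul_comm]

theorem map_scalar {h : A →L[ℂ] ℂ} (hh : IsState h) (T : Matrix ι κ ℂ) :
    (scalar A T).map h = T := by
  ext i j
  simp [scalar, Algebra.algebraMap_eq_smul_one, hh.map_one]

theorem conjTranspose_mul_self_eq_zero {Y : Matrix ι κ A} (h : Yᴴ * Y = 0) : Y = 0 := by
  let _ := CStarAlgebra.spectralOrder A
  have _ := CStarAlgebra.spectralOrderedRing A
  ext i j
  have h1 := congrFun (congrFun h j) j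
  simp only [Matrix.mul_apply, conjTranspose_apply, Matrix.zero_apply] at h1
  have h2 := (Finset.sum_eq_zero_iff_of_nonneg fun k _ => star_mul_self_nonneg (Y k j)).1 h1 i
    (Finset.mem_univ i)
  exact (CStarRing.star_mul_self_eq_zero_iff _).1 h2

theorem posSemidef_map {h : A →L[ℂ] ℂ} (hh : IsState h) (Y : Matrix ι κ A) :
    ((Yᴴ * Y).map h).PosSemidef := by
  have hstar : ∀ x, h (star x) = conj (h x) :=
    PositiveFunctional.apply_star (τ := h.toLinearMap) hh.nonneg
  refine PosSemidef.of_dotProduct_mulVec_nonneg ?_ fun x => ?_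
  · ext i j
    rw [conjTranspose_apply, map_apply, map_apply, ← starRingEnd_apply, ← hstar,
      ← conjTranspose_apply, conjTranspose_mul, conjTranspose_conjTranspose]
  · have key : star x ⬝ᵥ ((Yᴴ * Y).map h *ᵥ x) =
        ∑ k, h (star (∑ j, x j • Y k j) * ∑ j, x j • Y k j) := by
      have e1 : ∀ k, h (star (∑ j, x j • Y k j) * ∑ j, x j • Y k j) =
          ∑ i, ∑ j, star (x i) * (h (star (Y k i) * Y k j) * x j) := fun k => by
        simp only [star_sum, star_smul, Finset.sum_mul_sum, smul_mul_assoc, mul_smul_comm, map_sum,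
          map_smul, smul_eq_mul]
        exact Finset.sum_congr rfl fun i _ => Finset.sum_congr rfl fun j _ => by ring
      rw [Finset.sum_congr rfl fun k _ => e1 k]
      simp only [dotProduct, mulVec, Matrix.mul_apply, map_apply, conjTranspose_apply, map_sum,
        Finset.mul_sum, Finset.sum_mul, Pi.star_apply]
      rw [Finset.sum_comm (s := Finset.univ (α := ι))]
      refine Finset.sum_congr rfl fun i _ => ?_
      rw [Finset.sum_comm]
    rw [key]
    exact Finset.sum_nonneg fun k _ => hh.nonneg _

/-- A positive semidefinite average that vanishes on the diagonal forces the right ideal generated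
by the entries of `Y` into the kernel of the state. -/
theorem apply_mul_eq_zero_of_map_eq_zero {h : A →L[ℂ] ℂ} (hh : IsState h) {Y : Matrix ι κ A}
    (hY : (Y * Yᴴ).map h = 0) (i : ι) (j : κ) (z : A) : h (Y i j * z) = 0 := by
  have h1 := congrFun (congrFun hY i) i
  simp only [map_apply, Matrix.mul_apply, conjTranspose_apply, Matrix.zero_apply, map_sum] at h1
  have h2 := (Finset.sum_eq_zero_iff_of_nonneg fun k _ => by
    simpa using hh.nonneg (star (Y i k))).1 h1 j (Finset.mem_univ j)
  exact PositiveFunctional.apply_mul_eq_zero_of_mul_star (τ := h.toLinearMap) hh.nonneg h2 z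

/-! ### Irreducibility -/

/-- If the kernel of `T` is invariant under the irreducible `w`, then `T` is zero or injective. -/
theorem IsIrreducible.eq_zero_or_leftInverse [DecidableEq ι] {w : Matrix ι ι A}
    (hw : IsIrreducible w) (T : Matrix κ ι ℂ)
    (hT : ∀ Z : Matrix ι ι ℂ, T * Z = 0 → scalar A T * w * scalar A Z = 0) :
    T = 0 ∨ ∃ C : Matrix ι κ ℂ, C * T = 1 := by
  classical
  obtain ⟨P, C, hP, hPh, hTP, hC⟩ := exists_kernel_projection T
  have h1 : scalar A (1 - P) * w * scalar A P = 0 := by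
    rw [hC, scalar_mul, Matrix.mul_assoc (scalar A C), Matrix.mul_assoc (scalar A C), hT P hTP,
      Matrix.mul_zero]
  rw [scalar_sub, scalar_one, Matrix.sub_mul, Matrix.one_mul, Matrix.sub_mul, sub_eq_zero] at h1
  rcases hw.2 P hP hPh h1.symm with h0 | h0
  · exact Or.inr ⟨C, by rw [← hC, h0, sub_zero]⟩
  · exact Or.inl (by rw [h0, Matrix.mul_one] at hTP; exact hTP)

/-- Schur's lemma. -/
theorem IsIrreducible.exists_leftInverse [DecidableEq ι] {w : Matrix ι ι A} {Y : Matrix κ κ A}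
    (hw : IsIrreducible w) {T : Matrix κ ι ℂ} (hT : Intertwines w Y T) (h0 : T ≠ 0) :
    ∃ C : Matrix ι κ ℂ, C * T = 1 := by
  refine (hw.eq_zero_or_leftInverse T fun Z hZ => ?_).resolve_left h0
  have hT' : scalar A T * w = Y * scalar A T := hT
  rw [hT', Matrix.mul_assoc, ← scalar_mul, hZ, scalar_zero, Matrix.mul_zero]

theorem IsIrreducible.conjRep [DecidableEq ι] {w : Matrix ι ι A} (hw : IsIrreducible w) :
    IsIrreducible (conjRep w) := by
  refine ⟨hw.1, fun P hP hPh h => ?_⟩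
  have hmap : ∀ S T : Matrix ι ι ℂ, (S * T).map star = S.map star * T.map star := fun S T => by
    ext i j; simp [Matrix.mul_apply]
  have hinv : ∀ S : Matrix ι ι ℂ, (S.map star).map star = S := fun S => by ext i j; simp
  have h' := congrArg (fun Y => Y.map star) h
  simp only [CompactQuantumGroup.conjRep, map_star_mul_scalar, map_star_scalar_mul] at h'
  have hw' : (w.map star).map star = w := by ext i j; simp
  rw [hw'] at h'
  have key := hw.2 (P.map star) (by rw [← hmap, hP])
    (by conv_rhs => rw [← hPh]
        rfl) h'
  refine key.imp (fun h0 => ?_) fun h0 => ?_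
  · rw [← hinv P, h0]; ext i j; simp
  · rw [← hinv P, h0]
    ext i j
    by_cases hij : i = j <;> simp [Matrix.one_apply, hij]

/-- Irreducibility is invariant under similarity. -/
theorem IsIrreducible.of_similar [DecidableEq ι] {w y : Matrix ι ι A} (hw : IsIrreducible w)
    {B C : Matrix ι ι ℂ} (hBC : B * C = 1)
    (h : scalar A B * w = y * scalar A B) : IsIrreducible y := by
  refine ⟨hw.1, fun P hP hPh hy => ?_⟩
  have h1 : scalar A (1 - P) * y * scalar A P = 0 := by
    rw [scalar_sub, scalar_one, Matrix.sub_mul, Matrix.one_mul, Matrix.sub_mul, hy, sub_self]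
  have hinv : ∀ Z : Matrix ι ι ℂ, (1 - P) * B * Z = 0 →
      scalar A ((1 - P) * B) * w * scalar A Z = 0 := by
    intro Z hZ
    have hZ' : B * Z = P * (B * Z) := by
      rw [Matrix.mul_assoc, Matrix.sub_mul, Matrix.one_mul, sub_eq_zero] at hZ
      exact hZ
    rw [scalar_mul, Matrix.mul_assoc (scalar A (1 - P)), h, Matrix.mul_assoc, Matrix.mul_assoc y,
      ← scalar_mul, hZ', scalar_mul, ← Matrix.mul_assoc, ← Matrix.mul_assoc, h1, Matrix.zero_mul]
  rcases hw.eq_zero_or_leftInverse ((1 - P) * B) hinv with h0 | ⟨D, hD⟩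
  · right
    have : (1 - P) * (B * C) = 0 := by rw [← Matrix.mul_assoc, h0, Matrix.zero_mul]
    rw [hBC, Matrix.mul_one, sub_eq_zero] at this
    exact this.symm
  · left
    have h2 : D * ((1 - P) * B) * (C * P) = 0 := by
      rw [Matrix.mul_assoc, Matrix.mul_assoc (1 - P), ← Matrix.mul_assoc B, hBC, Matrix.one_mul,
        Matrix.sub_mul, hP, Matrix.one_mul, sub_self, Matrix.mul_zero]
    rw [hD, Matrix.one_mul] at h2
    have : B * (C * P) = 0 := by rw [h2, Matrix.mul_zero]
    rwa [← Matrix.mul_assoc, hBC, Matrix.one_mul] at this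

end CompactQuantumGroup

/-! ### Finite-dimensional corepresentations -/

namespace CompactQuantumGroup

open MinTensor Matrix

variable {A : Type u} [CStarAlgebra A] {G : CompactQuantumGroup A}
variable {ι κ μ ν : Type} [Fintype ι] [Fintype κ] [Fintype μ] [Fintype ν]

theorem kroneckerMap_mul_mul {R : Type v} [NonUnitalSemiring R] {a b c d e f : Type}
    [Fintype b] [Fintype e]
    (x : Matrix a b R) (x' : Matrix b c R) (y : Matrix d e R) (y' : Matrix e f R)
    (h : ∀ i j k l, x' i j * y k l = y k l * x' i j) :
    kroneckerMap (fun s t => s * t) x y * kroneckerMap (fun s t => s * t) x' y' =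
      kroneckerMap (fun s t => s * t) (x * x') (y * y') := by
  ext ⟨i, k⟩ ⟨j, l⟩
  simp only [Matrix.mul_apply, kroneckerMap_apply, Fintype.sum_prod_type, Finset.sum_mul_sum]
  refine Finset.sum_congr rfl fun p _ => Finset.sum_congr rfl fun q _ => ?_
  rw [mul_assoc, ← mul_assoc (y k q), ← h, mul_assoc, mul_assoc]

theorem kroneckerMap_scalar (S : Matrix ι κ ℂ) (T : Matrix μ ν ℂ) :
    kroneckerMap (fun s t => s * t) (scalar A S) (scalar A T) =
      scalar A (kroneckerMap (fun s t => s * t) S T) := by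
  ext ⟨i, k⟩ ⟨j, l⟩
  simp [scalar]

variable (G) in
/-- The matrix `y` over `A` satisfies `Φ(y_{ij}) = ∑_k y_{ik} ⊗ y_{kj}`; it need not be unitary. -/
def IsCorep (y : Matrix ι ι A) : Prop := y.map G.comul = y.map (inl A) * y.map (inr A)

theorem isCorep_iff {y : Matrix ι ι A} :
    G.IsCorep y ↔ ∀ i j, G.comul (y i j) = ∑ k, of A A (y i k ⊗ₜ y k j) := by
  have h : ∀ i j, (y.map (inl A) * y.map (inr A)) i j = ∑ k, of A A (y i k ⊗ₜ y k j) :=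
    fun i j => by simp only [Matrix.mul_apply, map_apply, inl_mul_inr]
  constructor
  · intro hy i j
    rw [← h, ← map_apply (f := G.comul), hy]
  · intro hy
    ext1 i j
    rw [h, map_apply, hy]

theorem isRep_iff [DecidableEq ι] {y : Matrix ι ι A} :
    G.IsRep y ↔ y ∈ unitary (Matrix ι ι A) ∧ G.IsCorep y := by
  rw [isCorep_iff]; rfl

theorem map_algHom_scalar (F : A →⋆ₐ[ℂ] MinTensor A A) (T : Matrix ι κ ℂ) :
    (scalar A T).map F = scalar (MinTensor A A) T := by
  ext1 i j
  exact AlgHomClass.commutes F (T i j)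

theorem map_algHom_mul (F : A →⋆ₐ[ℂ] MinTensor A A) (X : Matrix ι κ A) (Y : Matrix κ μ A) :
    (X * Y).map F = X.map F * Y.map F := Matrix.map_mul

theorem IsCorep.conjRep {y : Matrix ι ι A} (hy : G.IsCorep y) : G.IsCorep (conjRep y) := by
  rw [isCorep_iff] at hy ⊢
  intro i j
  simp only [CompactQuantumGroup.conjRep, map_apply, map_star, hy, star_sum, star_of_tmul]

theorem IsCorep.tensorRep {x : Matrix ι ι A} {y : Matrix κ κ A} (hx : G.IsCorep x)
    (hy : G.IsCorep y) : G.IsCorep (tensorRep x y) := by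
  have hmap : ∀ F : A →⋆ₐ[ℂ] MinTensor A A,
      (CompactQuantumGroup.tensorRep x y).map F =
        kroneckerMap (fun s t => s * t) (x.map F) (y.map F) := fun F => by
    ext1 ⟨i, k⟩ ⟨j, l⟩
    exact map_mul F _ _
  rw [IsCorep, hmap, hmap, hmap, kroneckerMap_mul_mul, hx, hy]
  intro i j k l
  rw [map_apply, map_apply, inr_mul_inl, inl_mul_inr]

/-- A corepresentation compressed along an intertwiner with a left inverse. -/
theorem IsCorep.of_intertwines {y : Matrix ι ι A} {w : Matrix κ κ A} (hy : G.IsCorep y)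
    [DecidableEq κ] {T : Matrix ι κ ℂ} {S : Matrix κ ι ℂ} (hST : S * T = 1)
    (h : Intertwines w y T) : G.IsCorep w := by
  have h' : scalar A T * w = y * scalar A T := h
  have hF : ∀ F : A →⋆ₐ[ℂ] MinTensor A A,
      scalar (MinTensor A A) T * w.map F = y.map F * scalar (MinTensor A A) T := fun F => by
    rw [← map_algHom_scalar F, ← map_algHom_mul, ← map_algHom_mul, h']
  have key : scalar (MinTensor A A) T * w.map G.comul =
      scalar (MinTensor A A) T * (w.map (inl A) * w.map (inr A)) := by
    rw [hF, hy, ← Matrix.mul_assoc, hF, Matrix.mul_assoc, Matrix.mul_assoc, hF]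
  have h1 : scalar (MinTensor A A) S * scalar (MinTensor A A) T = 1 := by
    rw [← scalar_mul, hST, scalar_one]
  have := congrArg (fun X => scalar (MinTensor A A) S * X) key
  simp only [← Matrix.mul_assoc, h1, Matrix.one_mul] at this
  exact this

theorem IsCorep.convRight_apply {y : Matrix ι ι A} (hy : G.IsCorep y) {ψ : A →L[ℂ] ℂ}
    (hψ : IsState ψ) (i j : ι) : G.convRight ψ (y i j) = ∑ k, ψ (y k j) • y i k := by
  rw [CompactQuantumGroup.convRight_apply, isCorep_iff.1 hy, map_sum]
  exact Finset.sum_congr rfl fun k _ => rightSlice_of hψ _ _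

theorem IsCorep.convLeft_apply {y : Matrix ι ι A} (hy : G.IsCorep y) {φ : A →L[ℂ] ℂ}
    (hφ : IsState φ) (i j : ι) : G.convLeft φ (y i j) = ∑ k, φ (y i k) • y k j := by
  rw [CompactQuantumGroup.convLeft_apply, isCorep_iff.1 hy, map_sum]
  exact Finset.sum_congr rfl fun k _ => leftSlice_of hφ _ _

/-- A state which is invariant on the matrix coefficients of a corepresentation. -/
theorem IsCorep.exists_invariant_state [Nontrivial A] {y : Matrix ι ι A} (hy : G.IsCorep y) :
    ∃ h : A →L[ℂ] ℂ, IsState h ∧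
      (∀ i j, ∑ k, h (y k j) • y i k = h (y i j) • (1 : A)) ∧
      ∀ i j, ∑ k, h (y i k) • y k j = h (y i j) • (1 : A) := by
  let s : Set A := insert 1 (Set.range fun p : ι × ι => y p.1 p.2)
  have hs : s.Finite := (Set.finite_range _).insert 1
  let V : Submodule ℂ A := Submodule.span ℂ s
  have : FiniteDimensional ℂ V := FiniteDimensional.span_of_finite ℂ hs
  have h1 : (1 : A) ∈ V := Submodule.subset_span (Set.mem_insert _ _)
  have hmem : ∀ i j, y i j ∈ V := fun i j =>
    Submodule.subset_span (Set.mem_insert_of_mem _ ⟨(i, j), rfl⟩)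
  have hstable : ∀ F : A →L[ℂ] A, F 1 = 1 → (∀ i j, F (y i j) ∈ V) → ∀ q ∈ V, F q ∈ V := by
    intro F hF1 hF q hq
    have hle : V ≤ V.comap F.toLinearMap := by
      refine Submodule.span_le.2 ?_
      rintro x (rfl | ⟨p, rfl⟩)
      · change F 1 ∈ V
        rw [hF1]; exact h1
      · exact hF p.1 p.2
    exact hle hq
  have hleft1 : ∀ φ : A →L[ℂ] ℂ, IsState φ → G.convLeft φ 1 = 1 := fun φ hφ => by
    rw [CompactQuantumGroup.convLeft_apply, map_one, ← map_one (of A A),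
      Algebra.TensorProduct.one_def, leftSlice_of hφ, hφ.map_one, one_smul]
  obtain ⟨h, hh, hr, hl⟩ := G.exists_invariant_state V h1
    (fun ψ hψ => hstable _ (convRight_one hψ) fun i j => by
      rw [hy.convRight_apply hψ]
      exact V.sum_mem fun k _ => V.smul_mem _ (hmem _ _))
    (fun φ hφ => hstable _ (hleft1 φ hφ) fun i j => by
      rw [hy.convLeft_apply hφ]
      exact V.sum_mem fun k _ => V.smul_mem _ (hmem _ _))
  refine ⟨h, hh, fun i j => ?_, fun i j => ?_⟩
  · rw [← hy.convRight_apply hh, hr _ (hmem i j)]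
  · rw [← hy.convLeft_apply hh, hl _ (hmem i j)]

theorem transpose_mul_scalar_mul_map_star_apply (y : Matrix κ ι A) (E : Matrix κ κ ℂ) (i k : ι) :
    (yᵀ * scalar A E * y.map star) i k = ∑ p, ∑ q, E p q • (y p i * star (y q k)) := by
  rw [Matrix.mul_apply, Finset.sum_comm]
  refine Finset.sum_congr rfl fun q _ => ?_
  rw [mul_scalar_apply, Finset.sum_mul]
  exact Finset.sum_congr rfl fun p _ => by rw [smul_mul_assoc, transpose_apply, map_apply]

/-- Averages of `y P y^*` and of `y^T \bar y` with respect to an invariant state on the coefficients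
of `y ⊗ \bar y` are invariant. -/
theorem IsCorep.exists_average [Nontrivial A] {y : Matrix ι ι A} (hy : G.IsCorep y) :
    ∃ h : A →L[ℂ] ℂ, IsState h ∧
      (∀ P : Matrix ι ι ℂ, y * scalar A ((y * scalar A P * yᴴ).map h) * yᴴ =
        scalar A ((y * scalar A P * yᴴ).map h)) ∧
      yᵀ * scalar A ((yᵀ * CompactQuantumGroup.conjRep y).map h) * CompactQuantumGroup.conjRep y =
        scalar A ((yᵀ * CompactQuantumGroup.conjRep y).map h) := by
  obtain ⟨h, hh, hr, hl⟩ := (hy.tensorRep hy.conjRep).exists_invariant_state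
  have hr' : ∀ i k j l, ∑ p, ∑ q, h (y p j * star (y q l)) • (y i p * star (y k q)) =
      h (y i j * star (y k l)) • (1 : A) := fun i k j l => by
    have := hr (i, k) (j, l)
    rwa [Fintype.sum_prod_type] at this
  have hl' : ∀ i k j l, ∑ p, ∑ q, h (y i p * star (y k q)) • (y p j * star (y q l)) =
      h (y i j * star (y k l)) • (1 : A) := fun i k j l => by
    have := hl (i, k) (j, l)
    rwa [Fintype.sum_prod_type] at this
  refine ⟨h, hh, fun P => ?_, ?_⟩
  · have hH : ∀ i k, (y * scalar A P * yᴴ).map h i k =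
        ∑ j, ∑ l, P j l * h (y i j * star (y k l)) := fun i k => by
      rw [map_apply, Matrix.mul_apply, map_sum, Finset.sum_comm]
      refine Finset.sum_congr rfl fun l _ => ?_
      rw [mul_scalar_apply, Finset.sum_mul, map_sum]
      exact Finset.sum_congr rfl fun j _ => by
        rw [smul_mul_assoc, map_smul, smul_eq_mul, conjTranspose_apply]
    ext i k
    have e1 : (y * scalar A ((y * scalar A P * yᴴ).map h) * yᴴ) i k =
        ∑ p, ∑ q, (y * scalar A P * yᴴ).map h p q • (y i p * star (y k q)) := by
      rw [Matrix.mul_apply, Finset.sum_comm]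
      refine Finset.sum_congr rfl fun q _ => ?_
      rw [mul_scalar_apply, Finset.sum_mul]
      exact Finset.sum_congr rfl fun p _ => by rw [smul_mul_assoc, conjTranspose_apply]
    have e2 : scalar A ((y * scalar A P * yᴴ).map h) i k =
        (y * scalar A P * yᴴ).map h i k • (1 : A) := Algebra.algebraMap_eq_smul_one _
    rw [e1, e2, hH]
    simp only [hH, Finset.sum_smul, mul_smul, ← hr', Finset.smul_sum]
    calc _ = ∑ p, ∑ j, ∑ q, ∑ l, P j l • h (y p j * star (y q l)) • (y i p * star (y k q)) :=
          Finset.sum_congr rfl fun p _ => Finset.sum_comm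
      _ = ∑ j, ∑ p, ∑ q, ∑ l, P j l • h (y p j * star (y q l)) • (y i p * star (y k q)) :=
          Finset.sum_comm
      _ = ∑ j, ∑ p, ∑ l, ∑ q, P j l • h (y p j * star (y q l)) • (y i p * star (y k q)) :=
          Finset.sum_congr rfl fun j _ => Finset.sum_congr rfl fun p _ => Finset.sum_comm
      _ = _ := Finset.sum_congr rfl fun j _ => Finset.sum_comm
  · have hE : ∀ p q, (yᵀ * CompactQuantumGroup.conjRep y).map h p q =
        ∑ r, h (y r p * star (y r q)) := fun p q => by
      rw [map_apply, Matrix.mul_apply, map_sum]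
      rfl
    ext i k
    have e2 : scalar A ((yᵀ * CompactQuantumGroup.conjRep y).map h) i k =
        (yᵀ * CompactQuantumGroup.conjRep y).map h i k • (1 : A) :=
      Algebra.algebraMap_eq_smul_one _
    rw [CompactQuantumGroup.conjRep, transpose_mul_scalar_mul_map_star_apply,
      ← CompactQuantumGroup.conjRep, e2, hE]
    simp only [hE, Finset.sum_smul, ← hl']
    calc _ = ∑ p, ∑ r, ∑ q, h (y r p * star (y r q)) • (y p i * star (y q k)) :=
          Finset.sum_congr rfl fun p _ => Finset.sum_comm
      _ = _ := Finset.sum_comm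

end CompactQuantumGroup

/-! ### Complete reducibility -/

namespace CompactQuantumGroup

open MinTensor Matrix

variable {A : Type u} [CStarAlgebra A] {G : CompactQuantumGroup A}
variable {ι κ μ ν : Type} [Fintype ι] [Fintype κ] [Fintype μ] [Fintype ν]

theorem conjTranspose_conjRep (y : Matrix ι ι A) : (conjRep y)ᴴ = yᵀ := by
  ext i j; simp [conjRep]

theorem conjTranspose_mul_of_mem_unitary [DecidableEq ι] {y : Matrix ι ι A}
    (hy : y ∈ unitary (Matrix ι ι A)) : yᴴ * y = 1 := (Unitary.mem_iff.1 hy).1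

theorem mul_conjTranspose_of_mem_unitary [DecidableEq ι] {y : Matrix ι ι A}
    (hy : y ∈ unitary (Matrix ι ι A)) : y * yᴴ = 1 := (Unitary.mem_iff.1 hy).2

/-- The conjugate of `v` becomes isometric after a change of the inner product, given by an
invertible matrix `E = B^* B`. Irreducible unitary representations have this property, and it is
inherited by tensor products and subrepresentations. -/
def IsBalanced [DecidableEq ι] (v : Matrix ι ι A) : Prop :=
  ∃ (κ : Type) (_ : Fintype κ) (B : Matrix κ ι ℂ) (C : Matrix ι κ ℂ), C * B = 1 ∧
    vᵀ * scalar A (Bᴴ * B) * conjRep v = scalar A (Bᴴ * B)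

theorem map_ne_zero_of_trace_eq [DecidableEq ι] [Nonempty ι] {h : A →L[ℂ] ℂ} (hh : IsState h)
    {y : Matrix ι ι A} (hy : ∑ i, y i i = ∑ i, (1 : Matrix ι ι A) i i) : y.map h ≠ 0 := by
  intro h0
  have h1 : h (∑ i, y i i) = 0 := by
    rw [map_sum]
    exact Finset.sum_eq_zero fun i _ => congrFun (congrFun h0 i) i
  rw [hy] at h1
  have h2 : ∑ i, (1 : Matrix ι ι A) i i = (Fintype.card ι : ℂ) • (1 : A) := by
    simp [Nat.cast_smul_eq_nsmul]
  rw [h2, map_smul, hh.map_one, smul_eq_mul, mul_one, Nat.cast_eq_zero] at h1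
  exact Fintype.card_ne_zero h1

/-- The average of `y^T \bar y` is positive and invariant, and by irreducibility of `\bar y` its
kernel is trivial, since its trace is not zero. -/
theorem exists_square_balance [Nontrivial A] [DecidableEq ι] {y : Matrix ι ι A} (hy : G.IsRep y)
    (hirr : IsIrreducible y) : ∃ B C : Matrix ι ι ℂ, C * B = 1 ∧
      yᵀ * scalar A (Bᴴ * B) * conjRep y = scalar A (Bᴴ * B) := by
  obtain ⟨hU, hc⟩ := isRep_iff.1 hy
  obtain ⟨h, hh, -, hE⟩ := hc.exists_average
  have hpos := posSemidef_map hh (conjRep y)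
  rw [conjTranspose_conjRep] at hpos
  obtain ⟨B, hB⟩ := hpos.exists_eq_conjTranspose_mul_self
  rw [hB] at hE
  rcases hirr.conjRep.eq_zero_or_leftInverse B fun Z hZ => by
    refine conjTranspose_mul_self_eq_zero ?_
    rw [conjTranspose_mul_scalar, conjTranspose_scalar_mul, conjTranspose_conjRep]
    calc scalar A Zᴴ * (yᵀ * scalar A Bᴴ) * (scalar A B * conjRep y * scalar A Z) =
          scalar A Zᴴ * (yᵀ * scalar A (Bᴴ * B) * conjRep y) * scalar A Z := by
          simp only [scalar_mul, Matrix.mul_assoc]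
      _ = scalar A (Zᴴ * Bᴴ) * scalar A (B * Z) := by
          rw [hE]; simp only [scalar_mul, Matrix.mul_assoc]
      _ = 0 := by rw [hZ, scalar_zero, Matrix.mul_zero] with h0 | ⟨C, hC⟩
  · exfalso
    have := hirr.1
    rw [h0, Matrix.mul_zero] at hB
    refine map_ne_zero_of_trace_eq hh ?_ hB
    rw [← mul_conjTranspose_of_mem_unitary hU]
    simp only [Matrix.mul_apply, transpose_apply, conjTranspose_apply, conjRep, map_apply]
    exact Finset.sum_comm
  · exact ⟨B, C, hC, hE⟩

theorem IsIrreducible.isBalanced [Nontrivial A] [DecidableEq ι] {y : Matrix ι ι A}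
    (hirr : IsIrreducible y) (hy : G.IsRep y) : IsBalanced y := by
  obtain ⟨B, C, h1, h2⟩ := exists_square_balance hy hirr
  exact ⟨ι, inferInstance, B, C, h1, h2⟩

/-- The conjugate of an irreducible unitary representation has a right inverse, because the average
of `\bar y \bar y^*` is invertible. -/
theorem exists_conjRep_mul_eq_one [Nontrivial A] [DecidableEq ι] {y : Matrix ι ι A}
    (hy : G.IsRep y) (hirr : IsIrreducible y) : ∃ R, conjRep y * R = 1 := by
  obtain ⟨hU, hc⟩ := isRep_iff.1 hy
  obtain ⟨h, hh, hF, -⟩ := hc.conjRep.exists_average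
  set x := conjRep y with hx
  have hF := hF 1
  rw [scalar_one, Matrix.mul_one] at hF
  have hpos := posSemidef_map hh xᴴ
  rw [conjTranspose_conjTranspose] at hpos
  obtain ⟨D, hD⟩ := hpos.exists_eq_conjTranspose_mul_self
  rw [hD] at hF
  obtain ⟨P, C, hP, hPh, hDP, hC⟩ := exists_kernel_projection D
  -- The range of `1 - P`, which is the range of the invariant average, is invariant under `x`.
  have h1 : scalar A D * xᴴ * scalar A P = 0 := by
    refine conjTranspose_mul_self_eq_zero ?_
    rw [conjTranspose_mul_scalar, conjTranspose_scalar_mul, conjTranspose_conjTranspose]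
    calc scalar A Pᴴ * (x * scalar A Dᴴ) * (scalar A D * xᴴ * scalar A P) =
          scalar A Pᴴ * (x * scalar A (Dᴴ * D) * xᴴ) * scalar A P := by
          simp only [scalar_mul, Matrix.mul_assoc]
      _ = scalar A (Pᴴ * Dᴴ) * scalar A (D * P) := by
          rw [hF]; simp only [scalar_mul, Matrix.mul_assoc]
      _ = 0 := by rw [hDP, scalar_zero, Matrix.mul_zero]
  have h2 : scalar A (1 - P) * xᴴ * scalar A P = 0 := by
    rw [hC, scalar_mul, Matrix.mul_assoc (scalar A C), Matrix.mul_assoc (scalar A C), h1,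
      Matrix.mul_zero]
  have hQh : (1 - P)ᴴ = 1 - P := by rw [conjTranspose_sub, conjTranspose_one, hPh]
  have h3 : scalar A P * x * scalar A (1 - P) = 0 := by
    have := congrArg conjTranspose h2
    rwa [conjTranspose_mul_scalar, conjTranspose_scalar_mul, conjTranspose_conjTranspose, hPh, hQh,
      conjTranspose_zero, ← Matrix.mul_assoc] at this
  have hQQ : (1 - P) * (1 - P) = 1 - P := by
    rw [Matrix.mul_sub, Matrix.mul_one, Matrix.sub_mul, Matrix.one_mul, hP, sub_self, sub_zero]
  have h4 : scalar A (1 - P) * x * scalar A (1 - P) = x * scalar A (1 - P) := by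
    nth_rewrite 1 [scalar_sub]
    rw [Matrix.sub_mul, Matrix.sub_mul, h3, sub_zero, scalar_one, Matrix.one_mul]
  rcases hirr.conjRep.2 (1 - P) hQQ hQh h4 with h0 | h0
  · exfalso
    have hD0 : D = 0 := by rwa [← sub_eq_zero.1 h0, Matrix.mul_one] at hDP
    have := hirr.1
    rw [hD0, Matrix.mul_zero] at hD
    refine map_ne_zero_of_trace_eq hh ?_ hD
    rw [← conjTranspose_mul_of_mem_unitary hU]
    simp only [Matrix.mul_apply, conjTranspose_apply, hx, conjRep, map_apply, star_star]
    exact Finset.sum_comm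
  · rw [h0] at hC
    have hDC : D * C = 1 := mul_eq_one_comm.1 hC.symm
    refine ⟨scalar A (Dᴴ * D) * xᴴ * scalar A (C * Cᴴ), ?_⟩
    rw [← Matrix.mul_assoc, ← Matrix.mul_assoc, hF, ← scalar_mul, Matrix.mul_assoc,
      ← Matrix.mul_assoc D, hDC, Matrix.one_mul, ← conjTranspose_mul, ← hC, conjTranspose_one,
      scalar_one]

/-- The conjugate of an irreducible unitary representation is equivalent to a unitary one. -/
theorem exists_unitary_equivalent_conjRep [Nontrivial A] [DecidableEq ι] {y : Matrix ι ι A}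
    (hy : G.IsRep y) (hirr : IsIrreducible y) :
    ∃ x : Matrix ι ι A, G.IsRep x ∧ IsIrreducible x ∧ Equivalent x (conjRep y) := by
  obtain ⟨B, C, hCB, hE⟩ := exists_square_balance hy hirr
  obtain ⟨R, hR⟩ := exists_conjRep_mul_eq_one hy hirr
  have hBC : B * C = 1 := mul_eq_one_comm.1 hCB
  have hCB' : scalar A C * scalar A B = 1 := by rw [← scalar_mul, hCB, scalar_one]
  have hBC' : scalar A B * scalar A C = 1 := by rw [← scalar_mul, hBC, scalar_one]
  set x := scalar A B * conjRep y * scalar A C with hx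
  have h1 : scalar A C * x = conjRep y * scalar A C := by
    rw [hx, ← Matrix.mul_assoc, ← Matrix.mul_assoc, hCB', Matrix.one_mul]
  have h2 : scalar A B * conjRep y = x * scalar A B := by
    rw [hx, Matrix.mul_assoc, hCB', Matrix.mul_one]
  have hxx : xᴴ * x = 1 := by
    have : xᴴ = scalar A Cᴴ * (yᵀ * scalar A Bᴴ) := by
      rw [hx, conjTranspose_mul_scalar, conjTranspose_scalar_mul, conjTranspose_conjRep]
    calc xᴴ * x = scalar A Cᴴ * (yᵀ * scalar A (Bᴴ * B) * conjRep y) * scalar A C := by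
          rw [this, hx]; simp only [scalar_mul, Matrix.mul_assoc]
      _ = scalar A ((B * C)ᴴ * (B * C)) := by
          rw [hE, conjTranspose_mul]; simp only [scalar_mul, Matrix.mul_assoc]
      _ = 1 := by rw [hBC, Matrix.mul_one, conjTranspose_one, scalar_one]
  have hxr : x * (scalar A B * R * scalar A C) = 1 := by
    rw [← Matrix.mul_assoc, ← Matrix.mul_assoc, ← h2, Matrix.mul_assoc (scalar A B), hR,
      Matrix.mul_one, hBC']
  have hxx' : x * xᴴ = 1 := by
    have : xᴴ = scalar A B * R * scalar A C := by
      rw [← Matrix.mul_one xᴴ, ← hxr, ← Matrix.mul_assoc, hxx, Matrix.one_mul]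
    rw [this, hxr]
  refine ⟨x, isRep_iff.2 ⟨Unitary.mem_iff.2 ⟨hxx, hxx'⟩, ?_⟩, hirr.conjRep.of_similar hBC h2,
    C, B, hBC, hCB, h1⟩
  exact (isRep_iff.1 hy).2.conjRep.of_intertwines hBC h1

theorem Intertwines.comp {w : Matrix κ κ A} {v : Matrix ι ι A} {x : Matrix μ μ A}
    {T : Matrix κ μ ℂ} {V : Matrix ι κ ℂ} (hT : Intertwines x w T) (hV : Intertwines w v V) :
    Intertwines x v (V * T) := by
  rw [Intertwines] at hT hV ⊢
  rw [scalar_mul, Matrix.mul_assoc, hT, ← Matrix.mul_assoc, hV, Matrix.mul_assoc]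

theorem Intertwines.map_star {w : Matrix κ κ A} {v : Matrix ι ι A} {V : Matrix ι κ ℂ}
    (h : Intertwines w v V) : Intertwines (conjRep w) (conjRep v) (V.map star) := by
  have := congrArg (fun Y => Y.map star) (show scalar A V * w = v * scalar A V from h)
  rwa [map_star_scalar_mul, map_star_mul_scalar] at this

theorem map_star_mul_eq_one [DecidableEq ι] {S : Matrix ι κ ℂ} {T : Matrix κ ι ℂ} (h : S * T = 1) :
    S.map star * T.map star = 1 := by
  have h3 : (S * T).map star = S.map star * T.map star := by
    ext i j; simp [Matrix.mul_apply]
  rw [← h3, h]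
  ext i j
  by_cases hij : i = j <;> simp [Matrix.one_apply, hij]

theorem IsBalanced.of_intertwines [DecidableEq ι] [DecidableEq κ] {w : Matrix κ κ A}
    {v : Matrix ι ι A} (hv : IsBalanced v) {V : Matrix ι κ ℂ} {S : Matrix κ ι ℂ} (hS : S * V = 1)
    (h : Intertwines w v V) : IsBalanced w := by
  obtain ⟨m, _, B, C, hCB, hE⟩ := hv
  have h1 : scalar A (V.map star) * conjRep w = conjRep v * scalar A (V.map star) := h.map_star
  have h2 : wᵀ * scalar A (V.map star)ᴴ = scalar A (V.map star)ᴴ * vᵀ := by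
    have := congrArg conjTranspose h1
    rwa [conjTranspose_mul_scalar, conjTranspose_scalar_mul, conjTranspose_conjRep,
      conjTranspose_conjRep] at this
  refine ⟨m, inferInstance, B * V.map star, S.map star * C, ?_, ?_⟩
  · rw [Matrix.mul_assoc, ← Matrix.mul_assoc C, hCB, Matrix.one_mul]
    exact map_star_mul_eq_one hS
  · rw [conjTranspose_mul]
    calc _ = (wᵀ * scalar A (V.map star)ᴴ) * scalar A (Bᴴ * B) *
            (scalar A (V.map star) * conjRep w) := by simp only [scalar_mul, Matrix.mul_assoc]
      _ = scalar A (V.map star)ᴴ * (vᵀ * scalar A (Bᴴ * B) * conjRep v) *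
            scalar A (V.map star) := by rw [h1, h2]; simp only [Matrix.mul_assoc]
      _ = _ := by rw [hE]; simp only [scalar_mul, Matrix.mul_assoc]

theorem conjTranspose_kroneckerMap (B : Matrix μ ι ℂ) (D : Matrix ν κ ℂ) :
    (kroneckerMap (fun s t => s * t) B D)ᴴ = kroneckerMap (fun s t => s * t) Bᴴ Dᴴ := by
  ext ⟨i, k⟩ ⟨j, l⟩; simp

theorem kroneckerMap_one_one [DecidableEq ι] [DecidableEq κ] {R : Type v} [Semiring R] :
    kroneckerMap (fun s t => s * t) (1 : Matrix ι ι R) (1 : Matrix κ κ R) = 1 := by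
  ext ⟨i, k⟩ ⟨j, l⟩
  by_cases h1 : i = j <;> by_cases h2 : k = l <;> simp [Matrix.one_apply, h1, h2]

theorem IsBalanced.tensorRep [DecidableEq ι] [DecidableEq κ] {x : Matrix ι ι A} {y : Matrix κ κ A}
    (hx : IsBalanced x) (hy : IsBalanced y) : IsBalanced (tensorRep x y) := by
  obtain ⟨m, _, B, C, hCB, hE⟩ := hx
  obtain ⟨n, _, B', C', hCB', hE'⟩ := hy
  have hmul : ∀ {a b c d e f : Type} [Fintype b] [Fintype e] (x : Matrix a b ℂ)
      (x' : Matrix b c ℂ) (y : Matrix d e ℂ) (y' : Matrix e f ℂ),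
      kroneckerMap (fun s t => s * t) x y * kroneckerMap (fun s t => s * t) x' y' =
        kroneckerMap (fun s t => s * t) (x * x') (y * y') := fun x x' y y' =>
    kroneckerMap_mul_mul x x' y y' fun _ _ _ _ => mul_comm _ _
  refine ⟨m × n, inferInstance, kroneckerMap (fun s t => s * t) B B',
    kroneckerMap (fun s t => s * t) C C', ?_, ?_⟩
  · rw [hmul, hCB, hCB', kroneckerMap_one_one]
  · rw [conjTranspose_kroneckerMap, hmul]
    generalize Bᴴ * B = E at hE
    generalize B'ᴴ * B' = E' at hE'
    ext ⟨i, k⟩ ⟨j, l⟩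
    have h1 := congrFun (congrFun hE i) j
    have h2 := congrFun (congrFun hE' k) l
    rw [conjRep, transpose_mul_scalar_mul_map_star_apply] at h1 h2
    rw [conjRep, transpose_mul_scalar_mul_map_star_apply]
    simp only [Fintype.sum_prod_type]
    have h3 : scalar A (kroneckerMap (fun s t => s * t) E E') (i, k) (j, l) =
        scalar A E i j * scalar A E' k l := by simp [scalar]
    have h4 : scalar A E' k l = algebraMap ℂ A (E' k l) := rfl
    rw [h3, ← h1, Finset.sum_mul]
    refine Finset.sum_congr rfl fun p _ => ?_
    rw [Finset.sum_comm, Finset.sum_mul]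
    refine Finset.sum_congr rfl fun q _ => ?_
    rw [smul_mul_assoc, h4, mul_assoc, ← Algebra.commutes, ← h4, ← h2, ← mul_assoc, Finset.mul_sum,
      Finset.sum_mul, Finset.smul_sum]
    refine Finset.sum_congr rfl fun r _ => ?_
    rw [Finset.mul_sum, Finset.sum_mul, Finset.smul_sum]
    refine Finset.sum_congr rfl fun s _ => ?_
    simp only [kroneckerMap_apply, CompactQuantumGroup.tensorRep, mul_smul, mul_smul_comm,
      smul_mul_assoc, star_mul, mul_assoc]

theorem IsRep.tensorRep [DecidableEq ι] [DecidableEq κ] {x : Matrix ι ι A} {y : Matrix κ κ A}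
    (hx : G.IsRep x) (hy : G.IsRep y) : G.IsRep (tensorRep x y) := by
  obtain ⟨hxU, hxc⟩ := isRep_iff.1 hx
  obtain ⟨hyU, hyc⟩ := isRep_iff.1 hy
  refine isRep_iff.2 ⟨?_, hxc.tensorRep hyc⟩
  have h1 : CompactQuantumGroup.tensorRep x (1 : Matrix κ κ A) ∈
      unitary (Matrix (ι × κ) (ι × κ) A) := by
    have hs : star (CompactQuantumGroup.tensorRep x (1 : Matrix κ κ A)) =
        kroneckerMap (fun s t => s * t) xᴴ (1 : Matrix κ κ A) := by
      ext ⟨i, k⟩ ⟨j, l⟩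
      by_cases hkl : k = l <;>
        simp [CompactQuantumGroup.tensorRep, hkl, eq_comm]
    rw [Unitary.mem_iff, hs, CompactQuantumGroup.tensorRep, kroneckerMap_mul_mul,
      kroneckerMap_mul_mul, conjTranspose_mul_of_mem_unitary hxU,
      mul_conjTranspose_of_mem_unitary hxU, Matrix.one_mul, kroneckerMap_one_one]
    · exact ⟨rfl, rfl⟩
    all_goals
      intro i j k l
      by_cases hkl : k = l <;> simp [Matrix.one_apply, hkl]
  have h2 : CompactQuantumGroup.tensorRep (1 : Matrix ι ι A) y ∈
      unitary (Matrix (ι × κ) (ι × κ) A) := by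
    have hs : star (CompactQuantumGroup.tensorRep (1 : Matrix ι ι A) y) =
        kroneckerMap (fun s t => s * t) (1 : Matrix ι ι A) yᴴ := by
      ext ⟨i, k⟩ ⟨j, l⟩
      by_cases hkl : i = j <;>
        simp [CompactQuantumGroup.tensorRep, hkl, eq_comm]
    rw [Unitary.mem_iff, hs, CompactQuantumGroup.tensorRep, kroneckerMap_mul_mul,
      kroneckerMap_mul_mul, conjTranspose_mul_of_mem_unitary hyU,
      mul_conjTranspose_of_mem_unitary hyU, Matrix.one_mul, kroneckerMap_one_one]
    · exact ⟨rfl, rfl⟩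
    all_goals
      intro i j k l
      by_cases hkl : i = j <;> simp [Matrix.one_apply, hkl]
  have h3 : CompactQuantumGroup.tensorRep x y =
      CompactQuantumGroup.tensorRep x 1 * CompactQuantumGroup.tensorRep 1 y := by
    rw [CompactQuantumGroup.tensorRep, CompactQuantumGroup.tensorRep, CompactQuantumGroup.tensorRep,
      kroneckerMap_mul_mul, Matrix.mul_one, Matrix.one_mul]
    intro i j k l
    by_cases hkl : i = j <;> simp [Matrix.one_apply, hkl]
  rw [h3]
  exact mul_mem h1 h2

/-- A unitary representation restricts to the range of a projection that commutes with it. -/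
theorem IsRep.compress [DecidableEq ι] [DecidableEq κ] {v : Matrix ι ι A} (hv : G.IsRep v)
    {V : Matrix ι κ ℂ} (hV : Vᴴ * V = 1)
    (hc : scalar A (V * Vᴴ) * v = v * scalar A (V * Vᴴ)) :
    G.IsRep (scalar A Vᴴ * v * scalar A V) ∧
      Intertwines (scalar A Vᴴ * v * scalar A V) v V := by
  obtain ⟨hU, hvc⟩ := isRep_iff.1 hv
  set w := scalar A Vᴴ * v * scalar A V with hw
  have hV' : scalar A Vᴴ * scalar A V = 1 := by rw [← scalar_mul, hV, scalar_one]
  have h1 : scalar A V * w = v * scalar A V := by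
    rw [hw, ← Matrix.mul_assoc, ← Matrix.mul_assoc, ← scalar_mul, hc, Matrix.mul_assoc,
      ← scalar_mul, Matrix.mul_assoc, hV, Matrix.mul_one]
  have h2 : wᴴ = scalar A Vᴴ * vᴴ * scalar A V := by
    rw [hw, conjTranspose_mul_scalar, conjTranspose_scalar_mul, conjTranspose_conjTranspose,
      Matrix.mul_assoc]
  have h3 : w * scalar A Vᴴ = scalar A Vᴴ * v := by
    rw [hw, Matrix.mul_assoc, ← scalar_mul, Matrix.mul_assoc, ← hc, ← Matrix.mul_assoc,
      ← scalar_mul, ← Matrix.mul_assoc, hV, Matrix.one_mul]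
  refine ⟨isRep_iff.2 ⟨Unitary.mem_iff.2 ⟨?_, ?_⟩, hvc.of_intertwines hV h1⟩, h1⟩
  · rw [star_eq_conjTranspose, h2, Matrix.mul_assoc, h1, Matrix.mul_assoc (scalar A Vᴴ),
      ← Matrix.mul_assoc vᴴ, conjTranspose_mul_of_mem_unitary hU, Matrix.one_mul, hV']
  · rw [star_eq_conjTranspose, h2, ← Matrix.mul_assoc, ← Matrix.mul_assoc, h3,
      Matrix.mul_assoc (scalar A Vᴴ), mul_conjTranspose_of_mem_unitary hU, Matrix.mul_one, hV']

/-- The invariant subspaces of a balanced unitary representation are reducing. -/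
theorem IsRep.commute_of_invariant [Nontrivial A] [DecidableEq ι] {v : Matrix ι ι A}
    (hv : G.IsRep v) (hb : IsBalanced v) {P : Matrix ι ι ℂ} (hP : P * P = P) (hPh : Pᴴ = P)
    (hinv : scalar A P * v * scalar A P = v * scalar A P) :
    scalar A P * v = v * scalar A P := by
  obtain ⟨hU, hvc⟩ := isRep_iff.1 hv
  obtain ⟨h, hh, hF, -⟩ := hvc.exists_average
  replace hF := hF P
  have hv1 := conjTranspose_mul_of_mem_unitary hU
  have hv2 := mul_conjTranspose_of_mem_unitary hU
  set H := (v * scalar A P * vᴴ).map h with hH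
  -- `S` is the projection onto the orthogonal complement of the kernel of the average `H`; it
  -- commutes with `v` because `H` does, and `S ≤ P` because `H = H P`.
  have hvH : v * scalar A H = scalar A H * v := by
    calc v * scalar A H = v * scalar A H * vᴴ * v := by
          rw [Matrix.mul_assoc _ vᴴ v, hv1, Matrix.mul_one]
      _ = _ := by rw [hF]
  have hvH' : scalar A H * vᴴ = vᴴ * scalar A H := by
    calc scalar A H * vᴴ = vᴴ * (v * scalar A H) * vᴴ := by
          rw [← Matrix.mul_assoc, hv1, Matrix.one_mul]
      _ = vᴴ * scalar A H := by
          rw [hvH, Matrix.mul_assoc, Matrix.mul_assoc (scalar A H), hv2, Matrix.mul_one]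
  have hinv' : scalar A P * vᴴ * scalar A P = scalar A P * vᴴ := by
    have := congrArg conjTranspose hinv
    rwa [conjTranspose_mul_scalar, conjTranspose_scalar_mul, conjTranspose_mul_scalar, hPh,
      ← Matrix.mul_assoc] at this
  have hHP : H * P = H := by
    rw [hH, ← map_mul_scalar, Matrix.mul_assoc v, Matrix.mul_assoc v, hinv']
  obtain ⟨Z, C, hZ, hZh, hHZ, hC⟩ := exists_kernel_projection H
  have hz1 : scalar A (1 - Z) * v * scalar A Z = 0 := by
    rw [hC, scalar_mul, Matrix.mul_assoc (scalar A C), ← hvH, Matrix.mul_assoc, Matrix.mul_assoc v,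
      ← scalar_mul, hHZ, scalar_zero, Matrix.mul_zero, Matrix.mul_zero]
  have hz2 : scalar A (1 - Z) * vᴴ * scalar A Z = 0 := by
    rw [hC, scalar_mul, Matrix.mul_assoc (scalar A C), hvH', Matrix.mul_assoc, Matrix.mul_assoc vᴴ,
      ← scalar_mul, hHZ, scalar_zero, Matrix.mul_zero, Matrix.mul_zero]
  have hSh : (1 - Z)ᴴ = 1 - Z := by rw [conjTranspose_sub, conjTranspose_one, hZh]
  have hz3 : scalar A Z * v * scalar A (1 - Z) = 0 := by
    have := congrArg conjTranspose hz2
    rwa [conjTranspose_mul_scalar, conjTranspose_scalar_mul, conjTranspose_conjTranspose, hZh, hSh,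
      conjTranspose_zero, ← Matrix.mul_assoc] at this
  have hZv : scalar A Z * v = v * scalar A Z := by
    rw [scalar_sub, scalar_one, Matrix.sub_mul, Matrix.sub_mul, Matrix.one_mul, sub_eq_zero] at hz1
    rw [scalar_sub, scalar_one, Matrix.mul_sub, Matrix.mul_one, sub_eq_zero] at hz3
    rw [hz3, ← hz1]
  set S := 1 - Z with hS
  have hSv : scalar A S * v = v * scalar A S := by
    rw [hS, scalar_sub, scalar_one, Matrix.sub_mul, Matrix.mul_sub, Matrix.one_mul, Matrix.mul_one,
      hZv]
  have hSS : S * S = S := by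
    rw [hS, Matrix.mul_sub, Matrix.mul_one, Matrix.sub_mul, Matrix.one_mul, hZ, sub_self, sub_zero]
  have hSP : S * P = S := by rw [hC, Matrix.mul_assoc, hHP]
  have hPS : P * S = S := by
    have := congrArg conjTranspose hSP
    rwa [conjTranspose_mul, hPh, hSh] at this
  have hHS : H * S = H := by rw [hS, Matrix.mul_sub, Matrix.mul_one, hHZ, sub_zero]
  -- On the range of `K = P - S` the average `H` vanishes, which forces `K = 0`.
  suffices hK : P - S = 0 by rw [sub_eq_zero.1 hK, hSv]
  set K := P - S with hKdef
  have hKh : Kᴴ = K := by rw [hKdef, conjTranspose_sub, hPh, hSh]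
  have hKK : K * K = K := by
    rw [hKdef, Matrix.mul_sub, Matrix.sub_mul P S P, Matrix.sub_mul P S S, hP, hPS, hSP, hSS,
      sub_self, sub_zero]
  have hvK : scalar A K * v * scalar A K = v * scalar A K := by
    have e1 : scalar A P * v * scalar A S = v * scalar A S := by
      rw [Matrix.mul_assoc, ← hSv, ← Matrix.mul_assoc, ← scalar_mul, hPS]
    have e2 : scalar A S * v * scalar A P = v * scalar A S := by
      rw [hSv, Matrix.mul_assoc, ← scalar_mul, hSP]
    have e3 : scalar A S * v * scalar A S = v * scalar A S := by
      rw [hSv, Matrix.mul_assoc, ← scalar_mul, hSS]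
    rw [hKdef, scalar_sub, Matrix.sub_mul, Matrix.mul_sub, Matrix.sub_mul, Matrix.sub_mul, hinv, e1,
      e2, e3, sub_self, sub_zero, Matrix.mul_sub]
  have hvK' : scalar A K * vᴴ * scalar A K = scalar A K * vᴴ := by
    have := congrArg conjTranspose hvK
    rwa [conjTranspose_mul_scalar, conjTranspose_scalar_mul, conjTranspose_mul_scalar, hKh,
      ← Matrix.mul_assoc] at this
  have hzero : ((v * scalar A K) * (v * scalar A K)ᴴ).map h = 0 := by
    have e1 : (v * scalar A K) * (v * scalar A K)ᴴ = v * scalar A K * vᴴ := by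
      rw [conjTranspose_mul_scalar, hKh, ← Matrix.mul_assoc, Matrix.mul_assoc v, ← scalar_mul, hKK]
    have e2 : (v * scalar A K * vᴴ).map h = H - S := by
      have : v * scalar A K * vᴴ = v * scalar A P * vᴴ - scalar A S := by
        rw [hKdef, scalar_sub, Matrix.mul_sub, Matrix.sub_mul, ← hSv, Matrix.mul_assoc (scalar A S),
          hv2, Matrix.mul_one]
      rw [this, Matrix.map_sub _ (map_sub h), map_scalar hh]
    rw [e1, Matrix.mul_assoc, ← hvK', ← Matrix.mul_assoc, ← Matrix.mul_assoc, map_mul_scalar, e2,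
      hKdef, Matrix.mul_sub, Matrix.sub_mul H S P, Matrix.sub_mul H S S, hHP, hHS, hSP, hSS,
      sub_self]
  have hann := apply_mul_eq_zero_of_map_eq_zero hh hzero
  obtain ⟨m, _, B, D, hDB, hE⟩ := hb
  have hconj : (v * scalar A K).map star = conjRep v * scalar A (K.map star) :=
    map_star_mul_scalar v K
  have e3 : (v * scalar A K)ᵀ * scalar A (Bᴴ * B) * (v * scalar A K).map star =
      scalar A ((B * K.map star)ᴴ * (B * K.map star)) := by
    rw [hconj, transpose_mul_scalar]
    have hKt : (K.map star)ᴴ = Kᵀ := by ext i j; simp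
    calc _ = scalar A Kᵀ * (vᵀ * scalar A (Bᴴ * B) * conjRep v) * scalar A (K.map star) := by
          simp only [Matrix.mul_assoc]
      _ = _ := by rw [hE, conjTranspose_mul, hKt]; simp only [scalar_mul, Matrix.mul_assoc]
  have e4 : (B * K.map star)ᴴ * (B * K.map star) = 0 := by
    rw [← map_scalar hh ((B * K.map star)ᴴ * (B * K.map star)), ← e3]
    ext i k
    rw [map_apply, transpose_mul_scalar_mul_map_star_apply, map_sum]
    refine Finset.sum_eq_zero fun p _ => ?_
    rw [map_sum]
    exact Finset.sum_eq_zero fun q _ => by rw [map_smul, hann, smul_zero]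
  have e5 : B * K.map star = 0 := Matrix.conjTranspose_mul_self_eq_zero.1 e4
  have e6 : K.map star = 0 := by
    rw [← Matrix.one_mul (K.map star), ← hDB, Matrix.mul_assoc, e5, Matrix.mul_zero]
  ext i j
  have := congrFun (congrFun e6 i) j
  simpa using this

/-- Complete reducibility for representations on `ℂ^n`, by induction on `n`: a reducible
representation is restricted to a proper reducing subspace on which `Q` is not zero. -/
theorem exists_irrep_of_mul_ne_zero_fin [Nontrivial A] (n : ℕ) :
    ∀ (v : Matrix (Fin n) (Fin n) A), G.IsRep v → IsBalanced v → ∀ Q : Matrix κ (Fin n) ℂ, Q ≠ 0 →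
      ∃ (w : G.Irrep) (V : Matrix (Fin n) (Fin w.dim) ℂ), Intertwines w.mat v V ∧ Q * V ≠ 0 := by
  induction n using Nat.strong_induction_on with
  | _ n ih =>
  intro v hv hb Q hQ
  have : Nonempty (Fin n) := by
    by_contra hne
    rw [not_nonempty_iff] at hne
    exact hQ (by ext i j; exact hne.elim j)
  by_cases hirr : IsIrreducible v
  · refine ⟨⟨n, v, hv, hirr⟩, 1, ?_, by rwa [Matrix.mul_one]⟩
    change scalar A 1 * v = v * scalar A 1
    rw [scalar_one, Matrix.one_mul, Matrix.mul_one]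
  · rw [IsIrreducible] at hirr
    push Not at hirr
    obtain ⟨P, hP, hPh, hPv, hP0, hP1⟩ := hirr this
    have hc := hv.commute_of_invariant hb hP hPh hPv
    obtain ⟨R, hR, hRh, hRc, hR1, hQR⟩ : ∃ R : Matrix (Fin n) (Fin n) ℂ, R * R = R ∧ Rᴴ = R ∧
        scalar A R * v = v * scalar A R ∧ R ≠ 1 ∧ Q * R ≠ 0 := by
      -- One of `P` and `1 - P` is not annihilated by `Q`.
      by_cases hQP : Q * P = 0
      · refine ⟨1 - P, ?_, ?_, ?_, ?_, ?_⟩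
        · rw [Matrix.mul_sub, Matrix.mul_one, Matrix.sub_mul, Matrix.one_mul, hP, sub_self,
            sub_zero]
        · rw [conjTranspose_sub, conjTranspose_one, hPh]
        · rw [scalar_sub, scalar_one, Matrix.sub_mul, Matrix.mul_sub, Matrix.one_mul,
            Matrix.mul_one, hc]
        · intro h0
          exact hP0 (by simpa using h0)
        · rwa [Matrix.mul_sub, Matrix.mul_one, hQP, sub_zero]
      · exact ⟨P, hP, hPh, hc, hP1, hQP⟩
    obtain ⟨r, V, hV, hVR⟩ := exists_isometry_of_projection hR hRh
    have hle : r ≤ n := by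
      have hinj : Function.Injective V.mulVecLin := by
        refine Function.LeftInverse.injective (g := Vᴴ.mulVecLin) fun x => ?_
        rw [mulVecLin_apply, mulVecLin_apply, mulVec_mulVec, hV, one_mulVec]
      simpa using LinearMap.finrank_le_finrank_of_injective hinj
    have hlt : r < n := by
      refine lt_of_le_of_ne hle ?_
      rintro rfl
      exact hR1 (by rw [← hVR]; exact mul_eq_one_comm.1 hV)
    rw [← hVR] at hRc hQR
    obtain ⟨hw, hi⟩ := hv.compress hV hRc
    obtain ⟨w, W, hW, hQW⟩ := ih r hlt _ hw (hb.of_intertwines hV hi) (Q * V) (by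
      intro h0
      rw [← Matrix.mul_assoc, h0, Matrix.zero_mul] at hQR
      exact hQR rfl)
    exact ⟨w, V * W, hW.comp hi, by rwa [← Matrix.mul_assoc]⟩

/-- Complete reducibility: a non-zero linear map on the space of a balanced unitary representation
does not vanish on some irreducible subrepresentation. -/
theorem exists_irrep_of_mul_ne_zero [Nontrivial A] [DecidableEq ι] {v : Matrix ι ι A}
    (hv : G.IsRep v) (hb : IsBalanced v) {Q : Matrix κ ι ℂ} (hQ : Q ≠ 0) :
    ∃ (w : G.Irrep) (V : Matrix ι (Fin w.dim) ℂ), Intertwines w.mat v V ∧ Q * V ≠ 0 := by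
  obtain ⟨r, V, hV, hV1⟩ := exists_isometry_of_projection (Matrix.mul_one (1 : Matrix ι ι ℂ))
    conjTranspose_one
  obtain ⟨hw, hi⟩ := hv.compress hV (by rw [hV1, scalar_one, Matrix.one_mul, Matrix.mul_one])
  obtain ⟨w, W, hW, hQW⟩ := exists_irrep_of_mul_ne_zero_fin r _ hw (hb.of_intertwines hV hi) (Q * V)
    (by
      intro h0
      apply hQ
      rw [← Matrix.mul_one Q, ← hV1, ← Matrix.mul_assoc, h0, Matrix.zero_mul])
  exact ⟨w, V * W, hW.comp hi, by rwa [← Matrix.mul_assoc]⟩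

end CompactQuantumGroup

/-! ### Fusion rules -/

namespace CompactQuantumGroup

open MinTensor Matrix

variable {A : Type u} [CStarAlgebra A] {G : CompactQuantumGroup A}
variable {ι κ μ ν : Type} [Fintype ι] [Fintype κ] [Fintype μ] [Fintype ν]

/-- The adjoint of a morphism between unitary representations is a morphism. -/
theorem Intertwines.conjTranspose [DecidableEq ι] [DecidableEq κ] {w : Matrix κ κ A}
    {v : Matrix ι ι A} {T : Matrix ι κ ℂ} (hw : G.IsRep w) (hv : G.IsRep v)
    (h : Intertwines w v T) : Intertwines v w Tᴴ := by
  have h1 := congrArg Matrix.conjTranspose (show scalar A T * w = v * scalar A T from h)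
  rw [conjTranspose_mul_scalar, conjTranspose_scalar_mul] at h1
  have hw1 := mul_conjTranspose_of_mem_unitary hw.1
  have hv1 := conjTranspose_mul_of_mem_unitary hv.1
  change scalar A Tᴴ * v = w * scalar A Tᴴ
  calc scalar A Tᴴ * v = w * (wᴴ * scalar A Tᴴ) * v := by
        rw [← Matrix.mul_assoc, hw1, Matrix.one_mul]
    _ = w * scalar A Tᴴ := by
        rw [h1, Matrix.mul_assoc, Matrix.mul_assoc (scalar A Tᴴ), hv1, Matrix.mul_one]

theorem Intertwines.kroneckerMap {x : Matrix ι ι A} {x' : Matrix κ κ A} {y : Matrix μ μ A}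
    {y' : Matrix ν ν A} {S : Matrix κ ι ℂ} {T : Matrix ν μ ℂ} (hS : Intertwines x x' S)
    (hT : Intertwines y y' T) :
    Intertwines (tensorRep x y) (tensorRep x' y') (kroneckerMap (fun s t => s * t) S T) := by
  rw [Intertwines] at hS hT ⊢
  rw [← kroneckerMap_scalar, tensorRep, tensorRep, kroneckerMap_mul_mul, kroneckerMap_mul_mul, hS,
    hT]
  · intro i j k l
    exact Algebra.commutes _ _
  · intro i j k l
    exact (Algebra.commutes _ _).symm

theorem Intertwines.one [DecidableEq ι] (x : Matrix ι ι A) : Intertwines x x 1 := by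
  rw [Intertwines, scalar_one, Matrix.one_mul, Matrix.mul_one]

/-- Frobenius reciprocity: a morphism `x ⊗ y → w` yields a morphism `x → w ⊗ \bar y`. -/
theorem Intertwines.frobenius [DecidableEq κ] {x : Matrix ι ι A} {y : Matrix κ κ A}
    {w : Matrix μ μ A} (hy : y * yᴴ = 1) {Q : Matrix μ (ι × κ) ℂ}
    (h : Intertwines (tensorRep x y) w Q) :
    Intertwines x (tensorRep w (conjRep y)) (Matrix.of fun (p : μ × κ) i => Q p.1 (i, p.2)) := by
  have h' : ∀ p j l, ∑ i, ∑ m, Q p (i, m) • (x i j * y m l) = ∑ q, Q q (j, l) • w p q := by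
    intro p j l
    have := congrFun (congrFun (show scalar A Q * tensorRep x y = w * scalar A Q from h) p) (j, l)
    rw [scalar_mul_apply, mul_scalar_apply, Fintype.sum_prod_type] at this
    exact this
  have hy' : ∀ m k, ∑ l, y m l * star (y k l) = (1 : Matrix κ κ A) m k := fun m k => by
    rw [← hy, Matrix.mul_apply]; rfl
  change scalar A _ * x = tensorRep w (conjRep y) * scalar A _
  ext ⟨p, k⟩ j
  rw [scalar_mul_apply, mul_scalar_apply, Fintype.sum_prod_type]
  simp only [Matrix.of_apply]
  symm
  calc ∑ q, ∑ l, Q q (j, l) • tensorRep w (conjRep y) (p, k) (q, l) =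
        ∑ l, (∑ q, Q q (j, l) • w p q) * star (y k l) := by
        rw [Finset.sum_comm]
        refine Finset.sum_congr rfl fun l _ => ?_
        rw [Finset.sum_mul]
        exact Finset.sum_congr rfl fun q _ => by rw [smul_mul_assoc]; rfl
    _ = ∑ l, ∑ i, ∑ m, Q p (i, m) • (x i j * (y m l * star (y k l))) := by
        refine Finset.sum_congr rfl fun l _ => ?_
        rw [← h', Finset.sum_mul]
        refine Finset.sum_congr rfl fun i _ => ?_
        rw [Finset.sum_mul]
        exact Finset.sum_congr rfl fun m _ => by rw [smul_mul_assoc, mul_assoc]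
    _ = ∑ i, ∑ m, Q p (i, m) • (x i j * ∑ l, y m l * star (y k l)) := by
        rw [Finset.sum_comm]
        refine Finset.sum_congr rfl fun i _ => ?_
        rw [Finset.sum_comm]
        refine Finset.sum_congr rfl fun m _ => ?_
        rw [Finset.mul_sum, Finset.smul_sum]
    _ = ∑ i, Q p (i, k) • x i j := by
        refine Finset.sum_congr rfl fun i _ => ?_
        rw [Finset.sum_eq_single k]
        · rw [hy', Matrix.one_apply_eq, mul_one]
        · intro m _ hm
          rw [hy', Matrix.one_apply_ne hm, mul_zero, smul_zero]
        · intro hk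
          exact absurd (Finset.mem_univ k) hk

/-- Conjugation reverses the factors of a tensor product. -/
theorem Intertwines.conj_swap {x : Matrix ι ι A} {y : Matrix κ κ A} {w : Matrix μ μ A}
    {T : Matrix (ι × κ) μ ℂ} (h : Intertwines w (tensorRep x y) T) :
    Intertwines (conjRep w) (tensorRep (conjRep y) (conjRep x))
      (Matrix.of fun (p : κ × ι) q => star (T (p.2, p.1) q)) := by
  have h1 : scalar A (T.map star) * conjRep w = conjRep (tensorRep x y) * scalar A (T.map star) :=
    h.map_star
  change scalar A _ * conjRep w = tensorRep (conjRep y) (conjRep x) * scalar A _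
  ext ⟨k, i⟩ q
  have h2 := congrFun (congrFun h1 (i, k)) q
  rw [scalar_mul_apply, mul_scalar_apply, Fintype.sum_prod_type, Finset.sum_comm] at h2
  rw [scalar_mul_apply, mul_scalar_apply, Fintype.sum_prod_type]
  refine h2.trans (Finset.sum_congr rfl fun l _ => Finset.sum_congr rfl fun j _ => ?_)
  simp [conjRep, tensorRep]

/-- Reassociation of the tensor factors in the target of a morphism. -/
theorem Intertwines.assoc {x : Matrix ι ι A} {y : Matrix κ κ A} {z : Matrix ν ν A}
    {w : Matrix μ μ A} {T : Matrix ((ι × κ) × ν) μ ℂ}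
    (h : Intertwines w (tensorRep (tensorRep x y) z) T) :
    Intertwines w (tensorRep x (tensorRep y z))
      (Matrix.of fun (p : ι × κ × ν) q => T ((p.1, p.2.1), p.2.2) q) := by
  change scalar A _ * w = tensorRep x (tensorRep y z) * scalar A _
  ext ⟨i, k, m⟩ q
  have h2 := congrFun (congrFun
    (show scalar A T * w = tensorRep (tensorRep x y) z * scalar A T from h) ((i, k), m)) q
  rw [scalar_mul_apply, mul_scalar_apply] at h2
  rw [scalar_mul_apply, mul_scalar_apply]
  refine h2.trans ?_
  simp only [Fintype.sum_prod_type]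
  refine Finset.sum_congr rfl fun i' _ => Finset.sum_congr rfl fun k' _ =>
    Finset.sum_congr rfl fun m' _ => ?_
  simp [tensorRep, mul_assoc]

section Equivalent

variable [DecidableEq ι] [DecidableEq κ] [DecidableEq μ]

theorem Equivalent.symm {x : Matrix ι ι A} {y : Matrix κ κ A} (h : Equivalent x y) :
    Equivalent y x := by
  obtain ⟨T, S, h1, h2, h⟩ := h
  refine ⟨S, T, h2, h1, ?_⟩
  have h' : scalar A T * x = y * scalar A T := h
  have h1' : scalar A S * scalar A T = 1 := by rw [← scalar_mul, h1, scalar_one]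
  have h2' : scalar A T * scalar A S = 1 := by rw [← scalar_mul, h2, scalar_one]
  change scalar A S * y = x * scalar A S
  calc scalar A S * y = scalar A S * (y * scalar A T) * scalar A S := by
        rw [Matrix.mul_assoc, Matrix.mul_assoc, h2', Matrix.mul_one]
    _ = x * scalar A S := by rw [← h', ← Matrix.mul_assoc, h1', Matrix.one_mul]

theorem Equivalent.trans {x : Matrix ι ι A} {y : Matrix κ κ A} {z : Matrix μ μ A}
    (h : Equivalent x y) (h' : Equivalent y z) : Equivalent x z := by
  obtain ⟨T, S, h1, h2, h⟩ := h
  obtain ⟨T', S', h1', h2', h'⟩ := h'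
  refine ⟨T' * T, S * S', ?_, ?_, h.comp h'⟩
  · rw [Matrix.mul_assoc, ← Matrix.mul_assoc S', h1', Matrix.one_mul, h1]
  · rw [Matrix.mul_assoc, ← Matrix.mul_assoc T, h2, Matrix.one_mul, h2']

theorem Equivalent.conjRep {x : Matrix ι ι A} {y : Matrix κ κ A} (h : Equivalent x y) :
    Equivalent (conjRep x) (conjRep y) := by
  obtain ⟨T, S, h1, h2, h⟩ := h
  exact ⟨T.map star, S.map star, map_star_mul_eq_one h1, map_star_mul_eq_one h2, h.map_star⟩

theorem conjRep_conjRep (x : Matrix ι ι A) : conjRep (conjRep x) = x := by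
  ext i j; simp [CompactQuantumGroup.conjRep]

end Equivalent

theorem toDual_eq_iff {x y : G.Irrep} : G.toDual x = G.toDual y ↔ Equivalent x.mat y.mat :=
  ⟨fun h => Quotient.exact h, fun h => Quotient.sound h⟩

theorem exists_toDual_eq (a : G.Dual) : ∃ x : G.Irrep, G.toDual x = a := Quotient.exists_rep a

/-- By Schur's lemma, irreducible representations with a non-zero morphism between them are
equivalent. -/
theorem toDual_eq_of_intertwines {x y : G.Irrep} {T : Matrix (Fin y.dim) (Fin x.dim) ℂ}
    (h : Intertwines x.mat y.mat T) (h0 : T ≠ 0) : G.toDual x = G.toDual y := by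
  obtain ⟨C, hC⟩ := x.irreducible.exists_leftInverse h h0
  obtain ⟨D, hD⟩ := y.irreducible.exists_leftInverse (h.conjTranspose x.isRep y.isRep)
    (by rwa [Ne, conjTranspose_eq_zero])
  have hD' : T * Dᴴ = 1 := by
    have := congrArg Matrix.conjTranspose hD
    rwa [conjTranspose_mul, conjTranspose_conjTranspose, conjTranspose_one] at this
  have hCD : C = Dᴴ := by
    rw [← Matrix.mul_one C, ← hD', ← Matrix.mul_assoc, hC, Matrix.one_mul]
  exact toDual_eq_iff.2 ⟨T, C, hC, hCD ▸ hD', h⟩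

theorem mul_ne_zero_of_leftInverse [DecidableEq κ] {C : Matrix κ ι ℂ} {T : Matrix ι κ ℂ}
    (hC : C * T = 1) {X : Matrix κ μ ℂ} (hX : X ≠ 0) : T * X ≠ 0 := by
  intro h
  apply hX
  rw [← Matrix.one_mul X, ← hC, Matrix.mul_assoc, h, Matrix.mul_zero]

theorem mul_ne_zero_of_rightInverse [DecidableEq κ] {C : Matrix ι κ ℂ} {T : Matrix κ ι ℂ}
    (hC : T * C = 1) {X : Matrix μ κ ℂ} (hX : X ≠ 0) : X * T ≠ 0 := by
  intro h
  apply hX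
  rw [← Matrix.mul_one X, ← hC, ← Matrix.mul_assoc, h, Matrix.zero_mul]

theorem kroneckerMap_leftInverse [DecidableEq ι] [DecidableEq κ] {S : Matrix ι μ ℂ}
    {T : Matrix μ ι ℂ} {S' : Matrix κ ν ℂ} {T' : Matrix ν κ ℂ} (h : S * T = 1) (h' : S' * T' = 1) :
    kroneckerMap (fun s t => s * t) S S' * kroneckerMap (fun s t => s * t) T T' = 1 := by
  rw [kroneckerMap_mul_mul _ _ _ _ fun _ _ _ _ => mul_comm _ _, h, h', kroneckerMap_one_one]

/-- A class belongs to `a × b` as soon as there is a non-zero morphism from a representative of it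
to a representation equivalent to the tensor product. -/
theorem mem_fusion_of_intertwines {x y w : G.Irrep} [DecidableEq ι] [DecidableEq κ] [DecidableEq μ]
    {x' : Matrix ι ι A} {y' : Matrix κ κ A} {w' : Matrix μ μ A} (hx : Equivalent x.mat x')
    (hy : Equivalent y.mat y') (hw : Equivalent w.mat w') {T : Matrix (ι × κ) μ ℂ}
    (hT : Intertwines w' (tensorRep x' y') T) (h0 : T ≠ 0) :
    G.toDual w ∈ fusion (G.toDual x) (G.toDual y) := by
  obtain ⟨X, X', hX, -, hXi⟩ := hx.symm
  obtain ⟨Y, Y', hY, -, hYi⟩ := hy.symm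
  obtain ⟨W, W', -, hW, hWi⟩ := hw
  have hi := (hWi.comp hT).comp (hXi.kroneckerMap hYi)
  obtain ⟨C, hC⟩ := w.irreducible.exists_leftInverse hi
    (mul_ne_zero_of_leftInverse (kroneckerMap_leftInverse hX hY)
      (mul_ne_zero_of_rightInverse hW h0))
  refine ⟨x, y, w, rfl, rfl, rfl, _, ?_, hi⟩
  exact Function.LeftInverse.injective (g := C.mulVec) fun z => by
    rw [mulVec_mulVec, hC, one_mulVec]

theorem exists_intertwines_of_mem_fusion {x y w : G.Irrep}
    (h : G.toDual w ∈ fusion (G.toDual x) (G.toDual y)) :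
    ∃ T, Intertwines w.mat (tensorRep x.mat y.mat) T ∧ T ≠ 0 := by
  obtain ⟨x', y', w', hx, hy, hw, T, hT, hTi⟩ := h
  obtain ⟨X, X', hX, -, hXi⟩ := toDual_eq_iff.1 hx
  obtain ⟨Y, Y', hY, -, hYi⟩ := toDual_eq_iff.1 hy
  obtain ⟨W, W', -, hW, hWi⟩ := toDual_eq_iff.1 hw.symm
  have hT0 : T ≠ 0 := by
    rintro rfl
    obtain ⟨i⟩ := w'.irreducible.1
    have h1 := @hT (Pi.single i 1) 0 (by rw [zero_mulVec, zero_mulVec])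
    have h2 := congrFun h1 i
    simp at h2
  exact ⟨_, (hWi.comp hTi).comp (hXi.kroneckerMap hYi),
    mul_ne_zero_of_leftInverse (kroneckerMap_leftInverse hX hY)
      (mul_ne_zero_of_rightInverse hW hT0)⟩

theorem Equivalent.refl [DecidableEq ι] (x : Matrix ι ι A) : Equivalent x x :=
  ⟨1, 1, Matrix.one_mul 1, Matrix.one_mul 1, Intertwines.one x⟩

theorem IsConjugate.equivalent {x y : G.Irrep} (h : IsConjugate (G.toDual x) (G.toDual y)) :
    Equivalent y.mat (CompactQuantumGroup.conjRep x.mat) := by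
  obtain ⟨x', y', hx, hy, h⟩ := h
  exact ((toDual_eq_iff.1 hy.symm).trans h).trans (toDual_eq_iff.1 hx).conjRep

theorem IsConjugate.symm {a b : G.Dual} (h : IsConjugate a b) : IsConjugate b a := by
  obtain ⟨x, y, hx, hy, h⟩ := h
  refine ⟨y, x, hy, hx, ?_⟩
  have := h.conjRep
  rw [conjRep_conjRep] at this
  exact this.symm

theorem isConjugate_triv : IsConjugate G.triv G.triv := by
  refine ⟨_, _, rfl, rfl, ?_⟩
  have : CompactQuantumGroup.conjRep G.trivialIrrep.mat = G.trivialIrrep.mat := by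
    change (1 : Matrix (Fin 1) (Fin 1) A).map star = 1
    exact Matrix.map_one _ (star_zero A) (star_one A)
  rw [this]
  exact Equivalent.refl _

theorem mem_triv_fusion_iff {a c : G.Dual} : c ∈ fusion G.triv a ↔ c = a := by
  obtain ⟨x, rfl⟩ := exists_toDual_eq a
  obtain ⟨w, rfl⟩ := exists_toDual_eq c
  have hentry : ∀ k l : Fin x.dim, tensorRep (1 : Matrix (Fin 1) (Fin 1) A) x.mat (0, k) (0, l) =
      x.mat k l := fun k l => by simp [tensorRep]
  constructor
  · intro h
    obtain ⟨T, hT, h0⟩ := exists_intertwines_of_mem_fusion (x := G.trivialIrrep) h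
    change Matrix (Fin 1 × Fin x.dim) _ ℂ at T
    have hT' : scalar A T * w.mat =
        tensorRep (1 : Matrix (Fin 1) (Fin 1) A) x.mat * scalar A T := hT
    refine toDual_eq_of_intertwines (T := Matrix.of fun k p => T (0, k) p) ?_ ?_
    · change scalar A _ * w.mat = x.mat * scalar A _
      ext k p
      have h2 := congrFun (congrFun hT' (0, k)) p
      rw [scalar_mul_apply, mul_scalar_apply, Fintype.sum_prod_type, Fin.sum_univ_one] at h2
      rw [scalar_mul_apply, mul_scalar_apply]
      simp only [hentry] at h2
      exact h2
    · intro hz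
      apply h0
      ext ⟨i, k⟩ p
      rw [Subsingleton.elim i 0]
      exact congrFun (congrFun hz k) p
  · intro h
    rw [h]
    refine mem_fusion_of_intertwines (x := G.trivialIrrep)
      (Equivalent.refl (1 : Matrix (Fin 1) (Fin 1) A)) (Equivalent.refl x.mat)
      (Equivalent.refl x.mat)
      (T := Matrix.of fun p q => (1 : Matrix (Fin x.dim) (Fin x.dim) ℂ) p.2 q) ?_ ?_
    · change scalar A _ * x.mat = tensorRep (1 : Matrix (Fin 1) (Fin 1) A) x.mat * scalar A _
      ext ⟨i, k⟩ p
      rw [Subsingleton.elim i 0, scalar_mul_apply, mul_scalar_apply, Fintype.sum_prod_type,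
        Fin.sum_univ_one]
      simp [hentry, Matrix.one_apply, eq_comm]
    · intro hz
      obtain ⟨i⟩ := x.irreducible.1
      have := congrFun (congrFun hz (0, i)) i
      simp at this

variable [Nontrivial A]

theorem exists_isConjugate (a : G.Dual) : ∃ b, IsConjugate a b := by
  obtain ⟨x, rfl⟩ := exists_toDual_eq a
  obtain ⟨y, hy, hirr, h⟩ := exists_unitary_equivalent_conjRep x.isRep x.irreducible
  exact ⟨_, x, ⟨x.dim, y, hy, hirr⟩, rfl, rfl, h⟩

theorem fusion_nonempty (a b : G.Dual) : (fusion a b).Nonempty := by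
  obtain ⟨x, rfl⟩ := exists_toDual_eq a
  obtain ⟨y, rfl⟩ := exists_toDual_eq b
  obtain ⟨i⟩ := x.irreducible.1
  obtain ⟨k⟩ := y.irreducible.1
  have : Nonempty (Fin x.dim × Fin y.dim) := ⟨(i, k)⟩
  obtain ⟨w, V, hV, h0⟩ := exists_irrep_of_mul_ne_zero (x.isRep.tensorRep y.isRep)
    ((x.irreducible.isBalanced x.isRep).tensorRep (y.irreducible.isBalanced y.isRep))
    (one_ne_zero : (1 : Matrix (Fin x.dim × Fin y.dim) (Fin x.dim × Fin y.dim) ℂ) ≠ 0)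
  rw [Matrix.one_mul] at h0
  exact ⟨_, mem_fusion_of_intertwines (Equivalent.refl _) (Equivalent.refl _)
    (Equivalent.refl w.mat) hV h0⟩

/-- Frobenius reciprocity for classes. -/
theorem mem_fusion_of_isConjugate_right {a b b' c : G.Dual} (hb : IsConjugate b b')
    (h : c ∈ fusion a b) : a ∈ fusion c b' := by
  obtain ⟨x, rfl⟩ := exists_toDual_eq a
  obtain ⟨y, rfl⟩ := exists_toDual_eq b
  obtain ⟨y', rfl⟩ := exists_toDual_eq b'
  obtain ⟨w, rfl⟩ := exists_toDual_eq c
  obtain ⟨T, hT, h0⟩ := exists_intertwines_of_mem_fusion h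
  have hF := (hT.conjTranspose w.isRep (x.isRep.tensorRep y.isRep)).frobenius
    (mul_conjTranspose_of_mem_unitary y.isRep.1)
  refine mem_fusion_of_intertwines (Equivalent.refl w.mat) hb.equivalent (Equivalent.refl x.mat)
    hF ?_
  intro hz
  apply h0
  ext ⟨i, k⟩ p
  have := congrFun (congrFun hz (p, k)) i
  simpa using this

theorem mem_fusion_conj {a a' b b' c c' : G.Dual} (ha : IsConjugate a a') (hb : IsConjugate b b')
    (hc : IsConjugate c c') (h : c ∈ fusion a b) : c' ∈ fusion b' a' := by
  obtain ⟨x, rfl⟩ := exists_toDual_eq a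
  obtain ⟨y, rfl⟩ := exists_toDual_eq b
  obtain ⟨w, rfl⟩ := exists_toDual_eq c
  obtain ⟨x', rfl⟩ := exists_toDual_eq a'
  obtain ⟨y', rfl⟩ := exists_toDual_eq b'
  obtain ⟨w', rfl⟩ := exists_toDual_eq c'
  obtain ⟨T, hT, h0⟩ := exists_intertwines_of_mem_fusion h
  refine mem_fusion_of_intertwines hb.equivalent ha.equivalent hc.equivalent hT.conj_swap ?_
  intro hz
  apply h0
  ext ⟨i, k⟩ p
  have := congrFun (congrFun hz (k, i)) p
  simpa using this

/-- One half of the associativity of the fusion product; complete reducibility of `b ⊗ d` provides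
the intermediate class. -/
theorem exists_mem_fusion_assoc {a b c d e : G.Dual} (hc : c ∈ fusion a b) (he : e ∈ fusion c d) :
    ∃ f ∈ fusion b d, e ∈ fusion a f := by
  obtain ⟨x, rfl⟩ := exists_toDual_eq a
  obtain ⟨y, rfl⟩ := exists_toDual_eq b
  obtain ⟨w, rfl⟩ := exists_toDual_eq c
  obtain ⟨z, rfl⟩ := exists_toDual_eq d
  obtain ⟨t, rfl⟩ := exists_toDual_eq e
  obtain ⟨T, hT, hT0⟩ := exists_intertwines_of_mem_fusion hc
  obtain ⟨T', hT', hT0'⟩ := exists_intertwines_of_mem_fusion he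
  obtain ⟨C, hC⟩ := w.irreducible.exists_leftInverse hT hT0
  have hX := hT'.comp (hT.kroneckerMap (Intertwines.one z.mat))
  have hX0 := mul_ne_zero_of_leftInverse (kroneckerMap_leftInverse hC (Matrix.one_mul 1)) hT0'
  have hY := hX.assoc
  generalize Matrix.kroneckerMap (fun s t => s * t) T
    (1 : Matrix (Fin z.dim) (Fin z.dim) ℂ) * T' = X at hX0 hY
  -- `X` is regarded as a map on `y ⊗ z`; some irreducible subrepresentation `f` is not annihilated,
  -- so the composition of `X` with the projection onto `x ⊗ f` is not zero.
  let Q : Matrix (Fin x.dim × Fin t.dim) (Fin y.dim × Fin z.dim) ℂ :=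
    Matrix.of fun p q => star (X ((p.1, q.1), q.2) p.2)
  have hQ : Q ≠ 0 := by
    intro hz
    apply hX0
    ext ⟨⟨i, k⟩, m⟩ p
    have := congrFun (congrFun hz (i, p)) (k, m)
    simpa [Q] using this
  have hyz := y.isRep.tensorRep z.isRep
  obtain ⟨f, V, hV, h0⟩ := exists_irrep_of_mul_ne_zero hyz
    ((y.irreducible.isBalanced y.isRep).tensorRep (z.irreducible.isBalanced z.isRep)) hQ
  refine ⟨G.toDual f, mem_fusion_of_intertwines (Equivalent.refl _) (Equivalent.refl _)
    (Equivalent.refl f.mat) hV ?_, mem_fusion_of_intertwines (Equivalent.refl _) (Equivalent.refl _)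
    (Equivalent.refl t.mat) (hY.comp ((Intertwines.one x.mat).kroneckerMap
      (hV.conjTranspose f.isRep hyz))) ?_⟩
  · rintro rfl
    exact h0 (Matrix.mul_zero Q)
  · intro hz
    apply h0
    ext ⟨i, p⟩ s
    have h1 := congrArg star (congrFun (congrFun hz (i, s)) p)
    rw [Matrix.mul_apply, Fintype.sum_prod_type, Finset.sum_eq_single i] at h1
    · simp only [kroneckerMap_apply, Matrix.one_apply_eq, one_mul, star_sum, star_mul',
        conjTranspose_apply, star_star, Matrix.zero_apply, star_zero, Matrix.of_apply] at h1
      rw [Matrix.mul_apply, Matrix.zero_apply, ← h1]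
      exact Finset.sum_congr rfl fun q _ => mul_comm _ _
    · intro j _ hj
      exact Finset.sum_eq_zero fun q _ => by
        rw [kroneckerMap_apply, Matrix.one_apply_ne hj.symm, zero_mul, zero_mul]
    · intro hi
      exact absurd (Finset.mem_univ i) hi

end CompactQuantumGroup

/-! ### The chain group -/

namespace CompactQuantumGroup

variable {A : Type u} [CStarAlgebra A] {G : CompactQuantumGroup A} [Nontrivial A]

/-- The other half of associativity follows by conjugation. -/
theorem exists_mem_fusion_assoc' {a b c d e : G.Dual} (hc : c ∈ fusion b d)
    (he : e ∈ fusion a c) : ∃ f ∈ fusion a b, e ∈ fusion f d := by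
  obtain ⟨a', ha⟩ := exists_isConjugate a
  obtain ⟨b', hb⟩ := exists_isConjugate b
  obtain ⟨c', hc'⟩ := exists_isConjugate c
  obtain ⟨d', hd⟩ := exists_isConjugate d
  obtain ⟨e', he'⟩ := exists_isConjugate e
  obtain ⟨f', h1, h2⟩ := exists_mem_fusion_assoc (mem_fusion_conj hb hd hc' hc)
    (mem_fusion_conj ha hc' he' he)
  obtain ⟨f, hf⟩ := exists_isConjugate f'
  exact ⟨f, mem_fusion_conj hb.symm ha.symm hf h1, mem_fusion_conj hd.symm hf he'.symm h2⟩

theorem mem_fusion_triv (a : G.Dual) : a ∈ fusion a G.triv := by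
  obtain ⟨a', ha⟩ := exists_isConjugate a
  exact mem_fusion_conj isConjugate_triv ha.symm ha.symm (mem_triv_fusion_iff.2 rfl)

theorem triv_mem_fusion {a a' : G.Dual} (h : IsConjugate a a') : G.triv ∈ fusion a a' :=
  mem_fusion_of_isConjugate_right h (mem_triv_fusion_iff.2 rfl)

theorem setMul_mono {S S' T T' : Set G.Dual} (hS : S ⊆ S') (hT : T ⊆ T') :
    setMul S T ⊆ setMul S' T' := by
  rintro c ⟨a, ha, b, hb, hc⟩
  exact ⟨a, hS ha, b, hT hb, hc⟩

theorem setMul_assoc (S T U : Set G.Dual) : setMul (setMul S T) U = setMul S (setMul T U) := by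
  ext e
  constructor
  · rintro ⟨c, ⟨a, ha, b, hb, hc⟩, d, hd, he⟩
    obtain ⟨f, h1, h2⟩ := exists_mem_fusion_assoc hc he
    exact ⟨a, ha, f, ⟨b, hb, d, hd, h1⟩, h2⟩
  · rintro ⟨a, ha, c, ⟨b, hb, d, hd, hc⟩, he⟩
    obtain ⟨f, h1, h2⟩ := exists_mem_fusion_assoc' hc he
    exact ⟨f, ⟨a, ha, b, hb, h1⟩, d, hd, h2⟩

theorem triv_setMul (S : Set G.Dual) : setMul {G.triv} S = S := by
  ext c
  constructor
  · rintro ⟨_, rfl, b, hb, hc⟩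
    rwa [mem_triv_fusion_iff.1 hc]
  · intro hc
    exact ⟨_, rfl, c, hc, mem_triv_fusion_iff.2 rfl⟩

theorem listProd_append (l m : List G.Dual) :
    listProd (l ++ m) = setMul (listProd l) (listProd m) := by
  induction l with
  | nil => rw [List.nil_append, listProd, triv_setMul]
  | cons z l ih => rw [List.cons_append, listProd, ih, listProd, setMul_assoc]

theorem mem_listProd_singleton (a : G.Dual) : a ∈ listProd [a] :=
  ⟨a, rfl, G.triv, rfl, mem_fusion_triv a⟩

/-- Concatenation of sequences makes the chain relation compatible with products. -/
theorem ChainRel.fusion {a a' b b' c c' : G.Dual} (ha : G.ChainRel a a') (hb : G.ChainRel b b')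
    (hc : c ∈ fusion a b) (hc' : c' ∈ fusion a' b') : G.ChainRel c c' := by
  obtain ⟨l, hl, hl'⟩ := ha
  obtain ⟨m, hm, hm'⟩ := hb
  refine ⟨l ++ m, ?_, ?_⟩ <;> rw [listProd_append]
  exacts [⟨a, hl, b, hm, hc⟩, ⟨a', hl', b', hm', hc'⟩]

theorem ChainRel.refl (a : G.Dual) : G.ChainRel a a :=
  ⟨[a], mem_listProd_singleton a, mem_listProd_singleton a⟩

theorem ChainRel.symm {a b : G.Dual} (h : G.ChainRel a b) : G.ChainRel b a := by
  obtain ⟨l, h1, h2⟩ := h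
  exact ⟨l, h2, h1⟩

theorem ChainRel.trans {a b c : G.Dual} (h : G.ChainRel a b) (h' : G.ChainRel b c) :
    G.ChainRel a c := by
  obtain ⟨l, ha, hb⟩ := h
  obtain ⟨m, hb', hc⟩ := h'
  obtain ⟨b', hbb⟩ := exists_isConjugate b
  -- `a ∈ a × (b̄ × b)` and `c ∈ (b × b̄) × c` both lie in the product of `l`, `b̄` and `m`.
  refine ⟨l ++ ([b'] ++ m), ?_, ?_⟩
  · rw [listProd_append, listProd_append]
    exact ⟨a, ha, G.triv, ⟨b', mem_listProd_singleton b', b, hb', triv_mem_fusion hbb.symm⟩,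
      mem_fusion_triv a⟩
  · rw [listProd_append, listProd_append, ← setMul_assoc]
    exact ⟨G.triv, ⟨b, hb, b', mem_listProd_singleton b', triv_mem_fusion hbb⟩, c, hc,
      mem_triv_fusion_iff.2 rfl⟩

theorem chainRel_equivalence : Equivalence G.ChainRel :=
  ⟨ChainRel.refl, ChainRel.symm, ChainRel.trans⟩

/-- The set-wise product of two classes is the class of any element of the fusion product. -/
theorem setMul_classOf {a b c : G.Dual} (hc : c ∈ fusion a b) :
    setMul (classOf G.ChainRel a).1 (classOf G.ChainRel b).1 = (classOf G.ChainRel c).1 := by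
  ext e
  constructor
  · rintro ⟨x, hx, y, hy, he⟩
    exact ChainRel.fusion hx hy he hc
  · intro he
    obtain ⟨b', hb⟩ := exists_isConjugate b
    obtain ⟨x, hx⟩ := fusion_nonempty e b'
    exact ⟨x, ChainRel.fusion he (ChainRel.refl b') hx (mem_fusion_of_isConjugate_right hb hc), b,
      ChainRel.refl b, mem_fusion_of_isConjugate_right hb.symm hx⟩

/-- The set-wise product of classes of the chain relation. -/
def chainMul (C D : G.ChainGroup) : G.ChainGroup :=
  ⟨setMul C.1 D.1, by
    obtain ⟨_, a, rfl⟩ := C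
    obtain ⟨_, b, rfl⟩ := D
    obtain ⟨c, hc⟩ := fusion_nonempty a b
    exact ⟨c, setMul_classOf hc⟩⟩

theorem chainMul_classOf {a b c : G.Dual} (hc : c ∈ fusion a b) :
    chainMul (classOf G.ChainRel a) (classOf G.ChainRel b) = classOf G.ChainRel c :=
  Subtype.ext (setMul_classOf hc)

theorem exists_classOf_eq (C : G.ChainGroup) : ∃ a, C = classOf G.ChainRel a := by
  obtain ⟨a, ha⟩ := C.2
  exact ⟨a, Subtype.ext ha⟩

variable (G) in
/-- The chain group, with the set-wise product of classes. -/
abbrev chainGroup : Group G.ChainGroup :=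
  let _ : Mul G.ChainGroup := ⟨chainMul⟩
  let _ : One G.ChainGroup := ⟨classOf G.ChainRel G.triv⟩
  let _ : Inv G.ChainGroup :=
    ⟨fun C => classOf G.ChainRel (exists_isConjugate (exists_classOf_eq C).choose).choose⟩
  Group.ofLeftAxioms
    (fun C D E => Subtype.ext (setMul_assoc C.1 D.1 E.1))
    (fun C => by
      obtain ⟨a, rfl⟩ := exists_classOf_eq C
      exact chainMul_classOf (mem_triv_fusion_iff.2 rfl))
    (fun C => by
      change chainMul (classOf G.ChainRel _) C = classOf G.ChainRel G.triv
      conv_lhs => rw [(exists_classOf_eq C).choose_spec]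
      refine chainMul_classOf (triv_mem_fusion ?_)
      have h := (exists_isConjugate (exists_classOf_eq C).choose).choose_spec
      rw [← (exists_classOf_eq C).choose_spec]
      exact h.symm)

theorem cosetRel_chainSubobject_iff (a b : G.Dual) :
    CosetRel G.chainSubobject a b ↔ G.ChainRel a b := by
  constructor
  · rintro ⟨b', hb, x, hx, hx1⟩
    exact ChainRel.fusion hx1 (ChainRel.refl b) (mem_fusion_of_isConjugate_right hb.symm hx)
      (mem_triv_fusion_iff.2 rfl)
  · intro h
    obtain ⟨b', hb⟩ := exists_isConjugate b
    obtain ⟨x, hx⟩ := fusion_nonempty a b'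
    exact ⟨b', hb, x, hx, ChainRel.fusion h (ChainRel.refl b') hx (triv_mem_fusion hb)⟩

theorem cosetRel_chainSubobject : CosetRel G.chainSubobject = G.ChainRel :=
  funext fun a => funext fun b => propext (cosetRel_chainSubobject_iff a b)

theorem isSubobject_chainSubobject : IsSubobject G.chainSubobject where
  triv_mem := ChainRel.refl _
  fusion_subset _ ha _ hb _ hc := ChainRel.fusion ha hb hc (mem_triv_fusion_iff.2 rfl)
  conj_mem _ ha b hb := (ChainRel.fusion ha (ChainRel.refl b) (triv_mem_fusion hb)
    (mem_triv_fusion_iff.2 rfl)).symm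

/-- Transport of the chain group along an equality of relations. -/
theorem exists_group_of_eq_chainRel {R : G.Dual → G.Dual → Prop} (hR : R = G.ChainRel) :
    ∃ g : Group (Classes R), IsSetwise g ∧
      ∃ e : (letI := G.chainGroup; G.ChainGroup ≃* Classes R),
        ∀ a, e (classOf G.ChainRel a) = classOf R a := by
  subst hR
  exact ⟨G.chainGroup, fun C D => rfl, letI := G.chainGroup; MulEquiv.refl _, fun a => rfl⟩

theorem isCentral_chainSubobject : IsCentral G.chainSubobject := by
  obtain ⟨g, hg, -⟩ := exists_group_of_eq_chainRel (G := G) cosetRel_chainSubobject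
  exact ⟨isSubobject_chainSubobject, g, hg⟩

/-- Every product `z_1 × ⋯ × z_n` is contained in a single coset of a central subobject. -/
theorem IsCentral.exists_listProd_subset {S : Set G.Dual} (hS : IsCentral S) (l : List G.Dual) :
    ∃ C : Classes (CosetRel S), listProd l ⊆ C.1 := by
  obtain ⟨hsub, g, hg⟩ := hS
  have hrefl : ∀ a, CosetRel S a a := fun a => by
    obtain ⟨a', ha⟩ := exists_isConjugate a
    exact ⟨a', ha, G.triv, triv_mem_fusion ha, hsub.triv_mem⟩
  induction l with
  | nil =>
    refine ⟨classOf _ G.triv, ?_⟩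
    rintro _ rfl
    exact hrefl _
  | cons z l ih =>
    obtain ⟨C, hC⟩ := ih
    refine ⟨g.mul (classOf _ z) C, ?_⟩
    rw [hg]
    refine setMul_mono ?_ hC
    rintro _ rfl
    exact hrefl _

theorem IsCentral.chainSubobject_subset {S : Set G.Dual} (hS : IsCentral S) :
    G.chainSubobject ⊆ S := by
  rintro z ⟨l, hz, h1⟩
  obtain ⟨⟨_, x, rfl⟩, hC⟩ := hS.exists_listProd_subset l
  obtain ⟨x', hx, y, hy, hyS⟩ := hC h1
  obtain ⟨x'', hx', t, ht, htS⟩ := hC hz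
  rw [mem_triv_fusion_iff.1 hy] at hyS
  exact hS.1.fusion_subset t htS x (hS.1.conj_mem _ hyS _ hx.symm)
    (mem_fusion_of_isConjugate_right hx'.symm ht)

theorem centerSubobject_eq_chainSubobject : G.centerSubobject = G.chainSubobject :=
  Set.Subset.antisymm (Set.sInter_subset_of_mem isCentral_chainSubobject)
    (Set.subset_sInter fun _ hS => IsCentral.chainSubobject_subset hS)

end CompactQuantumGroup

end

theorem mainTheorem7 {A : Type*} [CStarAlgebra A] [Nontrivial A] (G : CompactQuantumGroup A) :
    Equivalence G.ChainRel ∧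
    CompactQuantumGroup.IsCentral G.chainSubobject ∧
    (∀ a b : G.Dual, CompactQuantumGroup.CosetRel G.chainSubobject a b ↔ G.ChainRel a b) ∧
    G.centerSubobject = G.chainSubobject ∧
    ∃ (gc : Group G.ChainGroup)
      (gE : Group (CompactQuantumGroup.Classes (CompactQuantumGroup.CosetRel G.chainSubobject)))
      (gZ : Group (CompactQuantumGroup.Classes (CompactQuantumGroup.CosetRel G.centerSubobject))),
      CompactQuantumGroup.IsSetwise gc ∧
      CompactQuantumGroup.IsSetwise gE ∧
      CompactQuantumGroup.IsSetwise gZ ∧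
      (1 : G.ChainGroup) = CompactQuantumGroup.classOf G.ChainRel G.triv ∧
      (∀ a b : G.Dual, CompactQuantumGroup.IsConjugate a b →
        (CompactQuantumGroup.classOf G.ChainRel a)⁻¹ =
          CompactQuantumGroup.classOf G.ChainRel b) ∧
      (∃ e : G.ChainGroup ≃*
          CompactQuantumGroup.Classes (CompactQuantumGroup.CosetRel G.chainSubobject),
        ∀ a : G.Dual, e (CompactQuantumGroup.classOf G.ChainRel a) =
          CompactQuantumGroup.classOf (CompactQuantumGroup.CosetRel G.chainSubobject) a) ∧
      (∃ e : G.ChainGroup ≃*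
          CompactQuantumGroup.Classes (CompactQuantumGroup.CosetRel G.centerSubobject),
        ∀ a : G.Dual, e (CompactQuantumGroup.classOf G.ChainRel a) =
          CompactQuantumGroup.classOf (CompactQuantumGroup.CosetRel G.centerSubobject) a) := by
  obtain ⟨gE, hE, eE, heE⟩ := CompactQuantumGroup.exists_group_of_eq_chainRel (G := G)
    CompactQuantumGroup.cosetRel_chainSubobject
  obtain ⟨gZ, hZ, eZ, heZ⟩ := CompactQuantumGroup.exists_group_of_eq_chainRel (G := G)
    (R := CompactQuantumGroup.CosetRel G.centerSubobject)
    (by rw [CompactQuantumGroup.centerSubobject_eq_chainSubobject,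
      CompactQuantumGroup.cosetRel_chainSubobject])
  refine ⟨CompactQuantumGroup.chainRel_equivalence,
    CompactQuantumGroup.isCentral_chainSubobject,
    CompactQuantumGroup.cosetRel_chainSubobject_iff,
    CompactQuantumGroup.centerSubobject_eq_chainSubobject, G.chainGroup, gE, gZ,
    fun _ _ => rfl, hE, hZ, rfl, fun a b h => ?_, ⟨eE, heE⟩, ⟨eZ, heZ⟩⟩
  let _ := G.chainGroup
  exact (eq_inv_of_mul_eq_one_left
    (CompactQuantumGroup.chainMul_classOf (CompactQuantumGroup.triv_mem_fusion h.symm))).symm
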